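/- Let $\mathbb F_q$ be the finite field with $q$ elements and $K$ a finite extension of the rational function field $\mathbb F_q(\theta)$, embedded in $\mathbb C_\infty$, the completion of an algebraic closure of $\mathbb F_q((1/\theta))$ with $|\theta|=q$. Let $K_\infty$ be the completion and $\bar K$ the algebraic closure of $K$ inside $\mathbb C_\infty$. Let $\mathbb T\subset\mathbb C_\infty[[t]]$ be the Tate algebra of power series converging for $|t|\le 1$, and $\mathbb E$ the ring of power series that converge on all of $\mathbb C_\infty$ and whose coefficients lie in a finite extension of $K_\infty$. Put $\tau(\sum x_it^i)=\sum x_i^qt^i$, $\sigma=\tau^{-1}$, $\partial_t^{(n)}(\sum x_it^i)=\sum\binom{i}{n}x_it^{i-n}$ (all applied to matrices entrywise), and for a square matrix $M$ let the prolongation $\rho_{[l]}(M)$ be the block upper triangular matrix with $(l+1)\times(l+1)$ blocks whose $(a,b)$ block, $a\le b$, is $\partial_t^{(b-a)}(M)$. Say that a pair $(\Phi,\Psi)$ of $n\times n$ matrices satisfies the ABP conditions if $\Phi\in \mathrm{Mat}_n(\bar K[t])$, $\det\Phi=c(t-\theta)^s$ for some $c\in\bar K^\times$ and $s\ge 1$,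 $\Psi\in \mathrm{GL}_n(\mathbb T)\cap \mathrm{Mat}_n(\mathbb E)$, and $\sigma(\Psi)=\Psi\Phi$. Let $E$ be a $t$-module over $K$ of dimension $d\ge 1$: an algebraic group $E\cong\mathbb G_a^d$ over $K$ with $t$ acting by an $\mathbb F_q$-linear endomorphism $\phi_t\in\mathrm{Mat}_d(K\{\tau\})$ such that $d\phi_t-\theta$ is nilpotent on $\mathrm{Lie}(E)$. Assume that $E$ is abelian (its $t$-motive $\mathsf M=\mathrm{Hom}_{\mathbb F_q}(E,\mathbb G_{a,K})$ is finitely generated over $K[t]$) and uniformizable (its exponential $\exp_E:\mathrm{Lie}(E)(\mathbb C_\infty)\to E(\mathbb C_\infty)$ is surjective), and let $\Lambda=\ker(\exp_E)$ be its period lattice, an $\mathbb F_q[t]$-module via $d\phi_t$. Let $m_1,\dots,m_r$ be a $K[t]$-basis of $\mathsf M$, let $\Theta\in\mathrm{Mat}_r(K[t])$ be given by $\tau(m_i)=\sum_j\Theta_{ij}m_j$, and let $\Upsilon\in\mathrm{GL}_r(\mathbb T)$ be a rigid analytic trivialization, i.e. $\tau(\Upsilon)\Theta=\Upsilon$. (1)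 For every $B\in\mathrm{GL}_r(K[t])$, put $\tilde\Theta=B\Theta\sigma(B)^{-1}$ and $R=\tau(\Upsilon)B^{-1}$. Then $(\tilde\Theta,R)$ and, for every $l\ge 0$, $(\rho_{[l]}(\tilde\Theta),\rho_{[l]}(R))$ satisfy the ABP conditions, and $\rho_{[l]}(R^{-1})=\rho_{[l]}(R)^{-1}$. (2) There are $B\in\mathrm{GL}_r(K[t])$, a coordinate system $E\cong\mathbb G_a^d$ and an $\mathbb F_q[t]$-basis $\lambda_1,\dots,\lambda_r$ of $\Lambda$ such that, for $R=\tau(\Upsilon)B^{-1}$, the coordinates of $\lambda_1,\dots,\lambda_r$ in the induced coordinate system of $\mathrm{Lie}(E)(\mathbb C_\infty)\cong\mathbb C_\infty^d$ are the values at $t=\theta$ of certain entries of $\rho_{[d-1]}(R)^{-1}$. More precisely, there are row indices $a_1,\dots,a_d$ and column indices $b_1,\dots,b_r$ such that the $(a_i,b_j)$ entry of $\rho_{[d-1]}(R)^{-1}$ converges at $t=\theta$, and its value there is the $i$-th coordinate of $\lambda_j$. -/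

import Mathlib

open Polynomial PowerSeries
open scoped NNReal WithZero

noncomputable section

namespace TPeriods

/-! ### The field `ℂ_∞` -/

section BaseField

variable (Fq : Type*) [Field Fq]

/-- The field `𝔽_q((1/θ))`, the completion of `𝔽_q(θ)` at the place at infinity. -/
abbrev LaurentInfty : Type _ := @RatFunc.CompletionAtInfty Fq _ (Classical.decEq _)

namespace LaurentInfty

instance : CompleteSpace (LaurentInfty Fq) :=
  @UniformSpace.Completion.completeSpace (RatFunc Fq)
    (@RatFunc.inftyValued Fq _ (Classical.decEq _)).toUniformSpace

theorem v_algebraMap_X :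
    Valued.v (algebraMap (RatFunc Fq) (LaurentInfty Fq) RatFunc.X) = WithZero.exp (1 : ℤ) := by
  let := Classical.decEq (RatFunc Fq)
  have h := @Valued.extensionValuation_apply_coe (RatFunc Fq) _ ℤᵐ⁰ _
    (RatFunc.inftyValued Fq) RatFunc.X
  refine Eq.trans h ?_
  exact RatFunc.inftyValuation.X Fq

variable [Fintype Fq]

/-- The valuation is turned into an absolute value with `|θ| = q`. -/
instance rankOne : (Valued.v (R := LaurentInfty Fq) (Γ₀ := ℤᵐ⁰)).RankOne where
  hom' := (WithZeroMulInt.toNNReal (e := (Fintype.card Fq : ℝ≥0))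
    (by exact_mod_cast Fintype.card_ne_zero)).comp MonoidWithZeroHom.ValueGroup₀.embedding
  strictMono' := (WithZeroMulInt.toNNReal_strictMono
    (by exact_mod_cast Fintype.one_lt_card)).comp
      MonoidWithZeroHom.ValueGroup₀.embedding_strictMono
  exists_val_nontrivial := ⟨algebraMap (RatFunc Fq) _ RatFunc.X, by
    rw [v_algebraMap_X]; exact ⟨by simp, by simp⟩⟩

instance : NontriviallyNormedField (LaurentInfty Fq) :=
  Valued.toNontriviallyNormedField (LaurentInfty Fq) ℤᵐ⁰

instance : IsUltrametricDist (LaurentInfty Fq) :=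
  inferInstanceAs (@IsUltrametricDist (LaurentInfty Fq)
    (Valued.toNormedField (LaurentInfty Fq) ℤᵐ⁰).toDist)

end LaurentInfty

variable [Fintype Fq]

/-- An algebraic closure of `𝔽_q((1/θ))`. -/
def AlgClInfty : Type _ := AlgebraicClosure (LaurentInfty Fq)

namespace AlgClInfty

instance : Field (AlgClInfty Fq) := inferInstanceAs (Field (AlgebraicClosure (LaurentInfty Fq)))

instance : Algebra (LaurentInfty Fq) (AlgClInfty Fq) :=
  inferInstanceAs (Algebra (LaurentInfty Fq) (AlgebraicClosure (LaurentInfty Fq)))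

instance : Algebra.IsAlgebraic (LaurentInfty Fq) (AlgClInfty Fq) :=
  inferInstanceAs (Algebra.IsAlgebraic (LaurentInfty Fq) (AlgebraicClosure (LaurentInfty Fq)))

instance : IsAlgClosed (AlgClInfty Fq) :=
  inferInstanceAs (IsAlgClosed (AlgebraicClosure (LaurentInfty Fq)))

/-- The unique extension of the absolute value. -/
instance : NontriviallyNormedField (AlgClInfty Fq) :=
  spectralNorm.nontriviallyNormedField (LaurentInfty Fq) (AlgClInfty Fq)

instance : IsUltrametricDist (AlgClInfty Fq) :=
  IsUltrametricDist.isUltrametricDist_of_forall_norm_add_le_max_norm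
    (isNonarchimedean_spectralNorm (K := LaurentInfty Fq) (L := AlgClInfty Fq))

end AlgClInfty

/-- The field `ℂ_∞`: the completion of an algebraic closure of `𝔽_q((1/θ))`. -/
def CInfty : Type _ := UniformSpace.Completion (AlgClInfty Fq)

namespace CInfty

instance : NormedField (CInfty Fq) :=
  inferInstanceAs (NormedField (UniformSpace.Completion (AlgClInfty Fq)))

instance : CompleteSpace (CInfty Fq) :=
  inferInstanceAs (CompleteSpace (UniformSpace.Completion (AlgClInfty Fq)))

instance : Algebra (AlgClInfty Fq) (CInfty Fq) :=
  inferInstanceAs (Algebra (AlgClInfty Fq) (UniformSpace.Completion (AlgClInfty Fq)))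

instance : IsUltrametricDist (CInfty Fq) := by
  refine IsUltrametricDist.isUltrametricDist_of_forall_norm_add_le_max_norm fun x y => ?_
  refine UniformSpace.Completion.induction_on₂ (α := AlgClInfty Fq) (β := AlgClInfty Fq)
    (p := fun x y => ‖x + y‖ ≤ max ‖x‖ ‖y‖) x y ?_ ?_
  · exact isClosed_le (by fun_prop) (by fun_prop)
  · intro a b
    rw [← UniformSpace.Completion.coe_add]
    simp only [UniformSpace.Completion.norm_coe]
    exact IsUltrametricDist.norm_add_le_max a b

instance : Algebra (RatFunc Fq) (CInfty Fq) :=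
  ((algebraMap (AlgClInfty Fq) (CInfty Fq)).comp
    ((algebraMap (LaurentInfty Fq) (AlgClInfty Fq)).comp
      (algebraMap (RatFunc Fq) (LaurentInfty Fq)))).toAlgebra

instance : Algebra Fq (CInfty Fq) :=
  ((algebraMap (RatFunc Fq) (CInfty Fq)).comp (algebraMap Fq (RatFunc Fq))).toAlgebra

instance : IsScalarTower Fq (RatFunc Fq) (CInfty Fq) := IsScalarTower.of_algebraMap_eq fun _ => rfl

/-- The element `θ` of `ℂ_∞`. -/
def theta : CInfty Fq := algebraMap (RatFunc Fq) (CInfty Fq) RatFunc.X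

theorem norm_theta : ‖theta Fq‖ = Fintype.card Fq := by
  have h1 : ‖theta Fq‖ = ‖algebraMap (LaurentInfty Fq) (AlgClInfty Fq)
      (algebraMap (RatFunc Fq) (LaurentInfty Fq) RatFunc.X)‖ :=
    UniformSpace.Completion.norm_coe _
  have h2 : ‖algebraMap (LaurentInfty Fq) (AlgClInfty Fq)
      (algebraMap (RatFunc Fq) (LaurentInfty Fq) RatFunc.X)‖ =
      ‖algebraMap (RatFunc Fq) (LaurentInfty Fq) RatFunc.X‖ :=
    spectralNorm_extends _
  have h3 : ‖algebraMap (RatFunc Fq) (LaurentInfty Fq) RatFunc.X‖ =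
      (WithZeroMulInt.toNNReal (e := (Fintype.card Fq : ℝ≥0))
        (by exact_mod_cast Fintype.card_ne_zero)
        (Valued.v (algebraMap (RatFunc Fq) (LaurentInfty Fq) RatFunc.X)) : ℝ) := by
    refine (Valued.toNormedField.norm_def (L := LaurentInfty Fq) (Γ₀ := ℤᵐ⁰)).trans ?_
    change ((WithZeroMulInt.toNNReal (e := (Fintype.card Fq : ℝ≥0))
      (by exact_mod_cast Fintype.card_ne_zero) (MonoidWithZeroHom.ValueGroup₀.embedding
      (Valued.v.restrict _)) : ℝ≥0) : ℝ) = _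
    rw [Valuation.embedding_restrict]
  rw [h1, h2, h3, LaurentInfty.v_algebraMap_X, WithZeroMulInt.toNNReal_neg_apply _ (by simp)]
  simp [WithZero.exp]

/-- Every element of `ℂ_∞` has a `q`-th root. -/
theorem pow_card_surjective : Function.Surjective fun x : CInfty Fq => x ^ Fintype.card Fq := by
  intro x
  obtain ⟨u, hu⟩ : ∃ u : ℕ → AlgClInfty Fq,
      Filter.Tendsto (fun n => algebraMap (AlgClInfty Fq) (CInfty Fq) (u n)) Filter.atTop
        (nhds x) := by
    have hd : DenseRange (algebraMap (AlgClInfty Fq) (CInfty Fq)) :=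
      UniformSpace.Completion.denseRange_coe
    obtain ⟨v, hv, hvx⟩ := mem_closure_iff_seq_limit.1 (hd x)
    choose u hu using hv
    exact ⟨u, by simpa only [hu] using hvx⟩
  choose w hw using fun n => IsAlgClosed.exists_pow_nat_eq (u n) (Fintype.card_pos (α := Fq))
  set b : ℕ → CInfty Fq := fun n => algebraMap (AlgClInfty Fq) (CInfty Fq) (w n) with hb
  have hbx : Filter.Tendsto (fun n => b n ^ Fintype.card Fq) Filter.atTop (nhds x) := by
    simpa only [hb, ← map_pow, hw] using hu
  have hsub : ∀ y z : CInfty Fq, (y - z) ^ Fintype.card Fq =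
      y ^ Fintype.card Fq - z ^ Fintype.card Fq := fun y z =>
    map_sub (FiniteField.frobeniusAlgHom Fq (CInfty Fq)) y z
  have hcau : CauchySeq b := by
    rw [Metric.cauchySeq_iff]
    intro ε hε
    obtain ⟨N, hN⟩ := Metric.cauchySeq_iff.1 hbx.cauchySeq (ε ^ Fintype.card Fq) (by positivity)
    refine ⟨N, fun m hm n hn => ?_⟩
    have h := hN m hm n hn
    rw [dist_eq_norm, ← hsub, norm_pow] at h
    rw [dist_eq_norm]
    exact lt_of_pow_lt_pow_left₀ _ hε.le h
  obtain ⟨y, hy⟩ := cauchySeq_tendsto_of_complete hcau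
  exact ⟨y, tendsto_nhds_unique (hy.pow _) hbx⟩

/-- The `q`-power Frobenius `x ↦ x ^ q` of `ℂ_∞`; its inverse is `x ↦ x ^ (1/q)`. -/
def frob : CInfty Fq ≃+* CInfty Fq :=
  RingEquiv.ofBijective (FiniteField.frobeniusAlgHom Fq (CInfty Fq))
    ⟨RingHom.injective _, pow_card_surjective Fq⟩

theorem frob_apply (x : CInfty Fq) : frob Fq x = x ^ Fintype.card Fq := rfl

end CInfty
end BaseField

/-! ### Power series over `ℂ_∞` -/

section Series

variable (Fq : Type*) [Field Fq] [Fintype Fq]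

/-- The twist `τ(∑ xᵢ tⁱ) = ∑ xᵢ^q tⁱ`. -/
def twist : (CInfty Fq)⟦X⟧ →+* (CInfty Fq)⟦X⟧ :=
  PowerSeries.map (CInfty.frob Fq : CInfty Fq →+* CInfty Fq)

/-- The inverse twist `σ(∑ xᵢ tⁱ) = ∑ xᵢ^(1/q) tⁱ`. -/
def invTwist : (CInfty Fq)⟦X⟧ →+* (CInfty Fq)⟦X⟧ :=
  PowerSeries.map ((CInfty.frob Fq).symm : CInfty Fq →+* CInfty Fq)

/-- The Tate algebra `𝕋` of power series that converge for `|t| ≤ 1`. -/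
def tateAlgebra : Subring (CInfty Fq)⟦X⟧ := PowerSeries.IsRestricted.subring 1

variable {Fq}

/-- The `n`-th hyperderivative `∑ xᵢ tⁱ ↦ ∑ (i choose n) xᵢ tⁱ⁻ⁿ` with respect to `t`. -/
def hyperDeriv (n : ℕ) (f : (CInfty Fq)⟦X⟧) : (CInfty Fq)⟦X⟧ :=
  PowerSeries.mk fun i => ((i + n).choose n : CInfty Fq) * PowerSeries.coeff (i + n) f

/-- The `n`-th prolongation `ρ_[n]` of a square matrix: the block upper triangular matrix with
`(n + 1) × (n + 1)` blocks whose block in position `(a, b)`, `a ≤ b`, is the `(b - a)`-th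
hyperderivative of the given matrix. -/
def prolongation {ι : Type*} (n : ℕ) (M : Matrix ι ι (CInfty Fq)⟦X⟧) :
    Matrix (Fin (n + 1) × ι) (Fin (n + 1) × ι) (CInfty Fq)⟦X⟧ :=
  fun x y => if x.1 ≤ y.1 then hyperDeriv ((y.1 : ℕ) - (x.1 : ℕ)) (M x.2 y.2) else 0

/-- `f` converges at `t = θ` and has the value `v` there. -/
def HasValueAtTheta (f : (CInfty Fq)⟦X⟧) (v : CInfty Fq) : Prop :=
  HasSum (fun n => PowerSeries.coeff n f * CInfty.theta Fq ^ n) v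

variable (K : Type*) [Field K] [Algebra K (CInfty Fq)]

/-- The inclusion `K[t] ⊆ ℂ_∞⟦t⟧`. -/
def polyToSeries : K[X] →+* (CInfty Fq)⟦X⟧ :=
  Polynomial.coeToPowerSeries.ringHom.comp
    (Polynomial.mapRingHom (algebraMap K (CInfty Fq)))

/-- The completion `K_∞` of `K`, realized as the closure of `K` in `ℂ_∞`. -/
def KInfty : Subfield (CInfty Fq) := (algebraMap K (CInfty Fq)).fieldRange.topologicalClosure

/-- Membership in the ring `𝔼` of entire functions: `f` converges on all of `ℂ_∞` and its
coefficients lie in a finite extension of `K_∞`. -/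
def IsEntire (f : (CInfty Fq)⟦X⟧) : Prop :=
  (∀ z : CInfty Fq, Summable fun n => PowerSeries.coeff n f * z ^ n) ∧
    ∃ L : IntermediateField (KInfty (Fq := Fq) K) (CInfty Fq),
      FiniteDimensional (KInfty (Fq := Fq) K) L ∧ ∀ n, PowerSeries.coeff n f ∈ L

/-- The hypotheses of the criterion of Anderson, Brownawell and Papanikolas on a pair `(Φ, Ψ)`. -/
structure ABPConditions {ι : Type*} [Fintype ι] [DecidableEq ι]
    (Φ Ψ : Matrix ι ι (CInfty Fq)⟦X⟧) : Prop where
  /-- `Φ` has entries in `K̄[t]`, where `K̄` is the algebraic closure of `K` in `ℂ_∞`. -/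
  poly : ∃ P : Matrix ι ι (algebraicClosure K (CInfty Fq))[X],
    Φ = P.map (polyToSeries (algebraicClosure K (CInfty Fq)))
  /-- `det Φ = c (t - θ)^s` with `c ∈ K̄ \ {0}` and `s ≥ 1`. -/
  det : ∃ c : algebraicClosure K (CInfty Fq), c ≠ 0 ∧ ∃ s : ℕ, 1 ≤ s ∧
    Φ.det = PowerSeries.C (c : CInfty Fq) *
      (PowerSeries.X - PowerSeries.C (CInfty.theta Fq)) ^ s
  /-- `Ψ ∈ GL(𝕋)`. -/
  tate : ∃ g : GL ι (tateAlgebra Fq), Ψ = g.1.map (tateAlgebra Fq).subtype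
  /-- `Ψ` has entries in `𝔼`. -/
  entire : ∀ i j, IsEntire K (Ψ i j)
  /-- `σ(Ψ) = Ψ Φ`. -/
  eqn : Ψ.map (invTwist Fq) = Ψ * Φ

end Series

/-! ### Twisted polynomials and `t`-modules -/

theorem theta_pow_ne {Fq K : Type*} [Field Fq] [Field K] [Algebra (RatFunc Fq) K] {m : ℕ} (hm : 1 < m) :
    (algebraMap (RatFunc Fq) K RatFunc.X) ^ m ≠ algebraMap (RatFunc Fq) K RatFunc.X := by
  rw [← map_pow, Ne, (algebraMap (RatFunc Fq) K).injective.eq_iff, ← RatFunc.algebraMap_X,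
    ← map_pow, (RatFunc.algebraMap_injective Fq).eq_iff]
  intro h
  have := congrArg Polynomial.natDegree h
  simp at this
  omega

section TModules

variable (Fq : Type*) [Field Fq] [Fintype Fq] (K : Type*) [Field K] [Algebra Fq K]

/-- The action of `τ` on `K` by the `q`-power Frobenius. -/
abbrev frobAction : MulSemiringAction (Multiplicative ℕ) K :=
  MulSemiringAction.compHom K
    (powersHom (K →+* K) (FiniteField.frobeniusAlgHom Fq K : K →+* K))

/-- The ring `K{τ}` of twisted polynomials, `τ x = x^q τ`; it is the ring of `𝔽_q`-linear
endomorphisms of the group scheme `𝔾_a` over `K`. -/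
def TwistedPoly (_Fq : Type*) (K : Type*) [Field K] : Type _ := SkewPolynomial K

namespace TwistedPoly

instance : Ring (TwistedPoly Fq K) :=
  letI := frobAction Fq K
  inferInstanceAs (Ring (SkewPolynomial K))

instance : Module K (TwistedPoly Fq K) :=
  inferInstanceAs (Module K (SkewPolynomial K))

variable {Fq K}

/-- The coefficient of `τ ^ n`. -/
def coeff (f : TwistedPoly Fq K) (n : ℕ) : K := SkewPolynomial.coeff f n

/-- The twisted polynomial `a τ ^ n`. -/
def monomial (n : ℕ) (a : K) : TwistedPoly Fq K := SkewPolynomial.monomial n a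

theorem monomial_mul_monomial (n m : ℕ) (a b : K) :
    (monomial n a * monomial m b : TwistedPoly Fq K) =
      monomial (n + m) (a * b ^ Fintype.card Fq ^ n) := by
  let := frobAction Fq K
  refine (SkewPolynomial.monomial_mul_monomial n m a b).trans ?_
  have h : ∀ n, (SkewPolynomial.φ^[n] b : K) = b ^ Fintype.card Fq ^ n := by
    intro n
    induction n with
    | zero => simp
    | succ n ih =>
      rw [Function.iterate_succ_apply', ih, pow_succ, pow_mul]
      rfl
  rw [h]
  rfl

theorem smul_mul (a : K) (f g : TwistedPoly Fq K) : (a • f) * g = a • (f * g) := by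
  let := frobAction Fq K
  have h : ∀ f : SkewPolynomial K, a • f = SkewPolynomial.C a * f := by
    intro f
    induction f using SkewPolynomial.induction with
    | h0 => simp
    | ha n r q _ _ ih => rw [smul_add, mul_add, ih, SkewPolynomial.smul_monomial,
        SkewPolynomial.C_mul_monomial, smul_eq_mul]
  have key : ∀ f g : SkewPolynomial K, (a • f) * g = a • (f * g) := by
    intro f g
    rw [h, h, mul_assoc]
  exact key f g

end TwistedPoly

/-- A `t`-module `E` of dimension `d` over `K`, written in a coordinate system `E ≅ 𝔾_a^d`:
the `𝔽_q[t]`-action `φ` is given by `φ_t ∈ Mat_d(K{τ}) = End_{𝔽_q}(𝔾_a^d)`, and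
`dφ_t - θ` is nilpotent on the Lie algebra. -/
structure TModule [Algebra (RatFunc Fq) K] (d : ℕ) where
  /-- The endomorphism `φ_t`. -/
  phi : Matrix (Fin d) (Fin d) (TwistedPoly Fq K)
  /-- The action of `t` on the Lie algebra is `θ` plus a nilpotent endomorphism. -/
  isNilpotent : IsNilpotent (phi.map (fun f => f.coeff 0) -
    Matrix.scalar (Fin d) (algebraMap (RatFunc Fq) K RatFunc.X))

namespace TModule

variable {Fq K} [Algebra (RatFunc Fq) K] {d : ℕ} (E : TModule Fq K d)

/-- The coefficient matrix of `τ ^ n` in `φ_t`. -/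
def phiCoeff (n : ℕ) : Matrix (Fin d) (Fin d) K := E.phi.map (fun f => f.coeff n)

/-- The matrix of `dφ_t` on `Lie(E)`. -/
abbrev dphi : Matrix (Fin d) (Fin d) K := E.phiCoeff 0

variable (Fq) in
/-- The `n`-th twist of a matrix over `K`: raise all entries to the power `q ^ n`. -/
def matTwist (n : ℕ) (M : Matrix (Fin d) (Fin d) K) : Matrix (Fin d) (Fin d) K :=
  M.map fun x => x ^ Fintype.card Fq ^ n

/-- The `K`-linear operator `X ↦ X (dφ_t)^(n) - (dφ_t) X` on `d × d` matrices. -/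
def sylvester (n : ℕ) : Matrix (Fin d) (Fin d) K →ₗ[K] Matrix (Fin d) (Fin d) K :=
  LinearMap.mulRight K (matTwist Fq n E.dphi) - LinearMap.mulLeft K E.dphi

theorem sylvester_bijective [IsScalarTower Fq (RatFunc Fq) K] (n : ℕ) :
    Function.Bijective (E.sylvester (n + 1)) := by
  rw [← Module.End.isUnit_iff]
  set θ : K := algebraMap (RatFunc Fq) K RatFunc.X with hθ
  set F : K →+* K := ((FiniteField.frobeniusAlgHom Fq K : K →+* K) ^ (n + 1)) with hF
  have hFx : ∀ x, F x = x ^ Fintype.card Fq ^ (n + 1) := by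
    have : ∀ k : ℕ, ∀ x, ((FiniteField.frobeniusAlgHom Fq K : K →+* K) ^ k) x =
        x ^ Fintype.card Fq ^ k := by
      intro k
      induction k with
      | zero => intro x; simp
      | succ k ih =>
        intro x
        rw [pow_succ', RingHom.mul_def, RingHom.comp_apply, ih, pow_succ, pow_mul]
        rfl
    exact this (n + 1)
  set N := E.dphi - Matrix.scalar (Fin d) θ with hN
  have hNn : IsNilpotent N := E.isNilpotent
  set N' := F.mapMatrix N with hN'
  have hNn' : IsNilpotent N' := hNn.map F.mapMatrix
  have hD' : matTwist Fq (n + 1) E.dphi = N' + Matrix.scalar (Fin d) (F θ) := by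
    have h1 : matTwist Fq (n + 1) E.dphi = F.mapMatrix E.dphi := by
      ext i j
      simp [matTwist, hFx]
    have h2 : F.mapMatrix (Matrix.scalar (Fin d) θ) = Matrix.scalar (Fin d) (F θ) := by
      ext i j
      by_cases h : i = j <;> simp [h]
    rw [h1, hN', hN, map_sub, h2, sub_add_cancel]
  have hc : F θ - θ ≠ 0 := by
    rw [hFx, sub_ne_zero]
    exact theta_pow_ne (Fq := Fq) (Nat.one_lt_pow (by omega) Fintype.one_lt_card)
  have hS : E.sylvester (n + 1) = algebraMap K _ (F θ - θ) +
      (LinearMap.mulRight K N' - LinearMap.mulLeft K N) := by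
    have hD : E.dphi = N + Matrix.scalar (Fin d) θ := by rw [hN, sub_add_cancel]
    refine LinearMap.ext fun X => ?_
    rw [sylvester, hD', hD]
    simp only [LinearMap.sub_apply, LinearMap.add_apply, LinearMap.mulRight_apply,
      LinearMap.mulLeft_apply, Module.algebraMap_end_apply, mul_add, add_mul, sub_smul]
    have e1 : X * Matrix.scalar (Fin d) (F θ) = F θ • X := by
      rw [Matrix.scalar_apply, ← Matrix.smul_one_eq_diagonal]; simp
    have e2 : Matrix.scalar (Fin d) θ * X = θ • X := by
      rw [Matrix.scalar_apply, ← Matrix.smul_one_eq_diagonal]; simp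
    rw [e1, e2]
    abel
  rw [hS]
  have hnil : IsNilpotent (LinearMap.mulRight K N' - LinearMap.mulLeft K N) :=
    Commute.isNilpotent_sub (LinearMap.commute_mulLeft_right (R := K) N N').symm
      ((LinearMap.isNilpotent_mulRight_iff K N').2 hNn')
      ((LinearMap.isNilpotent_mulLeft_iff K N).2 hNn)
  exact hnil.isUnit_add_left_of_commute ((isUnit_iff_ne_zero.2 hc).map (algebraMap K _))
    (Algebra.commutes _ _).symm

variable [IsScalarTower Fq (RatFunc Fq) K]

/-- The coefficients `e_n` of the exponential `e = ∑ e_n τ^n` of `E`, determined recursively by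
`e_0 = 1` and `e dφ_t = φ_t e`. -/
def expCoeff : ℕ → Matrix (Fin d) (Fin d) K
  | 0 => 1
  | n + 1 => (LinearEquiv.ofBijective _ (E.sylvester_bijective n)).symm
      (∑ k : Fin (n + 1), E.phiCoeff (k + 1) * matTwist Fq (k + 1) (expCoeff (n - k)))

theorem expCoeff_zero : E.expCoeff 0 = 1 := by rw [expCoeff]

/-- The functional equation `e dφ_t = φ_t e` of the exponential, coefficient by coefficient. -/
theorem expCoeff_mul (n : ℕ) : E.expCoeff n * matTwist Fq n E.dphi =
    ∑ k ∈ Finset.range (n + 1), E.phiCoeff k * matTwist Fq k (E.expCoeff (n - k)) := by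
  have hz : ∀ M : Matrix (Fin d) (Fin d) K, matTwist Fq 0 M = M := fun M => by
    ext; simp [matTwist]
  cases n with
  | zero => simp [expCoeff_zero, hz]
  | succ n =>
    have h := (LinearEquiv.ofBijective _ (E.sylvester_bijective n)).apply_symm_apply
      (∑ k : Fin (n + 1), E.phiCoeff (k + 1) * matTwist Fq (k + 1) (E.expCoeff (n - k)))
    rw [← expCoeff, LinearEquiv.ofBijective_apply, sylvester, LinearMap.sub_apply,
      LinearMap.mulRight_apply, LinearMap.mulLeft_apply, sub_eq_iff_eq_add] at h
    rw [h, Finset.sum_range_succ', hz, Finset.sum_range, Nat.sub_zero]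
    simp

/-- The `t`-motive of `E`: the `𝔽_q`-linear homomorphisms `E → 𝔾_a` over `K`, i.e. row vectors
over `K{τ}`, with `K` acting on the left and `t` acting by `m ↦ m ∘ φ_t`. -/
def motiveT : Module.End K (Fin d → TwistedPoly Fq K) where
  toFun m := Matrix.vecMul m E.phi
  map_add' m n := Matrix.add_vecMul _ _ _
  map_smul' a m := by
    ext j
    simp only [Matrix.vecMul, dotProduct, Pi.smul_apply, RingHom.id_apply, Finset.smul_sum,
      TwistedPoly.smul_mul]

/-- The `t`-motive of `E`, as a `K[t]`-module. -/
abbrev Motive : Type _ := Module.AEval' E.motiveT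

/-- The action of `τ` on the `t`-motive: `m ↦ τ ∘ m`. -/
def motiveTau (m : E.Motive) : E.Motive :=
  Module.AEval'.of E.motiveT fun j =>
    TwistedPoly.monomial 1 1 * (Module.AEval'.of E.motiveT).symm m j

/-- `E` is abelian: its `t`-motive is finitely generated over `K[t]`. -/
def IsAbelian : Prop := Module.Finite K[X] E.Motive

variable [Algebra K (CInfty Fq)] [IsScalarTower (RatFunc Fq) K (CInfty Fq)]

/-- The exponential `Lie(E)(ℂ_∞) → E(ℂ_∞)`, `z ↦ ∑ e_n z^(n)`. -/
def exp (z : Fin d → CInfty Fq) : Fin d → CInfty Fq :=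
  ∑' n : ℕ, ((E.expCoeff n).map (algebraMap K (CInfty Fq))).mulVec
    fun i => z i ^ Fintype.card Fq ^ n

/-- `E` is uniformizable: its exponential is surjective. -/
def IsUniformizable : Prop := Function.Surjective E.exp

/-- `dφ_t` as an endomorphism of `Lie(E)(ℂ_∞)`. -/
def lieT : Module.End Fq (Fin d → CInfty Fq) :=
  (Matrix.mulVecLin (E.dphi.map (algebraMap K (CInfty Fq)))).restrictScalars Fq

/-- `Lie(E)(ℂ_∞)` as an `𝔽_q[t]`-module, with `t` acting by `dφ_t`. -/
abbrev Lie : Type _ := Module.AEval' E.lieT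

/-- The underlying vector of an element of `Lie(E)(ℂ_∞)`. -/
def lieVec (x : E.Lie) : Fin d → CInfty Fq := (Module.AEval'.of E.lieT).symm x

/-- The period lattice, the kernel of the exponential. -/
def periods : Set E.Lie := {x | E.exp (E.lieVec x) = 0}

/-- `lam` is an `𝔽_q[t]`-basis of the period lattice. -/
structure IsPeriodBasis {r : ℕ} (lam : Fin r → E.Lie) : Prop where
  linearIndependent : LinearIndependent Fq[X] lam
  span_eq : (Submodule.span Fq[X] (Set.range lam) : Set E.Lie) = E.periods

end TModule

/-- The coordinates on `Lie(E)(ℂ_∞)` that are induced by a new coordinate system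
`κ = U x ∈ 𝔾_a^d` of `E`, where `U ∈ GL_d(K{τ})`: the vector `x` is sent to `dU x`. -/
def lieCoord {Fq K : Type*} [Field Fq] [Fintype Fq] [Field K] [Algebra Fq K]
    [Algebra K (CInfty Fq)] {d : ℕ} (U : GL (Fin d) (TwistedPoly Fq K))
    (x : Fin d → CInfty Fq) : Fin d → CInfty Fq :=
  (U.1.map fun f => algebraMap K (CInfty Fq) (f.coeff 0)).mulVec x

/-- The coefficientwise inclusion of matrices over `𝕋` into matrices over `ℂ_∞⟦t⟧`. -/
def tateMatrix {Fq : Type*} [Field Fq] [Fintype Fq] {r : ℕ} (Υ : GL (Fin r) (tateAlgebra Fq)) :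
    Matrix (Fin r) (Fin r) (CInfty Fq)⟦X⟧ := Υ.1.map (tateAlgebra Fq).subtype

/-- `Υ ∈ GL_r(𝕋)` is a rigid analytic trivialization of the `t`-motive with respect to the basis
`m = (m₁, …, m_r)ᵗ` on which `τ` acts by `τ(m) = Θ m`: one has `τ(Υ m) = Υ m`, i.e.
`τ(Υ) Θ = Υ`. -/
def IsRigidAnalyticTrivialization {Fq K : Type*} [Field Fq] [Fintype Fq] [Field K]
    [Algebra K (CInfty Fq)] {r : ℕ} (Θ : Matrix (Fin r) (Fin r) K[X])
    (Υ : GL (Fin r) (tateAlgebra Fq)) : Prop :=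
  (tateMatrix Υ).map (twist Fq) * Θ.map (polyToSeries K) = tateMatrix Υ

/-- The matrix `B Θ σ(B)⁻¹`. -/
def twistedTheta {Fq K : Type*} [Field Fq] [Fintype Fq] [Field K]
    [Algebra K (CInfty Fq)] {r : ℕ} (Θ : Matrix (Fin r) (Fin r) K[X])
    (B : GL (Fin r) K[X]) : Matrix (Fin r) (Fin r) (CInfty Fq)⟦X⟧ :=
  B.1.map (polyToSeries K) * Θ.map (polyToSeries K) *
    ((B.1.map (polyToSeries K)).map (invTwist Fq))⁻¹

/-- The matrix `R = τ(Υ) B⁻¹`. -/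
def matrixR {Fq K : Type*} [Field Fq] [Fintype Fq] [Field K]
    [Algebra K (CInfty Fq)] {r : ℕ} (Υ : GL (Fin r) (tateAlgebra Fq))
    (B : GL (Fin r) K[X]) : Matrix (Fin r) (Fin r) (CInfty Fq)⟦X⟧ :=
  (tateMatrix Υ).map (twist Fq) * (B.1.map (polyToSeries K))⁻¹

end TModules
end TPeriods
end

set_option linter.unusedSectionVars false

noncomputable section

namespace TPeriods

open Filter Topology Finset

/-! ### Hyperderivatives and restricted power series -/

section Hyper

variable {Fq : Type*} [Field Fq] [Fintype Fq]

/-! Part (1). The identity `σ(R) = R Θ̃` is formal: `σ(R) = Υ σ(B)⁻¹ = τ(Υ) Θ σ(B)⁻¹ = R B Θ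
σ(B)⁻¹`. For the determinant, the differential at the origin identifies the motive modulo the
`K[t]`-span of its `τ`-image with the dual of `Lie(E)` (`TModule.mem_tauSpan_iff`). There `t - θ` is
nilpotent, so `det Θ` divides a power of `t - θ`, and it is not a unit because `d ≥ 1`
(`TModule.exists_det_theta`).

Entireness comes from comparing coefficients in `Υ = τ(Υ) Θ`: the coefficients of `Υ` are a null
sequence controlled by the `q`-th powers of finitely many last terms, so they decay faster than any
geometric sequence (`exists_mul_pow_le_of_recurrence`). Each row of coefficients solves `y = y^(q)
Θ(0) + s` with `s` built from earlier coefficients. Since `Θ(0)` is invertible, `y` is algebraic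
over `K_∞` (`coeff_mem_algebraicClosure`); once `y` is small it is the limit of an iteration inside
the field already generated (`mem_of_eq_sum_pow_card_add`), so finitely many coefficients generate
the whole field. Prolongation is multiplicative by the Leibniz rule and commutes with `σ`, so it
preserves all the conditions (`ABPConditions.prolongation`).

Part (2). A period `λ` has a generating function `f_λ(x) = ∑ x(exp(dφ_t^(-n-1) λ)) t^n`, which is
`K[t]`-linear and `τ`-equivariant in the element `x` of the motive. Conversely, every such
functional with values in the Tate algebra comes from a `t`-division tower tending to zero
(`TModule.exists_isTower`), and every such tower comes from a period, because the exponential is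
bijective near zero (`TModule.exists_period_of_isTower`). The columns of `Υ⁻¹` satisfy `τ(y) = Θ y`,
so they are generating functions of periods `λ_j`. For any period the vector `v = (f_λ(m_i))` makes
`Υ v` invariant under `τ`, hence a vector over `𝔽_q[t]`; therefore the `λ_j` form a basis
(`TModule.isPeriodBasis_of_agf`).

To read off coordinates, replace `exp` and `x` by their linear parts. The error is quadratic and
converges for `|t| ≤ |θ|` (`TModule.agf_sub_linSeries_mem`), so the polar part of `f_λ(x)` at `θ` is
that of `⟨dx, (dφ_t - t)⁻¹ λ⟩`, a polynomial in `(t - θ)⁻¹` whose coefficients are pairings of `λ`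
with `dx N^j`, where `N = dφ_t - θ`. Elementary divisors give a basis `μ_i` of the motive and a
matrix `B` with `(t - θ)^(n_i) μ_i = ∑ B_ij τ(m_j)` (`TModule.exists_elementary_divisors`). With
this `B` the `(i, j)` entry of `R⁻¹` is `(t - θ)^(n_i) f_(λ_j)(μ_i)`, and its hyperderivatives of
order below `n_i` at `θ` are, up to sign, the pairings of `λ_j` with the differentials of `(t - θ)^k
μ_i` for `k < n_i`. Over all `i` these differentials form a basis of the dual of `Lie(E)`
(`TModule.exists_lin_basis`), hence a coordinate system. As `∑ n_i = d`, only orders at most `d - 1`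
occur, and these all appear in the last block column of the prolongation. -/

theorem coeff_hyperDeriv (n i : ℕ) (f : (CInfty Fq)⟦X⟧) :
    PowerSeries.coeff i (hyperDeriv n f) =
      ((i + n).choose n : CInfty Fq) * PowerSeries.coeff (i + n) f := by
  simp [hyperDeriv]

theorem coeff_twist (i : ℕ) (f : (CInfty Fq)⟦X⟧) :
    PowerSeries.coeff i (twist Fq f) = PowerSeries.coeff i f ^ Fintype.card Fq := by
  simp [twist, CInfty.frob_apply]

theorem coeff_invTwist (i : ℕ) (f : (CInfty Fq)⟦X⟧) :
    PowerSeries.coeff i (invTwist Fq f) = (CInfty.frob Fq).symm (PowerSeries.coeff i f) := by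
  simp [invTwist]

theorem invTwist_twist (f : (CInfty Fq)⟦X⟧) : invTwist Fq (twist Fq f) = f := by
  ext i
  rw [coeff_invTwist, coeff_twist, ← CInfty.frob_apply, RingEquiv.symm_apply_apply]

theorem hyperDeriv_zero_left (f : (CInfty Fq)⟦X⟧) : hyperDeriv 0 f = f := by
  ext i; simp [coeff_hyperDeriv]

theorem hyperDeriv_add (n : ℕ) (f g : (CInfty Fq)⟦X⟧) :
    hyperDeriv n (f + g) = hyperDeriv n f + hyperDeriv n g := by
  ext i; simp [coeff_hyperDeriv, mul_add]

/-- `hyperDeriv n` as an additive homomorphism. -/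
def hyperDerivHom (n : ℕ) : (CInfty Fq)⟦X⟧ →+ (CInfty Fq)⟦X⟧ where
  toFun := hyperDeriv n
  map_zero' := by ext i; simp [coeff_hyperDeriv]
  map_add' := hyperDeriv_add n

theorem hyperDeriv_sum {ι : Type*} (n : ℕ) (s : Finset ι) (f : ι → (CInfty Fq)⟦X⟧) :
    hyperDeriv n (∑ i ∈ s, f i) = ∑ i ∈ s, hyperDeriv n (f i) :=
  map_sum (hyperDerivHom n) f s

theorem hyperDeriv_C_mul (n : ℕ) (c : CInfty Fq) (f : (CInfty Fq)⟦X⟧) :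
    hyperDeriv n (PowerSeries.C c * f) = PowerSeries.C c * hyperDeriv n f := by
  ext i; simp only [coeff_hyperDeriv, PowerSeries.coeff_C_mul]; ring

theorem hyperDeriv_one (n : ℕ) :
    hyperDeriv n (1 : (CInfty Fq)⟦X⟧) = if n = 0 then 1 else 0 := by
  ext i
  rw [coeff_hyperDeriv, PowerSeries.coeff_one]
  rcases eq_or_ne n 0 with rfl | hn
  · simp [PowerSeries.coeff_one]
  · rw [if_neg (by omega), if_neg hn]; simp

/-- The Leibniz rule for hyperderivatives. -/
theorem hyperDeriv_mul (n : ℕ) (f g : (CInfty Fq)⟦X⟧) :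
    hyperDeriv n (f * g) =
      ∑ ij ∈ antidiagonal n, hyperDeriv ij.1 f * hyperDeriv ij.2 g := by
  ext i
  -- The `i`-th coefficient of the `n`-th hyperderivative of a product involves only coefficients of
  -- index at most `i + n`. Both factors may therefore be truncated, and the rule follows from the
  -- one for Hasse derivatives of polynomials.
  have hf : ∀ (f : (CInfty Fq)⟦X⟧) (k u : ℕ), u + k ≤ i + n →
      PowerSeries.coeff u (hyperDeriv k f) =
        (Polynomial.hasseDeriv k (PowerSeries.trunc (i + n + 1) f)).coeff u := by
    intro f k u h
    rw [coeff_hyperDeriv, Polynomial.hasseDeriv_coeff, PowerSeries.coeff_trunc,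
      if_pos (by omega)]
  rw [coeff_hyperDeriv, PowerSeries.coeff_mul_eq_coeff_trunc_mul_trunc f g (Nat.lt_succ_self _),
    ← Polynomial.coe_mul, Polynomial.coeff_coe, ← Polynomial.hasseDeriv_coeff,
    Polynomial.hasseDeriv_mul, Polynomial.finsetSum_coeff, map_sum]
  refine sum_congr rfl fun p hp => ?_
  rw [HasAntidiagonal.mem_antidiagonal] at hp
  rw [Polynomial.coeff_mul, PowerSeries.coeff_mul]
  refine sum_congr rfl fun u hu => ?_
  rw [HasAntidiagonal.mem_antidiagonal] at hu
  rw [hf f _ _ (by omega), hf g _ _ (by omega)]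

theorem hyperDeriv_invTwist (n : ℕ) (f : (CInfty Fq)⟦X⟧) :
    hyperDeriv n (invTwist Fq f) = invTwist Fq (hyperDeriv n f) := by
  ext i
  simp [coeff_hyperDeriv, coeff_invTwist]

theorem mem_restricted_iff {c : ℝ} {f : (CInfty Fq)⟦X⟧} :
    f ∈ PowerSeries.IsRestricted.subring c ↔
      Tendsto (fun n => ‖PowerSeries.coeff n f‖ * c ^ n) atTop (𝓝 0) :=
  PowerSeries.isRestricted_iff' c f

theorem mem_tateAlgebra_iff {f : (CInfty Fq)⟦X⟧} :
    f ∈ tateAlgebra Fq ↔ Tendsto (fun n => ‖PowerSeries.coeff n f‖) atTop (𝓝 0) := by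
  rw [tateAlgebra, mem_restricted_iff]
  simp

/-- Binomial coefficients have norm at most one in an ultrametric field, so only the index shift
matters, and it costs the constant factor `c ^ (-n)`. -/
theorem hyperDeriv_mem_restricted {c : ℝ} (hc : 0 < c) (n : ℕ) {f : (CInfty Fq)⟦X⟧}
    (hf : f ∈ PowerSeries.IsRestricted.subring c) :
    hyperDeriv n f ∈ PowerSeries.IsRestricted.subring c := by
  rw [mem_restricted_iff] at hf ⊢
  have h := ((tendsto_add_atTop_iff_nat n).2 hf).mul_const ((c ^ n)⁻¹)
  rw [zero_mul] at h
  refine squeeze_zero (fun i => by positivity) (fun i => ?_) h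
  rw [coeff_hyperDeriv, norm_mul]
  have h1 := IsUltrametricDist.norm_natCast_le_one (CInfty Fq) ((i + n).choose n)
  calc _ ≤ 1 * ‖PowerSeries.coeff (i + n) f‖ * c ^ i := by gcongr
    _ = _ := by rw [pow_add]; field_simp

theorem hyperDeriv_mem_tateAlgebra (n : ℕ) {f : (CInfty Fq)⟦X⟧} (hf : f ∈ tateAlgebra Fq) :
    hyperDeriv n f ∈ tateAlgebra Fq :=
  hyperDeriv_mem_restricted one_pos n hf

theorem twist_mem_tateAlgebra {f : (CInfty Fq)⟦X⟧} (hf : f ∈ tateAlgebra Fq) :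
    twist Fq f ∈ tateAlgebra Fq := by
  rw [mem_tateAlgebra_iff] at hf ⊢
  simpa [coeff_twist, Fintype.card_ne_zero] using hf.pow (Fintype.card Fq)

theorem coe_mem_restricted (c : ℝ) (p : (CInfty Fq)[X]) :
    (p : (CInfty Fq)⟦X⟧) ∈ PowerSeries.IsRestricted.subring (R := CInfty Fq) c := by
  rw [mem_restricted_iff]
  refine tendsto_const_nhds.congr' ?_
  filter_upwards [eventually_gt_atTop p.natDegree] with n hn
  rw [Polynomial.coeff_coe, Polynomial.coeff_eq_zero_of_natDegree_lt hn]
  simp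

theorem polyToSeries_apply {K : Type*} [Field K] [Algebra K (CInfty Fq)] (p : K[X]) :
    polyToSeries (Fq := Fq) K p = (p.map (algebraMap K (CInfty Fq)) : (CInfty Fq)⟦X⟧) := rfl

theorem coeff_polyToSeries {K : Type*} [Field K] [Algebra K (CInfty Fq)] (p : K[X]) (n : ℕ) :
    PowerSeries.coeff n (polyToSeries (Fq := Fq) K p) = algebraMap K (CInfty Fq) (p.coeff n) := by
  rw [polyToSeries_apply, Polynomial.coeff_coe, Polynomial.coeff_map]

theorem polyToSeries_injective {K : Type*} [Field K] [Algebra K (CInfty Fq)] :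
    Function.Injective (polyToSeries (Fq := Fq) K) := fun p q h => by
  ext n
  have := congrArg (PowerSeries.coeff n) h
  rw [coeff_polyToSeries, coeff_polyToSeries] at this
  exact (algebraMap K (CInfty Fq)).injective this

theorem polyToSeries_mem_tateAlgebra {K : Type*} [Field K] [Algebra K (CInfty Fq)] (p : K[X]) :
    polyToSeries (Fq := Fq) K p ∈ tateAlgebra Fq := coe_mem_restricted 1 _

theorem polyToSeries_C {K : Type*} [Field K] [Algebra K (CInfty Fq)] (a : K) :
    polyToSeries (Fq := Fq) K (Polynomial.C a) = PowerSeries.C (algebraMap K (CInfty Fq) a) := by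
  rw [polyToSeries_apply, Polynomial.map_C, Polynomial.coe_C]

theorem polyToSeries_X {K : Type*} [Field K] [Algebra K (CInfty Fq)] :
    polyToSeries (Fq := Fq) K Polynomial.X = PowerSeries.X := by
  rw [polyToSeries_apply, Polynomial.map_X, Polynomial.coe_X]

theorem hyperDeriv_polyToSeries {K : Type*} [Field K] [Algebra K (CInfty Fq)] (n : ℕ) (p : K[X]) :
    hyperDeriv n (polyToSeries (Fq := Fq) K p) = polyToSeries K (Polynomial.hasseDeriv n p) := by
  ext i
  rw [coeff_hyperDeriv, coeff_polyToSeries, coeff_polyToSeries, Polynomial.hasseDeriv_coeff]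
  simp

end Hyper

/-! ### Prolongations -/

section Prolongation

variable {Fq : Type*} [Field Fq] [Fintype Fq] {ι : Type*} (l : ℕ)

theorem prolongation_apply (M : Matrix ι ι (CInfty Fq)⟦X⟧) (x y : Fin (l + 1) × ι) :
    prolongation l M x y =
      if x.1 ≤ y.1 then hyperDeriv ((y.1 : ℕ) - (x.1 : ℕ)) (M x.2 y.2) else 0 := rfl

/-- The Leibniz rule in matrix form: an intermediate block index `c` with `a ≤ c ≤ b` splits the
order `b - a` as `(c - a) + (b - c)`. -/
theorem prolongation_mul [Fintype ι] (M N : Matrix ι ι (CInfty Fq)⟦X⟧) :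
    prolongation l (M * N) = prolongation l M * prolongation l N := by
  ext1 x y
  rw [Matrix.mul_apply, Fintype.sum_prod_type, prolongation_apply]
  simp only [prolongation_apply]
  split_ifs with hxy
  · rw [Matrix.mul_apply, hyperDeriv_sum]
    simp only [hyperDeriv_mul]
    rw [sum_comm]
    conv_rhs => rw [← sum_filter_add_sum_filter_not univ (fun c => x.1 ≤ c ∧ c ≤ y.1)]
    rw [sum_eq_zero (s := univ.filter fun c => ¬(x.1 ≤ c ∧ c ≤ y.1)), add_zero]
    -- A pair `(u, v)` with `u + v = b - a` corresponds to `c = a + u`. The minimum with `l` only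
    -- makes the index well typed; it is never attained strictly by `l`.
    · refine sum_bij' (fun p _ => (⟨(min ((x.1 : ℕ) + p.1) l : ℕ), by omega⟩ : Fin (l + 1)))
        (fun c _ => ((c : ℕ) - x.1, (y.1 : ℕ) - c)) ?_ ?_ ?_ ?_ ?_
      · intro p hp
        have := y.1.2
        have h' : (x.1 : ℕ) ≤ y.1 := hxy
        simp only [HasAntidiagonal.mem_antidiagonal, mem_filter, mem_univ, true_and, Fin.le_def] at *
        omega
      · intro c hc
        simp only [HasAntidiagonal.mem_antidiagonal, mem_filter, mem_univ, true_and, Fin.le_def] at *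
        omega
      · intro p hp
        have := y.1.2
        have h' : (x.1 : ℕ) ≤ y.1 := hxy
        simp only [HasAntidiagonal.mem_antidiagonal] at hp
        ext <;> simp <;> omega
      · intro c hc
        have := c.2
        simp only [mem_filter, mem_univ, true_and, Fin.le_def] at hc
        ext
        simp only
        omega
      · intro p hp
        have := y.1.2
        have h' : (x.1 : ℕ) ≤ y.1 := hxy
        simp only [HasAntidiagonal.mem_antidiagonal] at hp
        have h1 : min ((x.1 : ℕ) + p.1) l = x.1 + p.1 := by omega
        simp only [Fin.le_def, h1]
        refine sum_congr rfl fun j _ => ?_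
        rw [if_pos (by omega), if_pos (by omega)]
        congr 2 <;> omega
    · intro c hc
      refine sum_eq_zero fun j _ => ?_
      rw [mem_filter] at hc
      by_cases h1 : x.1 ≤ c
      · rw [if_neg (fun h2 => hc.2 ⟨h1, h2⟩), mul_zero]
      · rw [if_neg h1, zero_mul]
  · symm
    refine sum_eq_zero fun c _ => sum_eq_zero fun j _ => ?_
    by_cases h1 : x.1 ≤ c
    · rw [if_neg (fun h2 => hxy (h1.trans h2)), mul_zero]
    · rw [if_neg h1, zero_mul]

theorem prolongation_one [DecidableEq ι] :
    prolongation l (1 : Matrix ι ι (CInfty Fq)⟦X⟧) = 1 := by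
  ext1 x y
  have h0 : ∀ n, hyperDeriv n (0 : (CInfty Fq)⟦X⟧) = 0 := fun n => map_zero (hyperDerivHom n)
  rw [prolongation_apply, Matrix.one_apply, Matrix.one_apply]
  by_cases h2 : x.2 = y.2
  · rw [if_pos h2, hyperDeriv_one]
    by_cases h1 : x.1 = y.1
    · rw [if_pos h1.le, if_pos (by rw [h1]; simp), if_pos (Prod.ext h1 h2)]
    · rw [if_neg (fun h => h1 (congrArg Prod.fst h))]
      split_ifs with h3 h4
      · exact absurd (le_antisymm h3 (Fin.le_def.2 (by omega))) h1
      · rfl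
      · rfl
  · rw [if_neg h2, h0, ite_self, if_neg (fun h => h2 (congrArg Prod.snd h))]

theorem prolongation_map_invTwist (M : Matrix ι ι (CInfty Fq)⟦X⟧) :
    (prolongation l M).map (invTwist Fq) = prolongation l (M.map (invTwist Fq)) := by
  ext1 x y
  simp only [Matrix.map_apply, prolongation_apply, hyperDeriv_invTwist]
  split_ifs <;> simp

/-- The prolongation is block triangular, and each of its `l + 1` diagonal blocks is `M`, the
hyperderivative of order zero. -/
theorem det_prolongation [Fintype ι] [DecidableEq ι] (M : Matrix ι ι (CInfty Fq)⟦X⟧) :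
    (prolongation l M).det = M.det ^ (l + 1) := by
  have h : (prolongation l M).BlockTriangular Prod.fst := fun x y hxy => by
    rw [prolongation_apply, if_neg (not_le.2 hxy)]
  rw [h.det_fintype]
  have hk : ∀ k, ((prolongation l M).toSquareBlock Prod.fst k).det = M.det := by
    intro k
    let e : ι ≃ {x : Fin (l + 1) × ι // x.1 = k} :=
      { toFun := fun i => ⟨(k, i), rfl⟩
        invFun := fun x => x.1.2
        left_inv := fun i => rfl
        right_inv := fun x => Subtype.ext (Prod.ext x.2.symm rfl) }
    rw [← Matrix.det_submatrix_equiv_self e]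
    congr 1
    ext1 i j
    simp [Matrix.toSquareBlock_def, prolongation_apply, e, hyperDeriv_zero_left]
  simp [hk]

end Prolongation

/-! ### Values at `θ` -/

section Value

variable {Fq : Type*} [Field Fq] [Fintype Fq]

theorem norm_theta_pos : 0 < ‖CInfty.theta Fq‖ := by
  rw [CInfty.norm_theta]; exact_mod_cast Fintype.card_pos

theorem one_lt_norm_theta : 1 < ‖CInfty.theta Fq‖ := by
  rw [CInfty.norm_theta]; exact_mod_cast Fintype.one_lt_card

theorem theta_ne_zero : CInfty.theta Fq ≠ 0 := norm_pos_iff.1 norm_theta_pos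

variable (Fq) in
/-- The ring of power series that converge for `|t| ≤ |θ|`. -/
def thetaAlgebra : Subring (CInfty Fq)⟦X⟧ :=
  PowerSeries.IsRestricted.subring ‖CInfty.theta Fq‖

theorem exists_hasValueAtTheta {f : (CInfty Fq)⟦X⟧} (hf : f ∈ thetaAlgebra Fq) :
    ∃ v, HasValueAtTheta f v := by
  refine NonarchimedeanAddGroup.summable_of_tendsto_cofinite_zero ?_
  rw [Nat.cofinite_eq_atTop, tendsto_zero_iff_norm_tendsto_zero]
  simpa [norm_mul, norm_pow] using mem_restricted_iff.1 hf

theorem HasValueAtTheta.add {f g : (CInfty Fq)⟦X⟧} {v w : CInfty Fq} (hf : HasValueAtTheta f v)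
    (hg : HasValueAtTheta g w) : HasValueAtTheta (f + g) (v + w) := by
  simpa [HasValueAtTheta, add_mul] using HasSum.add hf hg

theorem HasValueAtTheta.C_mul {f : (CInfty Fq)⟦X⟧} {v : CInfty Fq} (hf : HasValueAtTheta f v)
    (c : CInfty Fq) : HasValueAtTheta (PowerSeries.C c * f) (c * v) := by
  simpa [HasValueAtTheta, mul_assoc] using HasSum.mul_left c hf

theorem hasValueAtTheta_zero : HasValueAtTheta (0 : (CInfty Fq)⟦X⟧) 0 := by
  simp [HasValueAtTheta, hasSum_zero]

theorem hasValueAtTheta_one : HasValueAtTheta (1 : (CInfty Fq)⟦X⟧) 1 := by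
  have := hasSum_single (f := fun n => PowerSeries.coeff n (1 : (CInfty Fq)⟦X⟧) *
    CInfty.theta Fq ^ n) 0 (fun n hn => by simp [PowerSeries.coeff_one, hn])
  simpa [HasValueAtTheta] using this

theorem HasValueAtTheta.sum {ι : Type*} (s : Finset ι) {f : ι → (CInfty Fq)⟦X⟧}
    {v : ι → CInfty Fq} (h : ∀ i ∈ s, HasValueAtTheta (f i) (v i)) :
    HasValueAtTheta (∑ i ∈ s, f i) (∑ i ∈ s, v i) := by
  classical
  induction s using Finset.induction_on with
  | empty => simpa using hasValueAtTheta_zero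
  | insert a s ha ih =>
    rw [sum_insert ha, sum_insert ha]
    exact (h a (mem_insert_self _ _)).add (ih fun i hi => h i (mem_insert_of_mem hi))

variable (Fq) in
/-- The power series `t - θ`. -/
def tSubTheta : (CInfty Fq)⟦X⟧ := PowerSeries.X - PowerSeries.C (CInfty.theta Fq)

theorem tSubTheta_mem : tSubTheta Fq ∈ thetaAlgebra Fq := by
  have := coe_mem_restricted ‖CInfty.theta Fq‖ (Polynomial.X - Polynomial.C (CInfty.theta Fq))
  rwa [Polynomial.coe_sub, Polynomial.coe_X, Polynomial.coe_C] at this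

theorem HasValueAtTheta.tSubTheta_mul {f : (CInfty Fq)⟦X⟧} {v : CInfty Fq}
    (hf : HasValueAtTheta f v) : HasValueAtTheta (tSubTheta Fq * f) 0 := by
  have h1 : HasValueAtTheta (PowerSeries.X * f) (CInfty.theta Fq * v) := by
    refine (hasSum_nat_add_iff' 1).1 ?_
    have h := HasSum.mul_left (CInfty.theta Fq) hf
    have e : (fun n => PowerSeries.coeff (n + 1) (PowerSeries.X * f) *
        CInfty.theta Fq ^ (n + 1)) =
        fun n => CInfty.theta Fq * (PowerSeries.coeff n f * CInfty.theta Fq ^ n) := by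
      ext n
      rw [PowerSeries.coeff_succ_X_mul]
      ring
    rw [e]
    simpa using h
  have h2 := h1.add (hf.C_mul (-CInfty.theta Fq))
  rw [neg_mul, add_neg_cancel] at h2
  convert h2 using 1
  rw [tSubTheta, sub_mul, map_neg, neg_mul, sub_eq_add_neg]

/-- Leibniz rule with a linear factor, whose hyperderivatives beyond the first vanish. On
coefficients this is Pascal's identity, so it holds in every characteristic. -/
theorem hyperDeriv_tSubTheta_mul (k : ℕ) (f : (CInfty Fq)⟦X⟧) :
    hyperDeriv (k + 1) (tSubTheta Fq * f) =
      tSubTheta Fq * hyperDeriv (k + 1) f + hyperDeriv k f := by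
  ext i
  simp only [tSubTheta, sub_mul, map_sub, map_add, coeff_hyperDeriv, PowerSeries.coeff_C_mul]
  rw [← add_assoc, PowerSeries.coeff_succ_X_mul]
  cases i with
  | zero => simp; ring
  | succ i =>
    rw [PowerSeries.coeff_succ_X_mul, coeff_hyperDeriv,
      show i + 1 + k = i + (k + 1) by ring, Nat.choose_succ_succ]
    push_cast
    ring

/-- A zero of order `n` at `θ` kills the hyperderivatives of lower order. Convergence on the whole
disc `|t| ≤ |θ|` is assumed so that the hyperderivatives of the cofactor also have values at `θ`. -/
theorem hyperDeriv_tSubTheta_pow_mul {f : (CInfty Fq)⟦X⟧} (hf : f ∈ thetaAlgebra Fq) :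
    ∀ n k : ℕ, k < n → HasValueAtTheta (hyperDeriv k (tSubTheta Fq ^ n * f)) 0
  | 0, k, h => absurd h (by omega)
  | n + 1, k, h => by
    have hm : tSubTheta Fq ^ n * f ∈ thetaAlgebra Fq :=
      mul_mem (pow_mem tSubTheta_mem n) hf
    rw [pow_succ', mul_assoc]
    cases k with
    | zero =>
      rw [hyperDeriv_zero_left]
      obtain ⟨v, hv⟩ := exists_hasValueAtTheta hm
      exact hv.tSubTheta_mul
    | succ k =>
      obtain ⟨v, hv⟩ := exists_hasValueAtTheta
        (hyperDeriv_mem_restricted norm_theta_pos (k + 1) hm)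
      rw [hyperDeriv_tSubTheta_mul]
      simpa using hv.tSubTheta_mul.add (hyperDeriv_tSubTheta_pow_mul hf n k (by omega))

theorem hyperDeriv_tSubTheta_pow : ∀ n k : ℕ,
    HasValueAtTheta (hyperDeriv k (tSubTheta Fq ^ n)) (if k = n then 1 else 0)
  | 0, k => by
    rw [pow_zero, hyperDeriv_one]
    split_ifs
    · exact hasValueAtTheta_one
    · exact hasValueAtTheta_zero
  | n + 1, 0 => by
    have := hyperDeriv_tSubTheta_pow_mul (one_mem (thetaAlgebra Fq)) (n + 1) 0 (by omega)
    simpa using this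
  | n + 1, k + 1 => by
    obtain ⟨v, hv⟩ := exists_hasValueAtTheta
      (hyperDeriv_mem_restricted norm_theta_pos (k + 1) (pow_mem (tSubTheta_mem (Fq := Fq)) n))
    rw [pow_succ', hyperDeriv_tSubTheta_mul]
    simpa using hv.tSubTheta_mul.add (hyperDeriv_tSubTheta_pow n k)

end Value

/-! ### Twisted polynomials and their action on `ℂ_∞` -/

namespace TwistedPoly

variable {Fq : Type*} [Field Fq] [Fintype Fq] {K : Type*} [Field K] [Algebra Fq K]

theorem coeff_add (f g : TwistedPoly Fq K) (n : ℕ) : (f + g).coeff n = f.coeff n + g.coeff n :=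
  congrArg (fun h => h (Multiplicative.ofAdd n))
    (SkewMonoidAlgebra.coeff_add (k := K) (G := Multiplicative ℕ) f g)

theorem coeff_zero (n : ℕ) : (0 : TwistedPoly Fq K).coeff n = 0 := rfl

theorem coeff_smul (a : K) (f : TwistedPoly Fq K) (n : ℕ) : (a • f).coeff n = a * f.coeff n := rfl

theorem coeff_monomial (n m : ℕ) (a : K) :
    (monomial n a : TwistedPoly Fq K).coeff m = if n = m then a else 0 :=
  SkewPolynomial.coeff_monomial

theorem ext {f g : TwistedPoly Fq K} (h : ∀ n, f.coeff n = g.coeff n) : f = g :=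
  SkewMonoidAlgebra.ext fun n => h n.toAdd

/-- The coefficient of `τ ^ n` as an additive homomorphism. -/
def coeffHom (n : ℕ) : TwistedPoly Fq K →+ K where
  toFun f := f.coeff n
  map_zero' := coeff_zero n
  map_add' f g := coeff_add f g n

theorem coeff_sum {ι : Type*} (s : Finset ι) (f : ι → TwistedPoly Fq K) (n : ℕ) :
    (∑ i ∈ s, f i).coeff n = ∑ i ∈ s, (f i).coeff n :=
  map_sum (coeffHom n) f s

theorem smul_monomial (n : ℕ) (a b : K) :
    a • (monomial n b : TwistedPoly Fq K) = monomial n (a * b) :=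
  SkewPolynomial.smul_monomial n a b

theorem monomial_zero_one : (monomial 0 1 : TwistedPoly Fq K) = 1 := by
  let := frobAction Fq K
  rfl

theorem coeff_one (n : ℕ) : (1 : TwistedPoly Fq K).coeff n = if 0 = n then 1 else 0 := by
  rw [← monomial_zero_one, coeff_monomial]

theorem exists_coeff_eq_zero (f : TwistedPoly Fq K) : ∃ N, ∀ n, N ≤ n → f.coeff n = 0 := by
  refine ⟨(SkewPolynomial.support f).sup id + 1, fun n hn => ?_⟩
  by_contra h
  have h1 := Finset.le_sup (f := id) (SkewPolynomial.mem_support_iff.2 h)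
  simp only [id] at h1
  omega

theorem eq_sum_monomial (f : TwistedPoly Fq K) {N : ℕ} (hN : ∀ n, N ≤ n → f.coeff n = 0) :
    f = ∑ k ∈ range N, monomial k (f.coeff k) := by
  refine ext fun n => ?_
  rw [coeff_sum]
  simp only [coeff_monomial, sum_ite_eq', mem_range]
  split_ifs with h
  · rfl
  · exact hN n (not_lt.1 h)

theorem induction {P : TwistedPoly Fq K → Prop} (f : TwistedPoly Fq K) (h0 : P 0)
    (hadd : ∀ f g, P f → P g → P (f + g)) (hmon : ∀ n a, P (monomial n a)) : P f := by
  obtain ⟨N, hN⟩ := exists_coeff_eq_zero f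
  rw [eq_sum_monomial f hN]
  exact Finset.sum_induction _ P hadd h0 fun k _ => hmon _ _

theorem pow_card_pow_add (n : ℕ) (a b : K) :
    (a + b) ^ Fintype.card Fq ^ n = a ^ Fintype.card Fq ^ n + b ^ Fintype.card Fq ^ n := by
  induction n with
  | zero => simp
  | succ n ih =>
    rw [pow_succ, pow_mul, pow_mul, pow_mul, ih]
    exact map_add (FiniteField.frobeniusAlgHom Fq K) _ _

variable (Fq K) in
/-- The `n`-th iterate of the Frobenius `x ↦ x ^ q`. -/
def frobPow (n : ℕ) : K →+* K where
  toFun x := x ^ Fintype.card Fq ^ n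
  map_one' := one_pow _
  map_mul' a b := mul_pow a b _
  map_zero' := zero_pow (pow_ne_zero _ Fintype.card_ne_zero)
  map_add' := pow_card_pow_add n

theorem frobPow_apply (n : ℕ) (x : K) : frobPow Fq K n x = x ^ Fintype.card Fq ^ n := rfl

theorem coeff_mul (f g : TwistedPoly Fq K) (n : ℕ) :
    (f * g).coeff n =
      ∑ p ∈ antidiagonal n, f.coeff p.1 * g.coeff p.2 ^ Fintype.card Fq ^ p.1 := by
  simp only [← frobPow_apply (Fq := Fq)]
  induction f using induction with
  | h0 => simp [coeff_zero]
  | hadd f₁ f₂ h₁ h₂ => simp only [add_mul, coeff_add, h₁, h₂, sum_add_distrib]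
  | hmon k a =>
    induction g using induction with
    | h0 => simp [coeff_zero]
    | hadd g₁ g₂ h₁ h₂ => simp only [mul_add, coeff_add, map_add, h₁, h₂, sum_add_distrib]
    | hmon m b =>
      rw [monomial_mul_monomial, coeff_monomial]
      simp only [coeff_monomial, frobPow_apply]
      by_cases h : k + m = n
      · rw [if_pos h, sum_eq_single (k, m)]
        · simp
        · rintro ⟨u, v⟩ huv hne
          rw [HasAntidiagonal.mem_antidiagonal] at huv
          by_cases h1 : k = u
          · rw [if_neg (c := m = v) (fun h2 => hne (by rw [h1, h2])),
              zero_pow (pow_ne_zero _ Fintype.card_ne_zero), mul_zero]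
          · rw [if_neg h1, zero_mul]
        · intro h1
          exact absurd (HasAntidiagonal.mem_antidiagonal.2 h) h1
      · rw [if_neg h, sum_eq_zero]
        rintro ⟨u, v⟩ huv
        rw [HasAntidiagonal.mem_antidiagonal] at huv
        by_cases h1 : k = u
        · rw [if_neg (c := m = v) (fun h2 => h (by rw [h1, h2]; exact huv)),
            zero_pow (pow_ne_zero _ Fintype.card_ne_zero), mul_zero]
        · rw [if_neg h1, zero_mul]

theorem coeff_zero_mul (f g : TwistedPoly Fq K) : (f * g).coeff 0 = f.coeff 0 * g.coeff 0 := by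
  simp [coeff_mul]

theorem coeff_zero_monomial_one_mul (f : TwistedPoly Fq K) : (monomial 1 1 * f).coeff 0 = 0 := by
  rw [coeff_zero_mul, coeff_monomial]
  simp

variable [Algebra K (CInfty Fq)]

variable (Fq) in
/-- The `q`-power Frobenius of `ℂ_∞` as an additive endomorphism. -/
def frobEnd : AddMonoid.End (CInfty Fq) :=
  (CInfty.frob Fq : CInfty Fq →+* CInfty Fq).toAddMonoidHom

theorem frobEnd_pow_apply (k : ℕ) (z : CInfty Fq) :
    (frobEnd Fq ^ k) z = z ^ Fintype.card Fq ^ k := by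
  induction k generalizing z with
  | zero => rw [pow_zero, pow_zero, pow_one]; rfl
  | succ k ih =>
    rw [pow_succ, pow_succ', pow_mul, ← CInfty.frob_apply, ← ih]
    rfl

variable (Fq K) in
/-- The action of `K{τ}` on `𝔾_a(ℂ_∞)`. -/
def toEnd : TwistedPoly Fq K →+* AddMonoid.End (CInfty Fq) :=
  letI := frobAction Fq K
  SkewMonoidAlgebra.liftNCRingHom (Module.toAddMonoidEnd K (CInfty Fq))
    (powersHom (AddMonoid.End (CInfty Fq)) (frobEnd Fq)) (by
      intro a n
      -- The lift to the skew ring needs the commutation rule `τ^n a = a^(q^n) τ^n`; this unfolds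
      -- the abstract action of `τ^n` on `K`.
      have hn : n • a = a ^ Fintype.card Fq ^ n.toAdd := by
        rw [← ofAdd_toAdd n, ← SkewPolynomial.φ_iterate_apply]
        generalize n.toAdd = n
        induction n with
        | zero => simp
        | succ n ih =>
          rw [Function.iterate_succ_apply', ih, toAdd_ofAdd, toAdd_ofAdd, pow_succ, pow_mul]
          rfl
      refine AddMonoidHom.ext fun z => ?_
      change (n • a) • ((frobEnd Fq ^ n.toAdd) z) = (frobEnd Fq ^ n.toAdd) (a • z)
      rw [frobEnd_pow_apply, frobEnd_pow_apply, hn, Algebra.smul_def, Algebra.smul_def, mul_pow,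
        map_pow])

theorem toEnd_monomial (n : ℕ) (a : K) (z : CInfty Fq) :
    toEnd Fq K (monomial n a) z = algebraMap K (CInfty Fq) a * z ^ Fintype.card Fq ^ n := by
  rw [← frobEnd_pow_apply, ← Algebra.smul_def]
  let := frobAction Fq K
  exact DFunLike.congr_fun (SkewMonoidAlgebra.liftNC_single _ _ _ _) z

theorem toEnd_eq_sum (f : TwistedPoly Fq K) {N : ℕ} (hN : ∀ n, N ≤ n → f.coeff n = 0)
    (z : CInfty Fq) :
    toEnd Fq K f z =
      ∑ k ∈ range N, algebraMap K (CInfty Fq) (f.coeff k) * z ^ Fintype.card Fq ^ k := by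
  conv_lhs => rw [eq_sum_monomial f hN, map_sum]
  refine (map_sum (AddMonoidHom.eval z : (CInfty Fq →+ CInfty Fq) →+ CInfty Fq) _ _).trans ?_
  exact sum_congr rfl fun k _ => toEnd_monomial k _ z

theorem toEnd_smul (a : K) (f : TwistedPoly Fq K) (z : CInfty Fq) :
    toEnd Fq K (a • f) z = algebraMap K (CInfty Fq) a * toEnd Fq K f z := by
  obtain ⟨N, hN⟩ := exists_coeff_eq_zero f
  rw [toEnd_eq_sum f hN, toEnd_eq_sum (a • f) (N := N) (fun n hn => by
    rw [coeff_smul, hN n hn, mul_zero]), mul_sum]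
  simp only [coeff_smul, map_mul, mul_assoc]

end TwistedPoly

/-! ### The coefficients of the exponential -/

namespace TModule

variable {Fq : Type*} [Field Fq] [Fintype Fq] {K : Type*} [Field K] [Algebra Fq K]
  {d : ℕ}

/-- The matrix of the coefficients of `τ ^ n`. -/
def matCoeff (n : ℕ) (M : Matrix (Fin d) (Fin d) (TwistedPoly Fq K)) : Matrix (Fin d) (Fin d) K :=
  M.map fun f => f.coeff n

variable (Fq) in
theorem matTwist_eq (n : ℕ) (M : Matrix (Fin d) (Fin d) K) :
    matTwist Fq n M = (TwistedPoly.frobPow Fq K n).mapMatrix M := rfl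

theorem matTwist_matTwist (m n : ℕ) (M : Matrix (Fin d) (Fin d) K) :
    matTwist Fq m (matTwist Fq n M) = matTwist Fq (m + n) M := by
  ext i j
  simp only [matTwist, Matrix.map_apply]
  rw [← pow_mul, pow_add, mul_comm]

theorem matTwist_zero_left (M : Matrix (Fin d) (Fin d) K) : matTwist Fq 0 M = M := by
  ext i j
  simp [matTwist]

theorem matCoeff_mul (M N : Matrix (Fin d) (Fin d) (TwistedPoly Fq K)) (n : ℕ) :
    matCoeff n (M * N) =
      ∑ p ∈ antidiagonal n, matCoeff p.1 M * matTwist Fq p.1 (matCoeff p.2 N) := by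
  ext i j
  simp only [matCoeff, Matrix.map_apply, Matrix.mul_apply, TwistedPoly.coeff_sum,
    TwistedPoly.coeff_mul, Matrix.sum_apply, matTwist]
  rw [sum_comm]

theorem matCoeff_one (n : ℕ) :
    matCoeff n (1 : Matrix (Fin d) (Fin d) (TwistedPoly Fq K)) = if 0 = n then 1 else 0 := by
  ext i j
  rw [matCoeff, Matrix.map_apply, Matrix.one_apply]
  by_cases hn : 0 = n
  · rw [if_pos hn, Matrix.one_apply]
    split_ifs
    · rw [TwistedPoly.coeff_one, if_pos hn]
    · rfl
  · rw [if_neg hn, Matrix.zero_apply]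
    split_ifs
    · rw [TwistedPoly.coeff_one, if_neg hn]
    · rfl

theorem exists_matCoeff_eq_zero (M : Matrix (Fin d) (Fin d) (TwistedPoly Fq K)) :
    ∃ N, ∀ n, N ≤ n → matCoeff n M = 0 := by
  choose N hN using fun p : Fin d × Fin d => TwistedPoly.exists_coeff_eq_zero (M p.1 p.2)
  refine ⟨univ.sup N, fun n hn => ?_⟩
  ext i j
  exact hN (i, j) n ((le_sup (mem_univ _)).trans hn)

theorem matCoeff_zero_mul (M N : Matrix (Fin d) (Fin d) (TwistedPoly Fq K)) :
    matCoeff 0 (M * N) = matCoeff 0 M * matCoeff 0 N := by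
  rw [matCoeff_mul]
  simp [matTwist_zero_left]

theorem matCoeff_zero_pow (M : Matrix (Fin d) (Fin d) (TwistedPoly Fq K)) (m : ℕ) :
    matCoeff 0 (M ^ m) = matCoeff 0 M ^ m := by
  induction m with
  | zero => rw [pow_zero, pow_zero, matCoeff_one, if_pos rfl]
  | succ m ih => rw [pow_succ, pow_succ, matCoeff_zero_mul, ih]

theorem sum_antidiagonal_assoc {A : Type*} [AddCommMonoid A] (n : ℕ) (f : ℕ → ℕ → ℕ → A) :
    ∑ p ∈ antidiagonal n, ∑ s ∈ antidiagonal p.2, f p.1 s.1 s.2 =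
      ∑ p ∈ antidiagonal n, ∑ s ∈ antidiagonal p.1, f s.1 s.2 p.2 := by
  rw [sum_sigma', sum_sigma']
  refine sum_nbij' (fun x => ⟨(x.1.1 + x.2.1, x.2.2), (x.1.1, x.2.1)⟩)
    (fun x => ⟨(x.2.1, x.2.2 + x.1.2), (x.2.2, x.1.2)⟩) ?_ ?_ ?_ ?_ ?_ <;>
  · rintro ⟨⟨a, b⟩, ⟨c, e⟩⟩ h
    simp only [mem_sigma, HasAntidiagonal.mem_antidiagonal] at h
    obtain ⟨h1, h2⟩ := h
    subst h2
    subst h1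
    simp [add_assoc]

variable [Algebra (RatFunc Fq) K] (E : TModule Fq K d) [IsScalarTower Fq (RatFunc Fq) K]

/-- The functional equation of the exponential for the action of `t ^ m`. -/
theorem expCoeff_mul_pow (m n : ℕ) : E.expCoeff n * matTwist Fq n (E.dphi ^ m) =
    ∑ p ∈ antidiagonal n, matCoeff p.1 (E.phi ^ m) * matTwist Fq p.1 (E.expCoeff p.2) := by
  induction m generalizing n with
  | zero =>
    rw [sum_eq_single (0, n)]
    · rw [pow_zero, pow_zero, matTwist_eq, map_one, matCoeff_one, if_pos rfl, matTwist_zero_left,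
        mul_one, one_mul]
    · rintro ⟨a, b⟩ h hne
      rw [HasAntidiagonal.mem_antidiagonal] at h
      rw [pow_zero, matCoeff_one, if_neg, zero_mul]
      rintro rfl
      exact hne (Prod.ext rfl (by simpa using h))
    · intro h
      exact absurd (HasAntidiagonal.mem_antidiagonal.2 (zero_add n)) h
  | succ m ih =>
    have h1 : ∀ n, E.expCoeff n * matTwist Fq n E.dphi = ∑ p ∈ antidiagonal n,
        matCoeff p.1 E.phi * matTwist Fq p.1 (E.expCoeff p.2) := fun n => by
      rw [Finset.Nat.sum_antidiagonal_eq_sum_range_succ_mk]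
      exact E.expCoeff_mul n
    rw [pow_succ, matTwist_eq, map_mul, ← matTwist_eq, ← matTwist_eq, ← mul_assoc, ih, sum_mul]
    have h2 : ∀ p ∈ antidiagonal n, matCoeff p.1 (E.phi ^ m) * matTwist Fq p.1 (E.expCoeff p.2) *
        matTwist Fq n E.dphi = ∑ s ∈ antidiagonal p.2, matCoeff p.1 (E.phi ^ m) *
          matTwist Fq p.1 (matCoeff s.1 E.phi) * matTwist Fq (p.1 + s.1) (E.expCoeff s.2) := by
      intro p hp
      rw [HasAntidiagonal.mem_antidiagonal] at hp
      rw [← hp, ← matTwist_matTwist, mul_assoc, matTwist_eq, matTwist_eq, ← map_mul, h1,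
        map_sum, mul_sum]
      refine sum_congr rfl fun s _ => ?_
      rw [map_mul, ← matTwist_eq, ← matTwist_eq, matTwist_matTwist, mul_assoc]
    rw [sum_congr rfl h2, sum_antidiagonal_assoc n fun a b c => matCoeff a (E.phi ^ m) *
      matTwist Fq a (matCoeff b E.phi) * matTwist Fq (a + b) (E.expCoeff c)]
    refine sum_congr rfl fun p _ => ?_
    rw [pow_succ, matCoeff_mul, sum_mul]
    refine sum_congr rfl fun s hs => ?_
    rw [HasAntidiagonal.mem_antidiagonal.1 hs]

variable (Fq K) in
/-- The element `θ` of `K`. -/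
abbrev thetaK : K := algebraMap (RatFunc Fq) K RatFunc.X

/-- A power of `dφ_t` is a scalar. -/
theorem exists_dphi_pow_eq : ∃ Q, 2 ≤ Q ∧
    E.dphi ^ Q = Matrix.scalar (Fin d) (thetaK Fq K ^ Q) := by
  obtain ⟨k, hk⟩ := E.isNilpotent
  obtain ⟨p, hp⟩ := CharP.exists Fq
  obtain ⟨n, hprime, hn⟩ := FiniteField.card Fq p
  have : Fact p.Prime := ⟨hprime⟩
  have : CharP K p := charP_of_injective_algebraMap (algebraMap Fq K).injective p
  rcases isEmpty_or_nonempty (Fin d) with h | h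
  · exact ⟨2, le_rfl, Subsingleton.elim _ _⟩
  have hQ : k + 1 < p ^ (k + 1) := Nat.lt_pow_self hprime.one_lt
  refine ⟨p ^ (k + 1), ?_, ?_⟩
  · exact le_trans hprime.two_le (Nat.le_self_pow (by omega) p)
  · set N := E.phi.map (fun f => f.coeff 0) - Matrix.scalar (Fin d) (thetaK Fq K) with hN
    have hD : E.dphi = N + Matrix.scalar (Fin d) (thetaK Fq K) := by
      rw [hN, sub_add_cancel]; rfl
    have hc : Commute N (Matrix.scalar (Fin d) (thetaK Fq K)) :=
      (Matrix.scalar_commute _ (fun _ => Commute.all _ _) _).symm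
    -- In characteristic `p` the `p^(k+1)`-th power of `N + θ` is the sum of the powers, and that of
    -- the nilpotent part vanishes because `p^(k+1)` exceeds its nilpotency exponent `k`.
    rw [hD, add_pow_char_pow_of_commute _ _ hc, pow_eq_zero_of_le (by omega) hk, zero_add, map_pow]

variable [Algebra K (CInfty Fq)] [IsScalarTower (RatFunc Fq) K (CInfty Fq)]

theorem algebraMap_thetaK : algebraMap K (CInfty Fq) (thetaK Fq K) = CInfty.theta Fq :=
  (IsScalarTower.algebraMap_apply (RatFunc Fq) K (CInfty Fq) _).symm

theorem norm_theta_pow_sub {a b : ℕ} (h : b < a) :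
    ‖CInfty.theta Fq ^ a - CInfty.theta Fq ^ b‖ = ‖CInfty.theta Fq‖ ^ a := by
  have hlt : ‖CInfty.theta Fq‖ ^ b < ‖CInfty.theta Fq‖ ^ a :=
    pow_lt_pow_right₀ one_lt_norm_theta h
  have := IsUltrametricDist.norm_add_eq_max_of_norm_ne_norm
    (x := CInfty.theta Fq ^ a) (y := -CInfty.theta Fq ^ b)
    (by rw [norm_neg, norm_pow, norm_pow]; exact hlt.ne')
  rw [sub_eq_add_neg, this, norm_neg, norm_pow, norm_pow, max_eq_left hlt.le]

/-- `x` bounds the entries of a matrix over `K`, seen in `ℂ_∞`. -/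
def EntryBound (M : Matrix (Fin d) (Fin d) K) (x : ℝ) : Prop :=
  ∀ i j, ‖algebraMap K (CInfty Fq) (M i j)‖ ≤ x

theorem EntryBound.mul {M N : Matrix (Fin d) (Fin d) K} {x y : ℝ} (hx : 0 ≤ x) (hy : 0 ≤ y)
    (hM : EntryBound (Fq := Fq) M x) (hN : EntryBound (Fq := Fq) N y) :
    EntryBound (Fq := Fq) (M * N) (x * y) := fun i j => by
  rw [Matrix.mul_apply, map_sum]
  refine IsUltrametricDist.norm_sum_le_of_forall_le_of_nonneg (mul_nonneg hx hy) fun k _ => ?_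
  rw [map_mul, norm_mul]
  exact mul_le_mul (hM i k) (hN k j) (norm_nonneg _) hx

theorem EntryBound.sum {ι : Type*} {s : Finset ι} {M : ι → Matrix (Fin d) (Fin d) K} {x : ℝ}
    (hx : 0 ≤ x) (hM : ∀ i ∈ s, EntryBound (Fq := Fq) (M i) x) :
    EntryBound (Fq := Fq) (∑ i ∈ s, M i) x := fun i j => by
  rw [Matrix.sum_apply, map_sum]
  exact IsUltrametricDist.norm_sum_le_of_forall_le_of_nonneg hx fun k hk => hM k hk i j

theorem EntryBound.matTwist {M : Matrix (Fin d) (Fin d) K} {x : ℝ}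
    (hM : EntryBound (Fq := Fq) M x) (n : ℕ) :
    EntryBound (Fq := Fq) (matTwist Fq n M) (x ^ Fintype.card Fq ^ n) := fun i j => by
  rw [TModule.matTwist, Matrix.map_apply, map_pow, norm_pow]
  exact pow_le_pow_left₀ (norm_nonneg _) (hM i j) _

theorem exists_entryBound (M : Matrix (Fin d) (Fin d) K) :
    ∃ x, 1 ≤ x ∧ EntryBound (Fq := Fq) M x := by
  refine ⟨1 + ∑ i, ∑ j, ‖algebraMap K (CInfty Fq) (M i j)‖, ?_, fun i j => ?_⟩
  · have : 0 ≤ ∑ i, ∑ j, ‖algebraMap K (CInfty Fq) (M i j)‖ :=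
      sum_nonneg fun i _ => sum_nonneg fun j _ => norm_nonneg _
    linarith
  · have h1 := single_le_sum (f := fun i => ∑ j, ‖algebraMap K (CInfty Fq) (M i j)‖)
      (fun i _ => sum_nonneg fun j _ => norm_nonneg _) (mem_univ i)
    have h2 := single_le_sum (f := fun j => ‖algebraMap K (CInfty Fq) (M i j)‖)
      (fun j _ => norm_nonneg _) (mem_univ j)
    exact (h2.trans h1).trans (le_add_of_nonneg_left zero_le_one)

theorem exists_entryBound_of_lt (M : ℕ → Matrix (Fin d) (Fin d) K) (N : ℕ) :
    ∃ x, 1 ≤ x ∧ ∀ n < N, EntryBound (Fq := Fq) (M n) x := by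
  choose x hx hM using fun n => exists_entryBound (Fq := Fq) (M n)
  refine ⟨1 + ∑ n ∈ range N, x n, ?_, fun n hn i j => (hM n i j).trans ?_⟩
  · have : 0 ≤ ∑ n ∈ range N, x n := sum_nonneg fun n _ => zero_le_one.trans (hx n)
    linarith
  · have := single_le_sum (f := x) (fun n _ => zero_le_one.trans (hx n)) (mem_range.2 hn)
    linarith

/-- The functional equation is used for `t^Q` instead of `t`, with `dφ_t^Q` the scalar `θ^Q`. The
Sylvester operator then becomes multiplication by `θ^(Q q^n) - θ^Q`, of norm `|θ|^(Q q^n)`, and can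
be divided out. Hence a bound `x^(q^m)` on the preceding `S` coefficients improves to `(x /
|θ|)^(q^n)` on the next one. -/
theorem expCoeff_step : ∃ n₀ S : ℕ, ∀ x : ℝ, 0 ≤ x → ∀ n, n₀ ≤ n →
    (∀ m, n ≤ m + S → m < n →
      EntryBound (Fq := Fq) (E.expCoeff m) (x ^ Fintype.card Fq ^ m)) →
    EntryBound (Fq := Fq) (E.expCoeff n) ((x / ‖CInfty.theta Fq‖) ^ Fintype.card Fq ^ n) := by
  obtain ⟨Q, hQ2, hQ⟩ := E.exists_dphi_pow_eq
  obtain ⟨S, hS⟩ := exists_matCoeff_eq_zero (E.phi ^ Q)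
  obtain ⟨B, hB1, hB⟩ := exists_entryBound_of_lt (Fq := Fq) (fun k => matCoeff k (E.phi ^ Q)) S
  set b : ℝ := ‖CInfty.theta Fq‖ with hb
  have hb1 : 1 < b := one_lt_norm_theta
  set q := Fintype.card Fq with hq
  have hq1 : 1 < q := Fintype.one_lt_card
  obtain ⟨n₁, hn₁⟩ := ((tendsto_pow_atTop_atTop_of_one_lt hb1).eventually_ge_atTop B).exists
  refine ⟨n₁ + 1, S, fun x hx n hn hm => ?_⟩
  have hw : n < q ^ n := Nat.lt_pow_self hq1
  have key : (thetaK Fq K ^ (Q * q ^ n) - thetaK Fq K ^ Q) • E.expCoeff n =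
      ∑ p ∈ (antidiagonal n).erase (0, n),
        matCoeff p.1 (E.phi ^ Q) * matTwist Fq p.1 (E.expCoeff p.2) := by
    have h := E.expCoeff_mul_pow Q n
    rw [← add_sum_erase _ _ (HasAntidiagonal.mem_antidiagonal.2 (zero_add n) :
      (0, n) ∈ antidiagonal n), matTwist_zero_left, matCoeff_zero_pow] at h
    have e0 : matCoeff 0 E.phi = E.dphi := rfl
    have e1 : matTwist Fq n (Matrix.scalar (Fin d) (thetaK Fq K ^ Q)) =
        Matrix.scalar (Fin d) (thetaK Fq K ^ (Q * q ^ n)) := by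
      ext i j
      simp only [matTwist, Matrix.map_apply, Matrix.scalar_apply, Matrix.diagonal_apply]
      split_ifs
      · rw [pow_mul]
      · exact zero_pow (pow_ne_zero _ Fintype.card_ne_zero)
    rw [e0, hQ, e1] at h
    have e2 : E.expCoeff n * Matrix.scalar (Fin d) (thetaK Fq K ^ (Q * q ^ n)) =
        thetaK Fq K ^ (Q * q ^ n) • E.expCoeff n := by
      rw [Matrix.scalar_apply, ← Matrix.smul_one_eq_diagonal]; simp
    have e3 : Matrix.scalar (Fin d) (thetaK Fq K ^ Q) * E.expCoeff n =
        thetaK Fq K ^ Q • E.expCoeff n := by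
      rw [Matrix.scalar_apply, ← Matrix.smul_one_eq_diagonal]; simp
    rw [sub_smul, sub_eq_iff_eq_add', ← e2, ← e3]
    exact h
  have hbound : ∀ i j, b ^ (Q * q ^ n) * ‖algebraMap K (CInfty Fq) (E.expCoeff n i j)‖ ≤
      B * x ^ q ^ n := by
    intro i j
    have hlt : Q < Q * q ^ n := by nlinarith
    have h1 : EntryBound (Fq := Fq) ((thetaK Fq K ^ (Q * q ^ n) - thetaK Fq K ^ Q) • E.expCoeff n)
        (B * x ^ q ^ n) := by
      rw [key]
      refine EntryBound.sum (by positivity) fun p hp => ?_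
      obtain ⟨p1, p2⟩ := p
      rw [mem_erase, HasAntidiagonal.mem_antidiagonal] at hp
      simp only at hp ⊢
      have hp1 : p1 ≠ 0 := fun h => hp.1 (Prod.ext h (by simp only; omega))
      by_cases hpS : p1 < S
      · have h2 := (hm p2 (by omega) (by omega)).matTwist p1
        rw [← pow_mul, ← pow_add, add_comm p2, hp.2] at h2
        exact (hB p1 hpS).mul (by linarith) (by positivity) h2
      · rw [hS p1 (by omega), zero_mul]
        intro i j
        rw [Matrix.zero_apply, map_zero, norm_zero]
        positivity
    have h2 := h1 i j
    rwa [Matrix.smul_apply, smul_eq_mul, map_mul, map_sub, map_pow, map_pow, algebraMap_thetaK,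
      norm_mul, norm_theta_pow_sub hlt] at h2
  intro i j
  -- As `Q ≥ 2`, one factor `b^((Q-1) q^n)` is available to absorb the bound `B` on the coefficients
  -- of `φ_t^Q`; the remaining factor `b^(q^n)` is the gain.
  have hBb : B ≤ b ^ ((Q - 1) * q ^ n) :=
    hn₁.trans (pow_le_pow_right₀ hb1.le (by nlinarith [Nat.sub_add_cancel (show 1 ≤ Q by omega)]))
  have hsplit : b ^ (Q * q ^ n) = b ^ ((Q - 1) * q ^ n) * b ^ q ^ n := by
    rw [← pow_add]
    congr 1
    obtain ⟨Q', rfl⟩ : ∃ Q', Q = Q' + 1 := ⟨Q - 1, by omega⟩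
    simp only [Nat.add_sub_cancel]
    ring
  have hpos : 0 < b ^ ((Q - 1) * q ^ n) := by positivity
  rw [div_pow, le_div_iff₀ (by positivity)]
  have h3 := hbound i j
  rw [hsplit] at h3
  have h4 : b ^ ((Q - 1) * q ^ n) * (‖algebraMap K (CInfty Fq) (E.expCoeff n i j)‖ * b ^ q ^ n) ≤
      b ^ ((Q - 1) * q ^ n) * x ^ q ^ n := by
    calc _ = b ^ ((Q - 1) * q ^ n) * b ^ q ^ n *
        ‖algebraMap K (CInfty Fq) (E.expCoeff n i j)‖ := by ring
      _ ≤ B * x ^ q ^ n := h3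
      _ ≤ _ := by gcongr
  exact le_of_mul_le_mul_left h4 hpos

theorem EntryBound.mono {M : Matrix (Fin d) (Fin d) K} {x y : ℝ}
    (hM : EntryBound (Fq := Fq) M x) (h : x ≤ y) : EntryBound (Fq := Fq) M y :=
  fun i j => (hM i j).trans h

/-- The coefficients of the exponential decay faster than `δ ^ (q ^ n)` for every `δ > 0`. -/
theorem expCoeff_decay {δ : ℝ} (hδ : 0 < δ) :
    ∃ N, ∀ n, N ≤ n → EntryBound (Fq := Fq) (E.expCoeff n) (δ ^ Fintype.card Fq ^ n) := by
  obtain ⟨n₀, S, hstep⟩ := E.expCoeff_step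
  obtain ⟨x, hx1, hx⟩ := exists_entryBound_of_lt (Fq := Fq) E.expCoeff n₀
  set b : ℝ := ‖CInfty.theta Fq‖ with hb
  have hb1 : 1 < b := one_lt_norm_theta
  have hx0 : 0 ≤ x := zero_le_one.trans hx1
  have h0 : ∀ n, EntryBound (Fq := Fq) (E.expCoeff n) (x ^ Fintype.card Fq ^ n) := by
    intro n
    induction n using Nat.strong_induction_on with
    | _ n ih =>
      rcases lt_or_ge n n₀ with h | h
      · exact (hx n h).mono (le_self_pow₀ hx1 (pow_ne_zero _ Fintype.card_ne_zero))
      · refine (hstep x hx0 n h fun m _ hmn => ih m hmn).mono ?_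
        exact pow_le_pow_left₀ (by positivity) (div_le_self hx0 hb1.le) _
  -- Each further use of the step lemma divides the base by `|θ|`, at the price of starting later.
  have hk : ∀ k : ℕ, ∃ N, ∀ n, N ≤ n →
      EntryBound (Fq := Fq) (E.expCoeff n) ((x / b ^ k) ^ Fintype.card Fq ^ n) := by
    intro k
    induction k with
    | zero => exact ⟨0, fun n _ => by simpa using h0 n⟩
    | succ k ih =>
      obtain ⟨N, hN⟩ := ih
      refine ⟨N + S + n₀, fun n hn => ?_⟩
      have := hstep (x / b ^ k) (by positivity) n (by omega) fun m hm _ => hN m (by omega)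
      rwa [div_div, ← pow_succ] at this
  obtain ⟨k, hk'⟩ := ((tendsto_pow_atTop_atTop_of_one_lt hb1).eventually_ge_atTop (x / δ)).exists
  obtain ⟨N, hN⟩ := hk k
  refine ⟨N, fun n hn => (hN n hn).mono (pow_le_pow_left₀ (by positivity) ?_ _)⟩
  rw [div_le_iff₀ (by positivity)]
  rw [div_le_iff₀ hδ] at hk'
  linarith

end TModule

/-! ### The exponential -/

namespace TModule

variable {Fq : Type*} [Field Fq] [Fintype Fq] {K : Type*} [Field K] [Algebra Fq K]
  {d : ℕ} [Algebra K (CInfty Fq)]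

/-- The additive map `z ↦ M z^(n)` on `ℂ_∞^d`. -/
def twistMulVec (M : Matrix (Fin d) (Fin d) K) (n : ℕ) :
    (Fin d → CInfty Fq) →+ (Fin d → CInfty Fq) where
  toFun z := (M.map (algebraMap K (CInfty Fq))).mulVec fun i => z i ^ Fintype.card Fq ^ n
  map_zero' := by
    have : (fun i => (0 : Fin d → CInfty Fq) i ^ Fintype.card Fq ^ n) = 0 :=
      funext fun i => zero_pow (pow_ne_zero _ Fintype.card_ne_zero)
    rw [this, Matrix.mulVec_zero]
  map_add' z w := by
    rw [← Matrix.mulVec_add]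
    congr 1
    funext i
    exact TwistedPoly.pow_card_pow_add n (z i) (w i)

theorem twistMulVec_apply (M : Matrix (Fin d) (Fin d) K) (n : ℕ) (z : Fin d → CInfty Fq) :
    twistMulVec M n z =
      (M.map (algebraMap K (CInfty Fq))).mulVec fun i => z i ^ Fintype.card Fq ^ n := rfl

theorem continuous_twistMulVec (M : Matrix (Fin d) (Fin d) K) (n : ℕ) :
    Continuous (twistMulVec (Fq := Fq) M n) := by
  change Continuous fun z : Fin d → CInfty Fq =>
    (M.map (algebraMap K (CInfty Fq))).mulVec fun i => z i ^ Fintype.card Fq ^ n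
  fun_prop

theorem twistMulVec_comp (M N : Matrix (Fin d) (Fin d) K) (m n : ℕ) (z : Fin d → CInfty Fq) :
    twistMulVec M m (twistMulVec N n z) =
      twistMulVec (M * matTwist Fq m N) (m + n) z := by
  rw [twistMulVec_apply, twistMulVec_apply, twistMulVec_apply, Matrix.map_mul,
    ← Matrix.mulVec_mulVec]
  congr 1
  funext i
  simp only [Matrix.mulVec, dotProduct, Matrix.map_apply, matTwist]
  rw [← TwistedPoly.frobPow_apply (Fq := Fq), map_sum]
  refine sum_congr rfl fun j _ => ?_
  rw [map_mul, TwistedPoly.frobPow_apply, TwistedPoly.frobPow_apply, map_pow, ← pow_mul, pow_add,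
    mul_comm (Fintype.card Fq ^ n)]

theorem twistMulVec_add_left (M N : Matrix (Fin d) (Fin d) K) (n : ℕ) (z : Fin d → CInfty Fq) :
    twistMulVec (M + N) n z = twistMulVec M n z + twistMulVec N n z := by
  rw [twistMulVec_apply, Matrix.map_add _ (map_add _), Matrix.add_mulVec]
  rfl

theorem twistMulVec_sum_left {ι : Type*} (s : Finset ι) (M : ι → Matrix (Fin d) (Fin d) K) (n : ℕ)
    (z : Fin d → CInfty Fq) :
    twistMulVec (∑ i ∈ s, M i) n z = ∑ i ∈ s, twistMulVec (M i) n z := by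
  classical
  induction s using Finset.induction_on with
  | empty =>
    rw [sum_empty, sum_empty, twistMulVec_apply, Matrix.map_zero _ (map_zero _),
      Matrix.zero_mulVec]
  | insert a s ha ih => rw [sum_insert ha, sum_insert ha, twistMulVec_add_left, ih]

theorem twistMulVec_zero_left (n : ℕ) (z : Fin d → CInfty Fq) :
    twistMulVec (0 : Matrix (Fin d) (Fin d) K) n z = 0 := by
  simpa using twistMulVec_sum_left (∅ : Finset ℕ) (fun _ => (0 : Matrix (Fin d) (Fin d) K)) n z

theorem EntryBound.norm_twistMulVec_le {M : Matrix (Fin d) (Fin d) K} {x : ℝ} (hx : 0 ≤ x)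
    (hM : EntryBound (Fq := Fq) M x) (n : ℕ) (z : Fin d → CInfty Fq) :
    ‖twistMulVec M n z‖ ≤ x * ‖z‖ ^ Fintype.card Fq ^ n := by
  rw [pi_norm_le_iff_of_nonneg (by positivity)]
  intro i
  rw [twistMulVec_apply, Matrix.mulVec, dotProduct]
  refine IsUltrametricDist.norm_sum_le_of_forall_le_of_nonneg (by positivity) fun j _ => ?_
  rw [norm_mul, norm_pow]
  exact mul_le_mul (hM i j) (pow_le_pow_left₀ (norm_nonneg _) (norm_le_pi_norm z j) _)
    (by positivity) hx

/-- The row vector `m` over `K{τ}` as a homomorphism `ℂ_∞^d → ℂ_∞`. -/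
def rowAct (m : Fin d → TwistedPoly Fq K) : (Fin d → CInfty Fq) →+ CInfty Fq where
  toFun g := ∑ i, TwistedPoly.toEnd Fq K (m i) (g i)
  map_zero' := by simp
  map_add' g h := by simp [sum_add_distrib]

theorem rowAct_apply (m : Fin d → TwistedPoly Fq K) (g : Fin d → CInfty Fq) :
    rowAct m g = ∑ i, TwistedPoly.toEnd Fq K (m i) (g i) := rfl

theorem rowAct_add (m n : Fin d → TwistedPoly Fq K) (g : Fin d → CInfty Fq) :
    rowAct (m + n) g = rowAct m g + rowAct n g := by
  simp only [rowAct_apply, Pi.add_apply, map_add, ← sum_add_distrib]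
  rfl

theorem rowAct_smul (a : K) (m : Fin d → TwistedPoly Fq K) (g : Fin d → CInfty Fq) :
    rowAct (a • m) g = algebraMap K (CInfty Fq) a * rowAct m g := by
  simp only [rowAct_apply, Pi.smul_apply, TwistedPoly.toEnd_smul, mul_sum]

theorem toEnd_mul_apply (f g : TwistedPoly Fq K) (z : CInfty Fq) :
    TwistedPoly.toEnd Fq K (f * g) z =
      TwistedPoly.toEnd Fq K f (TwistedPoly.toEnd Fq K g z) := by
  rw [map_mul]; rfl

theorem rowAct_monomial_one_mul (m : Fin d → TwistedPoly Fq K) (g : Fin d → CInfty Fq) :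
    rowAct (fun j => TwistedPoly.monomial 1 1 * m j) g = rowAct m g ^ Fintype.card Fq := by
  simp only [rowAct_apply, toEnd_mul_apply, TwistedPoly.toEnd_monomial, map_one, one_mul, pow_one]
  rw [← CInfty.frob_apply, map_sum]
  rfl

theorem toEnd_sum_apply {ι : Type*} (s : Finset ι) (f : ι → TwistedPoly Fq K) (z : CInfty Fq) :
    TwistedPoly.toEnd Fq K (∑ i ∈ s, f i) z = ∑ i ∈ s, TwistedPoly.toEnd Fq K (f i) z := by
  rw [map_sum]
  exact map_sum (AddMonoidHom.eval z : (CInfty Fq →+ CInfty Fq) →+ CInfty Fq) _ _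

theorem rowAct_single_one (i : Fin d) (g : Fin d → CInfty Fq) :
    rowAct (Pi.single i (1 : TwistedPoly Fq K)) g = g i := by
  rw [rowAct_apply, sum_eq_single i]
  · rw [Pi.single_eq_same, map_one]; rfl
  · intro j _ hj
    rw [Pi.single_eq_of_ne hj, map_zero]; rfl
  · simp

/-- The constant coefficients of a row vector over `K{τ}`. -/
def linPart (m : Fin d → TwistedPoly Fq K) : Fin d → K := fun i => (m i).coeff 0

variable [Algebra (RatFunc Fq) K] (E : TModule Fq K d)

/-- The action of `φ_t` on `E(ℂ_∞)`. -/
def phiAct : (Fin d → CInfty Fq) →+ (Fin d → CInfty Fq) where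
  toFun g i := rowAct (E.phi i) g
  map_zero' := funext fun _ => map_zero _
  map_add' g h := funext fun _ => map_add _ g h

theorem rowAct_vecMul (m : Fin d → TwistedPoly Fq K) (g : Fin d → CInfty Fq) :
    rowAct (Matrix.vecMul m E.phi) g = rowAct m (E.phiAct g) := by
  simp only [rowAct_apply, Matrix.vecMul, dotProduct, toEnd_sum_apply]
  rw [sum_comm]
  refine sum_congr rfl fun i _ => ?_
  change _ = TwistedPoly.toEnd Fq K (m i) (∑ j, TwistedPoly.toEnd Fq K (E.phi i j) (g j))
  rw [map_sum]
  exact sum_congr rfl fun j _ => toEnd_mul_apply _ _ _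

theorem phiAct_eq_sum {S : ℕ} (hS : ∀ n, S ≤ n → matCoeff n E.phi = 0) (g : Fin d → CInfty Fq) :
    E.phiAct g = ∑ k ∈ range S, twistMulVec (matCoeff k E.phi) k g := by
  funext i
  change ∑ j, TwistedPoly.toEnd Fq K (E.phi i j) (g j) = _
  rw [Finset.sum_apply]
  have : ∀ j, TwistedPoly.toEnd Fq K (E.phi i j) (g j) = ∑ k ∈ range S,
      algebraMap K (CInfty Fq) ((E.phi i j).coeff k) * g j ^ Fintype.card Fq ^ k := fun j =>
    TwistedPoly.toEnd_eq_sum _ (fun n hn => congrFun (congrFun (hS n hn) i) j) _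
  simp only [this]
  rw [sum_comm]
  rfl

variable [IsScalarTower Fq (RatFunc Fq) K] [IsScalarTower (RatFunc Fq) K (CInfty Fq)]

theorem norm_sub_le_max_norm (z w : Fin d → CInfty Fq) : ‖z - w‖ ≤ max ‖z‖ ‖w‖ := by
  rw [sub_eq_add_neg, ← norm_neg w]
  exact IsUltrametricDist.norm_add_le_max z (-w)

theorem exp_eq_tsum (z : Fin d → CInfty Fq) :
    E.exp z = ∑' n : ℕ, twistMulVec (E.expCoeff n) n z := rfl

theorem summable_exp (z : Fin d → CInfty Fq) :
    Summable fun n : ℕ => twistMulVec (E.expCoeff n) n z := by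
  refine NonarchimedeanAddGroup.summable_of_tendsto_cofinite_zero ?_
  rw [Nat.cofinite_eq_atTop, tendsto_zero_iff_norm_tendsto_zero]
  set δ : ℝ := (2 * (‖z‖ + 1))⁻¹ with hδ
  have hδ0 : 0 < δ := by positivity
  obtain ⟨N, hN⟩ := E.expCoeff_decay hδ0
  have h1 : Tendsto (fun n : ℕ => (1 / 2 : ℝ) ^ n) atTop (𝓝 0) :=
    tendsto_pow_atTop_nhds_zero_of_lt_one (by norm_num) (by norm_num)
  refine squeeze_zero' (Eventually.of_forall fun n => norm_nonneg _) ?_ h1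
  filter_upwards [eventually_ge_atTop N] with n hn
  refine ((hN n hn).norm_twistMulVec_le (by positivity) n z).trans ?_
  rw [← mul_pow]
  have h2 : δ * ‖z‖ ≤ 1 / 2 := by
    rw [hδ, inv_mul_le_iff₀ (by positivity)]
    linarith
  calc (δ * ‖z‖) ^ Fintype.card Fq ^ n ≤ (1 / 2) ^ Fintype.card Fq ^ n :=
        pow_le_pow_left₀ (by positivity) h2 _
    _ ≤ (1 / 2) ^ n := pow_le_pow_of_le_one (by norm_num) (by norm_num)
        (Nat.lt_pow_self Fintype.one_lt_card).le

theorem hasSum_exp (z : Fin d → CInfty Fq) :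
    HasSum (fun n : ℕ => twistMulVec (E.expCoeff n) n z) (E.exp z) := (E.summable_exp z).hasSum

/-- The exponential as an additive homomorphism. -/
def expHom : (Fin d → CInfty Fq) →+ (Fin d → CInfty Fq) where
  toFun := E.exp
  map_zero' := by simp [exp_eq_tsum]
  map_add' z w := by
    simp only [exp_eq_tsum, map_add]
    exact (E.summable_exp z).tsum_add (E.summable_exp w)

theorem expHom_apply (z : Fin d → CInfty Fq) : E.expHom z = E.exp z := rfl

/-- The matrix of `dφ_t` over `ℂ_∞`. -/
def dphiC : Matrix (Fin d) (Fin d) (CInfty Fq) := E.dphi.map (algebraMap K (CInfty Fq))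

theorem dphiC_mulVec (z : Fin d → CInfty Fq) :
    E.dphiC.mulVec z = twistMulVec E.dphi 0 z := by
  simp [twistMulVec_apply, dphiC]

/-- The functional equation of the exponential. -/
theorem exp_dphi (z : Fin d → CInfty Fq) : E.exp (E.dphiC.mulVec z) = E.phiAct (E.exp z) := by
  obtain ⟨S, hS⟩ := exists_matCoeff_eq_zero E.phi
  rw [E.phiAct_eq_sum hS]
  -- Applying the `τ^k` part of `φ_t` to the exponential series shifts the degree by `k`. Padding
  -- with zeros below `k` indexes all these series by the total degree, so that they can be compared
  -- term by term.
  have h1 : ∀ k, HasSum (fun n => if k ≤ n then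
      twistMulVec (matCoeff k E.phi) k (twistMulVec (E.expCoeff (n - k)) (n - k) z) else 0)
      (twistMulVec (matCoeff k E.phi) k (E.exp z)) := by
    intro k
    refine (hasSum_nat_add_iff' k).1 ?_
    rw [sum_eq_zero (fun i hi => if_neg (by rw [mem_range] at hi; omega)), sub_zero]
    have e : (fun n => if k ≤ n + k then twistMulVec (matCoeff k E.phi) k
        (twistMulVec (E.expCoeff (n + k - k)) (n + k - k) z) else 0) =
        fun n => twistMulVec (matCoeff k E.phi) k (twistMulVec (E.expCoeff n) n z) := by
      funext n
      rw [if_pos (by omega), Nat.add_sub_cancel]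
    rw [e]
    exact (E.hasSum_exp z).map (twistMulVec (matCoeff k E.phi) k) (continuous_twistMulVec _ _)
  refine (E.hasSum_exp _).unique ?_
  convert hasSum_sum (fun k (_ : k ∈ range S) => h1 k) using 1
  funext n
  rw [dphiC_mulVec, twistMulVec_comp, add_zero]
  have h2 := E.expCoeff_mul_pow 1 n
  rw [pow_one, pow_one] at h2
  rw [h2, twistMulVec_sum_left, Finset.Nat.sum_antidiagonal_eq_sum_range_succ_mk]
  have h3 : ∀ k, k ≤ n → twistMulVec (matCoeff k E.phi) k
      (twistMulVec (E.expCoeff (n - k)) (n - k) z) =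
      twistMulVec (matCoeff k E.phi * matTwist Fq k (E.expCoeff (n - k))) n z := by
    intro k hk
    rw [twistMulVec_comp, Nat.add_sub_cancel' hk]
  rw [← sum_filter]
  -- The ranges `k < S` and `k ≤ n` differ only in zero terms: either `φ_t` has no `τ^k` part, or
  -- the padding applies.
  rcases le_total S (n + 1) with h | h
  · rw [← sum_subset (range_subset_range.2 h)]
    · refine (sum_congr ?_ fun k hk => ?_).symm
      · ext k; simp; omega
      · rw [mem_range] at hk
        exact h3 k (by omega)
    · intro k _ hk
      rw [mem_range, not_lt] at hk
      simp only [hS k hk, zero_mul, twistMulVec_zero_left]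
  · refine (sum_congr ?_ fun k hk => ?_).symm
    · ext k; simp; omega
    · rw [mem_range] at hk
      exact h3 k (by omega)

theorem exists_expCoeff_bound : ∃ B : ℝ, 1 ≤ B ∧
    ∀ n, EntryBound (Fq := Fq) (E.expCoeff n) (B ^ Fintype.card Fq ^ n) := by
  obtain ⟨N, hN⟩ := E.expCoeff_decay one_pos
  obtain ⟨B, hB1, hB⟩ := exists_entryBound_of_lt (Fq := Fq) E.expCoeff N
  refine ⟨B, hB1, fun n => ?_⟩
  rcases lt_or_ge n N with h | h
  · exact (hB n h).mono (le_self_pow₀ hB1 (pow_ne_zero _ Fintype.card_ne_zero))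
  · exact (hN n h).mono (by rw [one_pow]; exact one_le_pow₀ hB1)

/-- The exponential is tangent to the identity. -/
theorem exists_norm_exp_sub_le : ∃ B : ℝ, 1 ≤ B ∧
    ∀ z, B * ‖z‖ ≤ 1 → ‖E.exp z - z‖ ≤ (B * ‖z‖) ^ 2 := by
  obtain ⟨B, hB1, hB⟩ := E.exists_expCoeff_bound
  refine ⟨B, hB1, fun z hz => ?_⟩
  have h0 : twistMulVec (E.expCoeff 0) 0 z = z := by
    rw [twistMulVec_apply, expCoeff_zero, Matrix.map_one _ (map_zero _) (map_one _)]
    simp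
  have h1 : E.exp z - z = ∑' n, twistMulVec (E.expCoeff (n + 1)) (n + 1) z := by
    rw [exp_eq_tsum, (E.summable_exp z).tsum_eq_zero_add, h0, add_sub_cancel_left]
  rw [h1]
  refine IsUltrametricDist.norm_tsum_le_of_forall_le_of_nonneg (by positivity) fun n => ?_
  refine ((hB (n + 1)).norm_twistMulVec_le (by positivity) _ z).trans ?_
  rw [← mul_pow]
  refine pow_le_pow_of_le_one (by positivity) hz ?_
  have : 1 < Fintype.card Fq := Fintype.one_lt_card
  calc 2 ≤ Fintype.card Fq := this
    _ ≤ Fintype.card Fq ^ (n + 1) := Nat.le_self_pow (by omega) _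

/-- The exponential is an isometric bijection near zero. -/
theorem exists_radius : ∃ ρ : ℝ, 0 < ρ ∧
    (∀ z, ‖z‖ ≤ ρ → E.exp z = 0 → z = 0) ∧
    ∀ y : Fin d → CInfty Fq, ‖y‖ ≤ ρ → ∃ z, ‖z‖ ≤ ‖y‖ ∧ E.exp z = y := by
  obtain ⟨B, hB1, hB⟩ := E.exists_norm_exp_sub_le
  have hB0 : 0 < B := zero_lt_one.trans_le hB1
  -- The radius `1 / (2 B^2)` is chosen so that the quadratic error `(B ‖z‖)^2` is at most `‖z‖ /
  -- 2`.
  have key : ∀ z, ‖z‖ ≤ (2 * B ^ 2)⁻¹ → ‖E.exp z - z‖ ≤ 2⁻¹ * ‖z‖ := by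
    intro z hz
    have h1 : 2 * B ^ 2 * ‖z‖ ≤ 1 := by
      rwa [← one_div, le_div_iff₀' (by positivity)] at hz
    have h2 : B * ‖z‖ ≤ 1 := by
      refine le_trans ?_ h1
      exact mul_le_mul_of_nonneg_right (by nlinarith) (norm_nonneg _)
    refine (hB z h2).trans ?_
    have : B ^ 2 * ‖z‖ ≤ 2⁻¹ := by linarith
    calc (B * ‖z‖) ^ 2 = B ^ 2 * ‖z‖ * ‖z‖ := by ring
      _ ≤ _ := mul_le_mul_of_nonneg_right this (norm_nonneg _)
  refine ⟨(2 * B ^ 2)⁻¹, by positivity, fun z hz h => ?_, fun y hy => ?_⟩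
  · have := key z hz
    rw [h, zero_sub, norm_neg] at this
    exact norm_le_zero_iff.1 (by linarith)
  -- The fixed points of `z ↦ y - (exp z - z)` are the preimages of `y`. On the closed ball of
  -- radius `‖y‖` this map is a contraction with constant `1/2`, by additivity of the exponential.
  · set f : (Fin d → CInfty Fq) → (Fin d → CInfty Fq) := fun z => y - (E.exp z - z) with hf
    have hmaps : Set.MapsTo f (Metric.closedBall 0 ‖y‖) (Metric.closedBall 0 ‖y‖) := by
      intro z hz
      rw [mem_closedBall_zero_iff] at hz ⊢
      refine (norm_sub_le_max_norm y _).trans (max_le le_rfl ?_)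
      have := key z (hz.trans hy)
      linarith [norm_nonneg z]
    have hcontr : ContractingWith (2⁻¹ : ℝ≥0) (hmaps.restrict f _ _) := by
      refine ⟨by norm_num, LipschitzWith.of_dist_le_mul fun z w => ?_⟩
      obtain ⟨z, hz⟩ := z
      obtain ⟨w, hw⟩ := w
      rw [mem_closedBall_zero_iff] at hz hw
      have hzw : ‖z - w‖ ≤ (2 * B ^ 2)⁻¹ :=
        (norm_sub_le_max_norm z w).trans (max_le (hz.trans hy) (hw.trans hy))
      have e : f z - f w = -(E.exp (z - w) - (z - w)) := by
        have := map_sub E.expHom z w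
        simp only [expHom_apply] at this
        rw [hf, this]
        simp only
        abel
      rw [Subtype.dist_eq, Subtype.dist_eq, dist_eq_norm, dist_eq_norm]
      change ‖f z - f w‖ ≤ _ * ‖z - w‖
      rw [e, norm_neg]
      simpa using key _ hzw
    obtain ⟨z, hz, hfix, -⟩ := hcontr.exists_fixedPoint' (x := 0)
      Metric.isClosed_closedBall.isComplete hmaps
      (by rw [mem_closedBall_zero_iff, norm_zero]; exact norm_nonneg _) (edist_ne_top _ _)
    refine ⟨z, mem_closedBall_zero_iff.1 hz, ?_⟩
    have h : y - (E.exp z - z) = z := hfix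
    rw [sub_sub_eq_add_sub, sub_eq_iff_eq_add, add_comm z] at h
    exact (add_right_cancel h).symm

end TModule

/-! ### The `t`-motive and its cotangent space -/

namespace TModule

variable {Fq : Type*} [Field Fq] [Fintype Fq] {K : Type*} [Field K] [Algebra Fq K]
  {d : ℕ} [Algebra (RatFunc Fq) K] (E : TModule Fq K d)

/-- The row vector over `K{τ}` underlying an element of the motive. -/
abbrev rowVec : E.Motive ≃ₗ[K] (Fin d → TwistedPoly Fq K) := (Module.AEval'.of E.motiveT).symm

theorem rowVec_X_smul (x : E.Motive) :
    E.rowVec ((Polynomial.X : K[X]) • x) = Matrix.vecMul (E.rowVec x) E.phi :=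
  Module.AEval.of_symm_X_smul E.motiveT x

theorem rowVec_C_smul (a : K) (x : E.Motive) :
    E.rowVec (Polynomial.C a • x) = a • E.rowVec x := by
  rw [Module.AEval.C_smul, map_smul]

theorem rowVec_motiveTau (x : E.Motive) :
    E.rowVec (E.motiveTau x) = fun j => TwistedPoly.monomial 1 1 * E.rowVec x j := rfl

theorem motiveTau_add (x y : E.Motive) : E.motiveTau (x + y) = E.motiveTau x + E.motiveTau y := by
  apply E.rowVec.injective
  rw [map_add, rowVec_motiveTau, rowVec_motiveTau, rowVec_motiveTau, map_add]
  funext j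
  exact mul_add _ _ _

theorem motiveTau_X_smul (x : E.Motive) :
    E.motiveTau ((Polynomial.X : K[X]) • x) = (Polynomial.X : K[X]) • E.motiveTau x := by
  apply E.rowVec.injective
  rw [rowVec_motiveTau, rowVec_X_smul, rowVec_X_smul, rowVec_motiveTau]
  funext j
  simp only [Matrix.vecMul, dotProduct, mul_sum, mul_assoc]

theorem motiveTau_C_smul (a : K) (x : E.Motive) :
    E.motiveTau (Polynomial.C a • x) = Polynomial.C (a ^ Fintype.card Fq) • E.motiveTau x := by
  apply E.rowVec.injective
  rw [rowVec_motiveTau, rowVec_C_smul, rowVec_C_smul, rowVec_motiveTau]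
  funext j
  have h : ∀ (c : K) (f : TwistedPoly Fq K), c • f = TwistedPoly.monomial 0 c * f := by
    intro c f
    conv_lhs => rw [← one_mul f, ← TwistedPoly.smul_mul, ← TwistedPoly.monomial_zero_one,
      TwistedPoly.smul_monomial, mul_one]
  rw [Pi.smul_apply, Pi.smul_apply, h, h, ← mul_assoc, ← mul_assoc,
    TwistedPoly.monomial_mul_monomial, TwistedPoly.monomial_mul_monomial]
  simp

variable (Fq K) in
/-- The `q`-power Frobenius of `K` on the coefficients of polynomials. -/
def polyTwist : K[X] →+* K[X] := Polynomial.mapRingHom (TwistedPoly.frobPow Fq K 1)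

theorem motiveTau_smul (p : K[X]) (x : E.Motive) :
    E.motiveTau (p • x) = polyTwist Fq K p • E.motiveTau x := by
  induction p using Polynomial.induction_on' generalizing x with
  | add p q hp hq => rw [add_smul, motiveTau_add, hp, hq, map_add, add_smul]
  | monomial n a =>
    rw [← Polynomial.C_mul_X_pow_eq_monomial, map_mul, map_pow, mul_smul, mul_smul,
      motiveTau_C_smul]
    have h1 : polyTwist Fq K (Polynomial.C a) = Polynomial.C (a ^ Fintype.card Fq) := by
      rw [polyTwist, Polynomial.coe_mapRingHom, Polynomial.map_C, TwistedPoly.frobPow_apply,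
        pow_one]
    have h2 : polyTwist Fq K Polynomial.X = Polynomial.X := Polynomial.map_X _
    rw [h1, h2]
    congr 1
    induction n with
    | zero => simp
    | succ n ih => rw [pow_succ', mul_smul, motiveTau_X_smul, ih, mul_smul]

/-- `motiveTau` as an additive homomorphism. -/
def motiveTauHom : E.Motive →+ E.Motive where
  toFun := E.motiveTau
  map_zero' := by
    have := E.motiveTau_add 0 0
    rwa [add_zero, left_eq_add] at this
  map_add' := E.motiveTau_add

theorem motiveTau_sum {ι : Type*} (s : Finset ι) (f : ι → E.Motive) :
    E.motiveTau (∑ i ∈ s, f i) = ∑ i ∈ s, E.motiveTau (f i) := map_sum E.motiveTauHom f s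

/-- The differential at the origin of an element of the motive, a `K`-linear form on `Lie(E)`. -/
def lin : E.Motive →ₗ[K] (Fin d → K) where
  toFun x := linPart (E.rowVec x)
  map_add' x y := by
    rw [map_add]
    exact funext fun j => TwistedPoly.coeff_add _ _ _
  map_smul' a x := by rw [map_smul]; rfl

theorem lin_apply (x : E.Motive) (j : Fin d) : E.lin x j = (E.rowVec x j).coeff 0 := rfl

theorem lin_X_smul (x : E.Motive) :
    E.lin ((Polynomial.X : K[X]) • x) = Matrix.vecMul (E.lin x) E.dphi := by
  funext j
  rw [lin_apply, rowVec_X_smul]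
  simp only [Matrix.vecMul, dotProduct, TwistedPoly.coeff_sum, TwistedPoly.coeff_zero_mul]
  rfl

theorem lin_C_smul (a : K) (x : E.Motive) : E.lin (Polynomial.C a • x) = a • E.lin x := by
  rw [Module.AEval.C_smul, map_smul]

theorem lin_motiveTau (x : E.Motive) : E.lin (E.motiveTau x) = 0 := by
  funext j
  rw [lin_apply, rowVec_motiveTau]
  exact TwistedPoly.coeff_zero_monomial_one_mul _

theorem lin_smul_eq_zero (p : K[X]) {x : E.Motive} (hx : E.lin x = 0) : E.lin (p • x) = 0 := by
  induction p using Polynomial.induction_on' with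
  | add p q hp hq => rw [add_smul, map_add, hp, hq, add_zero]
  | monomial n a =>
    rw [← Polynomial.C_mul_X_pow_eq_monomial, mul_smul, lin_C_smul]
    have : E.lin ((Polynomial.X : K[X]) ^ n • x) = 0 := by
      induction n with
      | zero => simpa using hx
      | succ n ih => rw [pow_succ', mul_smul, lin_X_smul, ih, Matrix.zero_vecMul]
    rw [this, smul_zero]

/-- The nilpotent part of `dφ_t`. -/
def nilPart : Matrix (Fin d) (Fin d) K := E.dphi - Matrix.scalar (Fin d) (thetaK Fq K)

theorem isNilpotent_nilPart : IsNilpotent E.nilPart := E.isNilpotent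

variable (Fq K) in
/-- The polynomial `t - θ` over `K`. -/
abbrev linTheta : K[X] := Polynomial.X - Polynomial.C (thetaK Fq K)

theorem lin_linTheta_smul (x : E.Motive) :
    E.lin (linTheta Fq K • x) = Matrix.vecMul (E.lin x) E.nilPart := by
  rw [sub_smul, map_sub, lin_X_smul, lin_C_smul, nilPart, Matrix.vecMul_sub]
  congr 1
  rw [Matrix.scalar_apply, ← Matrix.smul_one_eq_diagonal, Matrix.vecMul_smul, Matrix.vecMul_one]

theorem lin_linTheta_pow_smul (n : ℕ) (x : E.Motive) :
    E.lin (linTheta Fq K ^ n • x) = Matrix.vecMul (E.lin x) (E.nilPart ^ n) := by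
  induction n with
  | zero => simp
  | succ n ih => rw [pow_succ', mul_smul, lin_linTheta_smul, ih, Matrix.vecMul_vecMul, pow_succ]

theorem lin_surjective : Function.Surjective E.lin := by
  intro v
  refine ⟨E.rowVec.symm fun j => TwistedPoly.monomial 0 (v j), funext fun j => ?_⟩
  rw [lin_apply, LinearEquiv.apply_symm_apply, TwistedPoly.coeff_monomial, if_pos rfl]

variable {r : ℕ} (m : Module.Basis (Fin r) K[X] E.Motive)

/-- The `K[t]`-submodule of the motive that is generated by the image of `τ`. -/
def tauSpan : Submodule K[X] E.Motive := Submodule.span K[X] (Set.range fun j => E.motiveTau (m j))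

/-- By semilinearity of `τ`, its values on a basis already generate the span of its whole image. -/
theorem motiveTau_mem_tauSpan (x : E.Motive) : E.motiveTau x ∈ E.tauSpan m := by
  rw [← m.sum_repr x, motiveTau_sum]
  refine sum_mem fun j _ => ?_
  rw [motiveTau_smul]
  exact Submodule.smul_mem _ _ (Submodule.subset_span ⟨j, rfl⟩)

/-- A twisted polynomial without constant term is a left `K`-combination of the products `τ τ^k`. -/
theorem mem_tauSpan_of_rowVec {x : E.Motive} (i : Fin d) (f : TwistedPoly Fq K)
    (hf : f.coeff 0 = 0) (hx : E.rowVec x = Pi.single i f) : x ∈ E.tauSpan m := by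
  obtain ⟨N, hN⟩ := TwistedPoly.exists_coeff_eq_zero f
  have h : x = ∑ k ∈ range N, Polynomial.C (f.coeff (k + 1)) •
      E.motiveTau (E.rowVec.symm (Pi.single i (TwistedPoly.monomial k 1))) := by
    apply E.rowVec.injective
    rw [map_sum, hx]
    have h1 : ∀ k, E.rowVec (Polynomial.C (f.coeff (k + 1)) •
        E.motiveTau (E.rowVec.symm (Pi.single i (TwistedPoly.monomial k 1)))) =
        Pi.single i (TwistedPoly.monomial (k + 1) (f.coeff (k + 1))) := by
      intro k
      rw [rowVec_C_smul, rowVec_motiveTau, LinearEquiv.apply_symm_apply]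
      funext j
      by_cases hj : j = i
      · subst hj
        simp only [Pi.smul_apply, Pi.single_eq_same, TwistedPoly.monomial_mul_monomial,
          TwistedPoly.smul_monomial]
        simp [add_comm]
      · simp [hj]
    simp only [h1]
    have h2 : f = ∑ k ∈ range N, TwistedPoly.monomial (k + 1) (f.coeff (k + 1)) := by
      conv_lhs => rw [TwistedPoly.eq_sum_monomial f (N := N + 1) fun n hn => hN n (by omega)]
      rw [sum_range_succ', hf, add_eq_left]
      refine TwistedPoly.ext fun n => ?_
      rw [TwistedPoly.coeff_monomial, TwistedPoly.coeff_zero, ite_self]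
    conv_lhs => rw [h2]
    exact map_sum (AddMonoidHom.single (fun _ : Fin d => TwistedPoly Fq K) i) _ _
  rw [h]
  exact sum_mem fun k _ => Submodule.smul_mem _ _ (E.motiveTau_mem_tauSpan m _)

/-- A homomorphism with zero differential is a combination of elements `τ ∘ y`. Since the
differential is also surjective onto covectors, the quotient of the motive by this span is the dual
of `Lie(E)`, on which `t - θ` is nilpotent. -/
theorem mem_tauSpan_iff (x : E.Motive) : x ∈ E.tauSpan m ↔ E.lin x = 0 := by
  constructor
  · intro hx
    refine Submodule.span_induction (p := fun x _ => E.lin x = 0) ?_ (map_zero _) ?_ ?_ hx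
    · rintro _ ⟨j, rfl⟩
      exact E.lin_motiveTau _
    · intro x y _ _ hx hy
      rw [map_add, hx, hy, add_zero]
    · intro p x _ hx
      exact E.lin_smul_eq_zero p hx
  · intro hx
    have h : x = ∑ i, E.rowVec.symm (Pi.single i (E.rowVec x i)) := by
      apply E.rowVec.injective
      rw [map_sum]
      simp only [LinearEquiv.apply_symm_apply]
      exact (Finset.univ_sum_single _).symm
    rw [h]
    exact sum_mem fun i _ => E.mem_tauSpan_of_rowVec m i (E.rowVec x i) (congrFun hx i)
      (LinearEquiv.apply_symm_apply _ _)

theorem exists_linTheta_pow_smul_mem : ∃ k, ∀ x, linTheta Fq K ^ k • x ∈ E.tauSpan m := by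
  obtain ⟨k, hk⟩ := E.isNilpotent_nilPart
  exact ⟨k, fun x => by
    rw [mem_tauSpan_iff, lin_linTheta_pow_smul, hk, Matrix.vecMul_zero]⟩

theorem prime_linTheta : Prime (linTheta Fq K) := Polynomial.prime_X_sub_C _

variable {m} {Θ : Matrix (Fin r) (Fin r) K[X]}

/-- The determinant of `Θ` is a constant times a power of `t - θ`. -/
theorem exists_det_theta (hd : 1 ≤ d) (hΘ : ∀ i, E.motiveTau (m i) = ∑ j, Θ i j • m j) :
    ∃ c : K, c ≠ 0 ∧ ∃ s, 1 ≤ s ∧ Θ.det = Polynomial.C c * linTheta Fq K ^ s := by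
  obtain ⟨k, hk⟩ := E.exists_linTheta_pow_smul_mem m
  have h1 : ∀ i, ∃ a : Fin r → K[X], ∑ j, a j • E.motiveTau (m j) = linTheta Fq K ^ k • m i :=
    fun i => (Submodule.mem_span_range_iff_exists_fun _).1 (hk (m i))
  choose A hA using h1
  have h2 : (Matrix.of A) * Θ = Matrix.scalar (Fin r) (linTheta Fq K ^ k) := by
    ext1 i l
    -- Compare coordinates in the basis `m`: the expressions of `(t - θ)^k m_i` through the `τ(m_j)`
    -- form a matrix `A` with `A Θ = (t - θ)^k`.
    have h3 := congrArg (fun x => m.repr x l) (hA i)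
    simp only [hΘ, map_sum, map_smul, Finsupp.coe_finsetSum, Finset.sum_apply, Finsupp.smul_apply,
      Module.Basis.repr_self, Finsupp.single_apply, smul_eq_mul] at h3
    rw [Matrix.mul_apply, Matrix.scalar_apply, Matrix.diagonal_apply]
    simpa using h3
  have h3 : Θ.det ∣ linTheta Fq K ^ (k * r) := by
    refine ⟨(Matrix.of A).det, ?_⟩
    rw [mul_comm Θ.det, ← Matrix.det_mul, h2, Matrix.scalar_apply, Matrix.det_diagonal, prod_const,
      card_univ, Fintype.card_fin, pow_mul]
  obtain ⟨s, -, hs⟩ := (dvd_prime_pow prime_linTheta _).1 h3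
  obtain ⟨u, hu⟩ := hs.symm
  obtain ⟨c, hc, hcu⟩ := Polynomial.isUnit_iff.1 u.isUnit
  refine ⟨c, hc.ne_zero, s, ?_, by rw [hcu, mul_comm, hu]⟩
  -- If `s = 0`, then `Θ` is invertible, the `τ(m_j)` generate the motive and all differentials
  -- vanish, which is impossible when `d ≥ 1`.
  by_contra hs0
  have hs0 : s = 0 := by omega
  subst hs0
  have hunit : IsUnit Θ.det := by rw [← hu, pow_zero, one_mul]; exact u.isUnit
  have hlin : ∀ i, E.lin (m i) = 0 := by
    intro i
    rw [← mem_tauSpan_iff E m]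
    have : m i = ∑ j, Θ⁻¹ i j • E.motiveTau (m j) := by
      simp only [hΘ, smul_sum, smul_smul]
      rw [sum_comm]
      have e : ∀ l, ∑ j, (Θ⁻¹ i j * Θ j l) • m l = (1 : Matrix (Fin r) (Fin r) K[X]) i l • m l :=
        fun l => by rw [← sum_smul, ← Matrix.mul_apply, Matrix.nonsing_inv_mul _ hunit]
      simp only [e, Matrix.one_apply]
      simp
    rw [this]
    exact sum_mem fun j _ => Submodule.smul_mem _ _ (E.motiveTau_mem_tauSpan m _)
  have hall : ∀ x, E.lin x = 0 := fun x => by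
    rw [← m.sum_repr x, map_sum]
    exact sum_eq_zero fun i _ => E.lin_smul_eq_zero _ (hlin i)
  obtain ⟨x, hx⟩ := E.lin_surjective (fun _ => 1)
  have := congrFun hx ⟨0, hd⟩
  rw [hall x] at this
  exact zero_ne_one this

/-- Elementary divisors for the inclusion of the span of `τ M` in the motive `M`. -/
theorem exists_elementary_divisors (hdet : Θ.det ≠ 0)
    (hΘ : ∀ i, E.motiveTau (m i) = ∑ j, Θ i j • m j) :
    ∃ (B : GL (Fin r) K[X]) (μ : Module.Basis (Fin r) K[X] E.Motive) (n : Fin r → ℕ),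
      (∀ i, linTheta Fq K ^ n i • μ i = ∑ j, B.1 i j • E.motiveTau (m j)) ∧
      ∀ x, E.lin x = 0 ↔ ∀ i, linTheta Fq K ^ n i ∣ μ.repr x i := by
  classical
  have hli : LinearIndependent K[X] fun j => E.motiveTau (m j) := by
    rw [Fintype.linearIndependent_iff]
    intro g hg
    have h0 : Matrix.vecMul g Θ = 0 := by
      funext l
      have h3 := congrArg (fun x => m.repr x l) hg
      simp only [hΘ, map_sum, map_smul, Finsupp.coe_finsetSum, Finset.sum_apply, Finsupp.smul_apply,
        Module.Basis.repr_self, Finsupp.single_apply, smul_eq_mul] at h3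
      simpa [Matrix.vecMul, dotProduct] using h3
    have := Matrix.eq_zero_of_vecMul_eq_zero hdet h0
    exact fun i => congrFun this i
  let bT : Module.Basis (Fin r) K[X] (E.tauSpan m) := Module.Basis.span hli
  have hbT : ∀ j, (bT j : E.Motive) = E.motiveTau (m j) := fun j =>
    congrArg Subtype.val (Module.Basis.span_apply hli j)
  have hrank : Module.finrank K[X] (E.tauSpan m) = Module.finrank K[X] E.Motive := by
    rw [Module.finrank_eq_card_basis bT, Module.finrank_eq_card_basis m]
  -- Smith normal form over the principal ideal domain `K[t]`, for the span of the `τ(m_j)` inside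
  -- the motive; both have rank `r` because `det Θ ≠ 0`.
  obtain ⟨b', a, ab', hab⟩ := Submodule.exists_smith_normal_form_of_rank_eq m hrank
  obtain ⟨k, hk⟩ := E.exists_linTheta_pow_smul_mem m
  have hdvd : ∀ i, a i ∣ linTheta Fq K ^ k := by
    intro i
    have h1 := ab'.sum_repr ⟨_, hk (b' i)⟩
    have h2 := congrArg (fun x : E.tauSpan m => b'.repr (x : E.Motive) i) h1
    simp only [Submodule.coe_sum, Submodule.coe_smul, hab, map_sum, map_smul,
      Finsupp.coe_finsetSum, Finset.sum_apply, Finsupp.smul_apply, Module.Basis.repr_self,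
      Finsupp.single_apply, smul_eq_mul] at h2
    simp only [mul_ite, mul_one, mul_zero, sum_ite_eq', mem_univ, if_true] at h2
    exact ⟨_, by rw [← h2, mul_comm]⟩
  -- The invariant factors divide `(t - θ)^k`, so they are powers of `t - θ` up to units, and the
  -- units are absorbed into the basis `μ`.
  choose n _ hn using fun i => (dvd_prime_pow prime_linTheta _).1 (hdvd i)
  choose u hu using hn
  let μ := b'.unitsSMul fun i => (u i)⁻¹
  have hμ : ∀ i, linTheta Fq K ^ n i • μ i = (ab' i : E.Motive) := by
    intro i
    rw [hab, Module.Basis.unitsSMul_apply, ← hu, Units.smul_def, smul_smul, mul_assoc,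
      Units.mul_inv, mul_one]
  have hmul : (bT.toMatrix ab') * (ab'.toMatrix bT) = 1 := bT.toMatrix_mul_toMatrix_flip ab'
  have hmul' : (ab'.toMatrix bT) * (bT.toMatrix ab') = 1 := ab'.toMatrix_mul_toMatrix_flip bT
  -- The matrix `B` is the transposed change of basis, within the span, between the `τ(m_j)` and the
  -- adapted basis `(t - θ)^(n_i) μ_i`.
  refine ⟨⟨(bT.toMatrix ab').transpose, (ab'.toMatrix bT).transpose, ?_, ?_⟩, μ, n, ?_, ?_⟩
  · rw [← Matrix.transpose_mul, hmul', Matrix.transpose_one]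
  · rw [← Matrix.transpose_mul, hmul, Matrix.transpose_one]
  · intro i
    rw [hμ]
    conv_lhs => rw [← bT.sum_repr (ab' i)]
    rw [Submodule.coe_sum]
    refine sum_congr rfl fun j _ => ?_
    rw [Submodule.coe_smul, hbT]
    rfl
  · intro x
    rw [← mem_tauSpan_iff E m]
    constructor
    · intro hx i
      have h1 := congrArg Subtype.val (ab'.sum_repr ⟨x, hx⟩)
      simp only [Submodule.coe_sum, Submodule.coe_smul, ← hμ] at h1
      rw [← h1]
      simp only [map_sum, map_smul, Finsupp.coe_finsetSum, Finset.sum_apply, Finsupp.smul_apply,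
        Module.Basis.repr_self, Finsupp.single_apply, smul_eq_mul, mul_ite, mul_one, mul_zero,
        sum_ite_eq', mem_univ, if_true]
      exact dvd_mul_left _ _
    · intro h
      rw [← μ.sum_repr x]
      refine sum_mem fun i _ => ?_
      obtain ⟨e, he⟩ := h i
      rw [he, mul_comm, mul_smul, hμ]
      exact Submodule.smul_mem _ _ (ab' i).2

/-- The linear forms that come from an adapted basis of the motive are a basis of the dual of
`Lie(E)`. -/
theorem exists_lin_basis {μ : Module.Basis (Fin r) K[X] E.Motive} {n : Fin r → ℕ}
    (h : ∀ x, E.lin x = 0 ↔ ∀ i, linTheta Fq K ^ n i ∣ μ.repr x i) :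
    ∃ b : Module.Basis (Σ i, Fin (n i)) K (Fin d → K),
      ∀ s, b s = E.lin (linTheta Fq K ^ (s.2 : ℕ) • μ s.1) := by
  set v : (Σ i, Fin (n i)) → Fin d → K := fun s => E.lin (linTheta Fq K ^ (s.2 : ℕ) • μ s.1)
    with hv
  have hzero : ∀ i, ∀ j, n i ≤ j → E.lin (linTheta Fq K ^ j • μ i) = 0 := by
    intro i j hj
    rw [h]
    intro l
    rw [map_smul, Finsupp.smul_apply, Module.Basis.repr_self, Finsupp.single_apply, smul_eq_mul]
    split_ifs with hl
    · subst hl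
      rw [mul_one]
      exact pow_dvd_pow _ hj
    · rw [mul_zero]
      exact dvd_zero _
  have hli : LinearIndependent K v := by
    rw [Fintype.linearIndependent_iff]
    intro g hg
    have h1 : E.lin (∑ s : Σ i, Fin (n i), (Polynomial.C (g s) * linTheta Fq K ^ (s.2 : ℕ)) •
        μ s.1) = 0 := by
      rw [map_sum, ← hg]
      refine sum_congr rfl fun s _ => ?_
      rw [mul_smul, lin_C_smul]
    rw [h] at h1
    rintro ⟨i, j⟩
    have h2 := h1 i
    rw [Fintype.sum_sigma] at h2
    simp only [map_sum, map_smul, Finsupp.coe_finsetSum, Finset.sum_apply, Finsupp.smul_apply,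
      Module.Basis.repr_self, Finsupp.single_apply, smul_eq_mul, mul_ite, mul_one, mul_zero] at h2
    rw [sum_eq_single i (fun l _ hl => sum_eq_zero fun c _ => if_neg hl) (by simp)] at h2
    simp only [if_true] at h2
    -- Recentring at `θ` turns divisibility by `(t - θ)^(n_i)` into the vanishing of the
    -- coefficients of index below `n_i`.
    have h3 := map_dvd (Polynomial.taylorAlgHom (thetaK Fq K)) h2
    have hX : Polynomial.taylorAlgHom (thetaK Fq K) (linTheta Fq K) = Polynomial.X := by
      change Polynomial.taylor (thetaK Fq K) (linTheta Fq K) = Polynomial.X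
      rw [map_sub, Polynomial.taylor_X, Polynomial.taylor_C, add_sub_cancel_right]
    have hC : ∀ a, Polynomial.taylorAlgHom (thetaK Fq K) (Polynomial.C a) = Polynomial.C a :=
      fun a => Polynomial.taylor_C _ a
    simp only [map_pow, hX, map_sum, map_mul, hC] at h3
    have h4 := Polynomial.X_pow_dvd_iff.1 h3 j j.2
    simp only [Polynomial.finsetSum_coeff, Polynomial.coeff_C_mul, Polynomial.coeff_X_pow] at h4
    rw [sum_eq_single j (fun c _ hc => by
      rw [if_neg (fun h => hc (Fin.ext h.symm)), mul_zero]) (by simp)] at h4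
    simpa using h4
  have hspan : ⊤ ≤ Submodule.span K (Set.range v) := by
    intro w _
    obtain ⟨x, rfl⟩ := E.lin_surjective w
    rw [← μ.sum_repr x, map_sum]
    refine sum_mem fun i _ => ?_
    -- Expand each coordinate in powers of `t - θ`; the powers from `n_i` on map `μ_i` to elements
    -- with zero differential.
    rw [← Polynomial.sum_taylor_eq (μ.repr x i) (thetaK Fq K), Polynomial.sum, sum_smul, map_sum]
    refine sum_mem fun j _ => ?_
    rw [mul_smul, lin_C_smul]
    refine Submodule.smul_mem _ _ ?_
    rcases lt_or_ge j (n i) with hj | hj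
    · exact Submodule.subset_span ⟨⟨i, ⟨j, hj⟩⟩, rfl⟩
    · rw [hzero i j hj]
      exact zero_mem _
  exact ⟨Module.Basis.mk hli hspan, fun s => Module.Basis.mk_apply _ _ _⟩

end TModule

/-! ### Division towers and Anderson generating functions -/

namespace TModule

variable {Fq : Type*} [Field Fq] [Fintype Fq] {K : Type*} [Field K] [Algebra Fq K]
  {d : ℕ} [Algebra (RatFunc Fq) K] (E : TModule Fq K d) [Algebra K (CInfty Fq)]

/-- `g` is a `t`-division tower above `0` in `E(ℂ_∞)`. -/
structure IsTower (g : ℕ → Fin d → CInfty Fq) : Prop where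
  zero : E.phiAct (g 0) = 0
  succ : ∀ n, E.phiAct (g (n + 1)) = g n

/-- The generating series of the values of an element of the motive on a sequence of points. -/
def genSeries (g : ℕ → Fin d → CInfty Fq) : E.Motive →+ (CInfty Fq)⟦X⟧ where
  toFun x := PowerSeries.mk fun n => rowAct (E.rowVec x) (g n)
  map_zero' := by
    ext n
    rw [PowerSeries.coeff_mk, map_zero, rowAct_apply, map_zero]
    refine sum_eq_zero fun i _ => ?_
    rw [Pi.zero_apply, map_zero]
    rfl
  map_add' x y := by
    ext n
    rw [map_add, map_add, PowerSeries.coeff_mk, PowerSeries.coeff_mk, PowerSeries.coeff_mk,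
      rowAct_add]

theorem coeff_genSeries (g : ℕ → Fin d → CInfty Fq) (x : E.Motive) (n : ℕ) :
    PowerSeries.coeff n (E.genSeries g x) = rowAct (E.rowVec x) (g n) := by
  change PowerSeries.coeff n (PowerSeries.mk fun n => rowAct (E.rowVec x) (g n)) = _
  rw [PowerSeries.coeff_mk]

theorem genSeries_add_left (g h : ℕ → Fin d → CInfty Fq) (x : E.Motive) :
    E.genSeries (g + h) x = E.genSeries g x + E.genSeries h x := by
  ext n
  rw [map_add, coeff_genSeries, coeff_genSeries, coeff_genSeries, Pi.add_apply, map_add]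

theorem genSeries_motiveTau (g : ℕ → Fin d → CInfty Fq) (x : E.Motive) :
    E.genSeries g (E.motiveTau x) = twist Fq (E.genSeries g x) := by
  ext n
  rw [coeff_twist, coeff_genSeries, coeff_genSeries, rowVec_motiveTau, rowAct_monomial_one_mul]

variable {E}

theorem IsTower.genSeries_X_smul {g : ℕ → Fin d → CInfty Fq} (hg : E.IsTower g) (x : E.Motive) :
    E.genSeries g ((Polynomial.X : K[X]) • x) = PowerSeries.X * E.genSeries g x := by
  ext n
  rw [coeff_genSeries, rowVec_X_smul, rowAct_vecMul]
  cases n with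
  | zero => rw [hg.zero, map_zero, PowerSeries.coeff_zero_X_mul]
  | succ n => rw [hg.succ, PowerSeries.coeff_succ_X_mul, coeff_genSeries]

theorem genSeries_C_smul (g : ℕ → Fin d → CInfty Fq) (a : K) (x : E.Motive) :
    E.genSeries g (Polynomial.C a • x) =
      PowerSeries.C (algebraMap K (CInfty Fq) a) * E.genSeries g x := by
  ext n
  rw [coeff_genSeries, rowVec_C_smul, rowAct_smul, PowerSeries.coeff_C_mul, coeff_genSeries]

theorem IsTower.genSeries_smul {g : ℕ → Fin d → CInfty Fq} (hg : E.IsTower g) (p : K[X])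
    (x : E.Motive) : E.genSeries g (p • x) = polyToSeries K p * E.genSeries g x := by
  induction p using Polynomial.induction_on' with
  | add p q hp hq => rw [add_smul, map_add, hp, hq, map_add, add_mul]
  | monomial n a =>
    rw [← Polynomial.C_mul_X_pow_eq_monomial, mul_smul, genSeries_C_smul, map_mul,
      polyToSeries_C, mul_assoc, map_pow, polyToSeries_X]
    congr 1
    induction n with
    | zero => simp
    | succ n ih => rw [pow_succ', mul_smul, hg.genSeries_X_smul, ih, pow_succ', mul_assoc]

variable (E)

/-- The coordinate functions of `E` as elements of the motive. -/
def coordFun (i : Fin d) : E.Motive := E.rowVec.symm (Pi.single i 1)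

theorem rowVec_coordFun (i : Fin d) : E.rowVec (E.coordFun i) = Pi.single i 1 :=
  LinearEquiv.apply_symm_apply _ _

theorem coeff_genSeries_coordFun (g : ℕ → Fin d → CInfty Fq) (i : Fin d) (n : ℕ) :
    PowerSeries.coeff n (E.genSeries g (E.coordFun i)) = g n i := by
  rw [coeff_genSeries, rowVec_coordFun, rowAct_single_one]

/-- Every `K[t]`-linear and `τ`-equivariant map from the motive to power series is the generating
series of a division tower. -/
theorem exists_isTower (h : E.Motive →+ (CInfty Fq)⟦X⟧)
    (hsmul : ∀ (p : K[X]) x, h (p • x) = polyToSeries K p * h x)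
    (htau : ∀ x, h (E.motiveTau x) = twist Fq (h x)) :
    ∃ g, E.IsTower g ∧ E.genSeries g = h := by
  -- The tower is forced: its `n`-th point has as coordinates the `n`-th coefficients of the values
  -- of `h` on the coordinate functions. Since the elements `τ^k` of the coordinate functions span
  -- the motive over `K`, equivariance then determines `h`.
  set g : ℕ → Fin d → CInfty Fq := fun n i => PowerSeries.coeff n (h (E.coordFun i)) with hg
  have hmon : ∀ i k, E.genSeries g (E.rowVec.symm (Pi.single i (TwistedPoly.monomial k 1))) =
      h (E.rowVec.symm (Pi.single i (TwistedPoly.monomial k 1))) := by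
    intro i k
    induction k with
    | zero =>
      ext n
      exact E.coeff_genSeries_coordFun g i n
    | succ k ih =>
      have e : E.rowVec.symm (Pi.single i (TwistedPoly.monomial (k + 1) 1)) =
          E.motiveTau (E.rowVec.symm (Pi.single i (TwistedPoly.monomial k 1))) := by
        apply E.rowVec.injective
        rw [rowVec_motiveTau, LinearEquiv.apply_symm_apply, LinearEquiv.apply_symm_apply]
        funext j
        by_cases hj : j = i
        · subst hj
          simp only [Pi.single_eq_same, TwistedPoly.monomial_mul_monomial]
          simp [add_comm]
        · simp [hj]
      rw [e, genSeries_motiveTau, ih, htau]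
  have hC : ∀ i k a, E.genSeries g (E.rowVec.symm (Pi.single i (TwistedPoly.monomial k a))) =
      h (E.rowVec.symm (Pi.single i (TwistedPoly.monomial k a))) := by
    intro i k a
    have e : E.rowVec.symm (Pi.single i (TwistedPoly.monomial k a)) =
        Polynomial.C a • E.rowVec.symm (Pi.single i (TwistedPoly.monomial k 1)) := by
      apply E.rowVec.injective
      rw [rowVec_C_smul, LinearEquiv.apply_symm_apply, LinearEquiv.apply_symm_apply,
        ← Pi.single_smul, TwistedPoly.smul_monomial, mul_one]
    rw [e, genSeries_C_smul, hmon, hsmul, polyToSeries_C]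
  have hall : E.genSeries g = h := by
    refine AddMonoidHom.ext fun x => ?_
    have hx : x = ∑ i, E.rowVec.symm (Pi.single i (E.rowVec x i)) := by
      apply E.rowVec.injective
      rw [map_sum]
      simp only [LinearEquiv.apply_symm_apply]
      exact (Finset.univ_sum_single _).symm
    rw [hx, map_sum, map_sum]
    refine sum_congr rfl fun i _ => ?_
    induction E.rowVec x i using TwistedPoly.induction with
    | h0 => simp
    | hadd f₁ f₂ h₁ h₂ => rw [Pi.single_add, map_add, map_add, map_add, h₁, h₂]
    | hmon n a => exact hC i n a
  -- Linearity of `h` in `t`, read on coefficients, is exactly the division relation of the tower.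
  have hX : ∀ n i, E.phiAct (g n) i =
      PowerSeries.coeff n (PowerSeries.X * h (E.coordFun i)) := by
    intro n i
    rw [← polyToSeries_X (K := K), ← hsmul, ← hall, coeff_genSeries, rowVec_X_smul,
      rowVec_coordFun, Matrix.single_one_vecMul]
    rfl
  refine ⟨g, ⟨funext fun i => ?_, fun n => funext fun i => ?_⟩, hall⟩
  · rw [hX, PowerSeries.coeff_zero_X_mul, Pi.zero_apply]
  · rw [hX, PowerSeries.coeff_succ_X_mul]

variable [IsScalarTower Fq (RatFunc Fq) K] [IsScalarTower (RatFunc Fq) K (CInfty Fq)]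

theorem exists_dphiC_pow_eq : ∃ Q, 2 ≤ Q ∧ E.dphiC ^ Q = CInfty.theta Fq ^ Q • 1 := by
  obtain ⟨Q, hQ2, hQ⟩ := E.exists_dphi_pow_eq
  refine ⟨Q, hQ2, ?_⟩
  have h := congrArg (algebraMap K (CInfty Fq)).mapMatrix hQ
  rw [map_pow] at h
  refine h.trans ?_
  rw [← algebraMap_thetaK (K := K), ← map_pow]
  ext i j
  simp only [RingHom.mapMatrix_apply, Matrix.map_apply, Matrix.scalar_apply,
    Matrix.diagonal_apply, Matrix.smul_apply, Matrix.one_apply]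
  split_ifs <;> simp

theorem isUnit_det_dphiC : IsUnit E.dphiC.det := by
  obtain ⟨Q, hQ2, hQ⟩ := E.exists_dphiC_pow_eq
  rw [isUnit_iff_ne_zero]
  intro h0
  have h := congrArg Matrix.det hQ
  rw [Matrix.det_pow, h0, zero_pow (by omega), Matrix.det_smul, Matrix.det_one, mul_one] at h
  exact pow_ne_zero _ (pow_ne_zero _ theta_ne_zero) h.symm

/-- The sequence `n ↦ (dφ_t)^(-n-1) z`. -/
def divSeq (z : Fin d → CInfty Fq) (n : ℕ) : Fin d → CInfty Fq :=
  (E.dphiC⁻¹ ^ (n + 1)).mulVec z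

theorem dphiC_mulVec_divSeq_zero (z : Fin d → CInfty Fq) :
    E.dphiC.mulVec (E.divSeq z 0) = z := by
  rw [divSeq, Matrix.mulVec_mulVec, zero_add, pow_one,
    Matrix.mul_nonsing_inv _ E.isUnit_det_dphiC, Matrix.one_mulVec]

theorem dphiC_mulVec_divSeq_succ (z : Fin d → CInfty Fq) (n : ℕ) :
    E.dphiC.mulVec (E.divSeq z (n + 1)) = E.divSeq z n := by
  rw [divSeq, divSeq, Matrix.mulVec_mulVec, pow_succ', ← mul_assoc,
    Matrix.mul_nonsing_inv _ E.isUnit_det_dphiC, one_mul]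

theorem divSeq_unique {z : Fin d → CInfty Fq} {w : ℕ → Fin d → CInfty Fq}
    (h0 : E.dphiC.mulVec (w 0) = z) (hs : ∀ n, E.dphiC.mulVec (w (n + 1)) = w n) (n : ℕ) :
    E.divSeq z n = w n := by
  have hinj := Matrix.mulVec_injective_of_isUnit
    ((Matrix.isUnit_iff_isUnit_det _).2 E.isUnit_det_dphiC)
  induction n with
  | zero => exact hinj (by rw [dphiC_mulVec_divSeq_zero, h0])
  | succ n ih => exact hinj (by rw [dphiC_mulVec_divSeq_succ, hs, ih])

theorem divSeq_add (z w : Fin d → CInfty Fq) : E.divSeq (z + w) = E.divSeq z + E.divSeq w :=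
  funext fun _ => Matrix.mulVec_add _ _ _

/-- Since `dφ_t^Q = θ^Q`, the quantity `‖dφ_t^(-n-1) z‖ |θ|^n` is periodic in `n` with period `Q`.
-/
theorem exists_norm_divSeq_le (z : Fin d → CInfty Fq) :
    ∃ A, 0 ≤ A ∧ ∀ n, ‖E.divSeq z n‖ * ‖CInfty.theta Fq‖ ^ n ≤ A := by
  obtain ⟨Q, hQ2, hQ⟩ := E.exists_dphiC_pow_eq
  have hper : ∀ n, ‖E.divSeq z (n + Q)‖ * ‖CInfty.theta Fq‖ ^ (n + Q) =
      ‖E.divSeq z n‖ * ‖CInfty.theta Fq‖ ^ n := by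
    intro n
    have h1 : ∀ k, (E.dphiC ^ k).mulVec (E.divSeq z (n + k)) = E.divSeq z n := by
      intro k
      induction k with
      | zero => rw [pow_zero, Matrix.one_mulVec, add_zero]
      | succ k ih =>
        rw [pow_succ, ← Matrix.mulVec_mulVec, ← add_assoc, dphiC_mulVec_divSeq_succ, ih]
    rw [← h1 Q, hQ, Matrix.smul_mulVec, Matrix.one_mulVec, norm_smul, norm_pow, pow_add]
    ring
  refine ⟨∑ n ∈ range Q, ‖E.divSeq z n‖ * ‖CInfty.theta Fq‖ ^ n,
    sum_nonneg fun n _ => by positivity, fun n => ?_⟩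
  induction n using Nat.strong_induction_on with
  | _ n ih =>
    rcases lt_or_ge n Q with h | h
    · exact single_le_sum (f := fun n => ‖E.divSeq z n‖ * ‖CInfty.theta Fq‖ ^ n)
        (fun n _ => by positivity) (mem_range.2 h)
    · obtain ⟨k, rfl⟩ := Nat.exists_eq_add_of_le' h
      rw [hper]
      exact ih k (by omega)

theorem tendsto_divSeq (z : Fin d → CInfty Fq) : Tendsto (E.divSeq z) atTop (𝓝 0) := by
  obtain ⟨A, hA0, hA⟩ := E.exists_norm_divSeq_le z
  rw [tendsto_zero_iff_norm_tendsto_zero]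
  have h1 : Tendsto (fun n : ℕ => A * (‖CInfty.theta Fq‖⁻¹) ^ n) atTop (𝓝 0) := by
    have := tendsto_pow_atTop_nhds_zero_of_lt_one (inv_nonneg.2 (norm_nonneg (CInfty.theta Fq)))
      (inv_lt_one_of_one_lt₀ one_lt_norm_theta)
    simpa using this.const_mul A
  refine squeeze_zero (fun n => norm_nonneg _) (fun n => ?_) h1
  rw [inv_pow, ← div_eq_mul_inv, le_div_iff₀ (pow_pos norm_theta_pos n)]
  exact hA n

theorem isTower_exp_divSeq {z : Fin d → CInfty Fq} (hz : E.exp z = 0) :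
    E.IsTower fun n => E.exp (E.divSeq z n) where
  zero := by rw [← exp_dphi, dphiC_mulVec_divSeq_zero, hz]
  succ n := by rw [← exp_dphi, dphiC_mulVec_divSeq_succ]

/-- A division tower that tends to zero comes from a period. -/
theorem exists_period_of_isTower {g : ℕ → Fin d → CInfty Fq} (hg : E.IsTower g)
    (h0 : Tendsto g atTop (𝓝 0)) :
    ∃ z, E.exp z = 0 ∧ ∀ n, E.exp (E.divSeq z n) = g n := by
  obtain ⟨ρ, hρ, hinj, hsurj⟩ := E.exists_radius
  obtain ⟨A, hA1, hA⟩ := exists_entryBound (Fq := Fq) E.dphi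
  have hDle : ∀ z, ‖E.dphiC.mulVec z‖ ≤ A * ‖z‖ := by
    intro z
    rw [dphiC_mulVec]
    simpa using hA.norm_twistMulVec_le (by linarith) 0 z
  -- The radius is divided by the bound `A` for `dφ_t` so that the image under `dφ_t` of a chosen
  -- logarithm still lies in the ball where the exponential is injective.
  have hev : ∀ᶠ n in atTop, ‖g n‖ ≤ ρ / A := by
    have h1 := (tendsto_zero_iff_norm_tendsto_zero.1 h0).eventually_lt_const
      (u := ρ / A) (by positivity)
    exact h1.mono fun n hn => hn.le
  obtain ⟨N, hN⟩ := eventually_atTop.1 hev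
  have hρA : ρ / A ≤ ρ := div_le_self hρ.le hA1
  have hex : ∀ n, ∃ z, ‖z‖ ≤ ρ / A ∧ E.exp z = g (N + n) := by
    intro n
    obtain ⟨z, hz1, hz2⟩ := hsurj (g (N + n)) ((hN _ (by omega)).trans hρA)
    exact ⟨z, hz1.trans (hN _ (by omega)), hz2⟩
  choose w hw1 hw2 using hex
  -- Both sides have the same exponential and their difference lies in the injectivity ball, so the
  -- local logarithms are compatible.
  have hw3 : ∀ n, E.dphiC.mulVec (w (n + 1)) = w n := by
    intro n
    rw [← sub_eq_zero]
    refine hinj _ ?_ ?_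
    · refine (norm_sub_le_max_norm _ _).trans (max_le ?_ ((hw1 n).trans hρA))
      refine (hDle _).trans ?_
      have := mul_le_mul_of_nonneg_left (hw1 (n + 1)) (zero_le_one.trans hA1)
      rwa [mul_div_cancel₀ _ (by positivity)] at this
    · have := map_sub E.expHom (E.dphiC.mulVec (w (n + 1))) (w n)
      simp only [expHom_apply] at this
      rw [this, exp_dphi, hw2, hw2, ← add_assoc, hg.succ, sub_self]
  -- The logarithms exist only from index `N` on. Multiplying by `dφ_t^N` moves them back to a
  -- compatible sequence above the full tower, and the period is `dφ_t (v 0)`.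
  set v : ℕ → Fin d → CInfty Fq := fun n => (E.dphiC ^ N).mulVec (w n) with hv
  have hvs : ∀ n, E.dphiC.mulVec (v (n + 1)) = v n := by
    intro n
    rw [hv]
    simp only
    rw [Matrix.mulVec_mulVec, ← pow_succ', pow_succ, ← Matrix.mulVec_mulVec, hw3]
  have hpow : ∀ k n, E.exp ((E.dphiC ^ k).mulVec (w n)) = E.phiAct^[k] (g (N + n)) := by
    intro k n
    induction k with
    | zero => rw [pow_zero, Matrix.one_mulVec, hw2]; rfl
    | succ k ih =>
      rw [pow_succ', ← Matrix.mulVec_mulVec, exp_dphi, ih, Function.iterate_succ_apply']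
  have hit : ∀ k n, E.phiAct^[k] (g (k + n)) = g n := by
    intro k
    induction k with
    | zero => intro n; rw [zero_add]; rfl
    | succ k ih =>
      intro n
      rw [Function.iterate_succ_apply', show k + 1 + n = k + (n + 1) by ring, ih, hg.succ]
  have hexp : ∀ n, E.exp (v n) = g n := fun n => (hpow N n).trans (hit N n)
  refine ⟨E.dphiC.mulVec (v 0), ?_, fun n => ?_⟩
  · rw [exp_dphi, hexp, hg.zero]
  · rw [E.divSeq_unique rfl hvs, hexp]

/-- A period is determined by its division tower. -/
theorem eq_zero_of_exp_divSeq_eq_zero {z : Fin d → CInfty Fq}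
    (h : ∀ n, E.exp (E.divSeq z n) = 0) : z = 0 := by
  obtain ⟨ρ, hρ, hinj, -⟩ := E.exists_radius
  have h1 := (tendsto_zero_iff_norm_tendsto_zero.1 (E.tendsto_divSeq z)).eventually_lt_const hρ
  obtain ⟨n, hn⟩ := h1.exists
  -- The division sequence tends to zero, so one of its terms lies in the ball where the exponential
  -- is injective; invertibility is not needed to return from this term to `z`, only multiplication
  -- by `dφ_t`.
  have h2 : E.divSeq z n = 0 := hinj _ hn.le (h n)
  have hz : ∀ n, E.divSeq z n = 0 → z = 0 := by
    intro n
    induction n with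
    | zero => intro h; rw [← E.dphiC_mulVec_divSeq_zero z, h, Matrix.mulVec_zero]
    | succ n ih =>
      intro h
      exact ih (by rw [← dphiC_mulVec_divSeq_succ, h, Matrix.mulVec_zero])
  exact hz n h2

theorem genSeries_mem_tateAlgebra {g : ℕ → Fin d → CInfty Fq} (hg : Tendsto g atTop (𝓝 0))
    (x : E.Motive) : E.genSeries g x ∈ tateAlgebra Fq := by
  rw [mem_tateAlgebra_iff]
  simp only [coeff_genSeries]
  rw [← tendsto_zero_iff_norm_tendsto_zero]
  have hc : Continuous (rowAct (Fq := Fq) (E.rowVec x)) := by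
    change Continuous fun g : Fin d → CInfty Fq => ∑ i, TwistedPoly.toEnd Fq K (E.rowVec x i) (g i)
    refine continuous_finsetSum _ fun i _ => ?_
    obtain ⟨N, hN⟩ := TwistedPoly.exists_coeff_eq_zero (E.rowVec x i)
    simp only [TwistedPoly.toEnd_eq_sum _ hN]
    fun_prop
  have h := (hc.tendsto 0).comp hg
  rwa [map_zero] at h

theorem tendsto_exp_divSeq (z : Fin d → CInfty Fq) :
    Tendsto (fun n => E.exp (E.divSeq z n)) atTop (𝓝 0) := by
  obtain ⟨B, hB1, hB⟩ := E.exists_norm_exp_sub_le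
  have h1 := tendsto_zero_iff_norm_tendsto_zero.1 (E.tendsto_divSeq z)
  have h2 : Tendsto (fun n => (B * ‖E.divSeq z n‖) ^ 2) atTop (𝓝 0) := by
    simpa using (h1.const_mul B).pow 2
  have h3 : Tendsto (fun n => E.exp (E.divSeq z n) - E.divSeq z n) atTop (𝓝 0) := by
    rw [tendsto_zero_iff_norm_tendsto_zero]
    refine squeeze_zero' (Eventually.of_forall fun n => norm_nonneg _) ?_ h2
    have h4 := h1.eventually_lt_const (u := B⁻¹) (by positivity)
    filter_upwards [h4] with n hn
    refine hB _ ?_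
    rw [← le_div_iff₀' (by positivity), one_div]
    exact hn.le
  simpa using h3.add (E.tendsto_divSeq z)

end TModule

/-! ### The period lattice -/

section Fixed

variable {Fq : Type*} [Field Fq] [Fintype Fq]

theorem exists_algebraMap_of_pow_card {x : CInfty Fq} (hx : x ^ Fintype.card Fq = x) :
    ∃ c : Fq, algebraMap Fq (CInfty Fq) c = x := by
  classical
  set P : (CInfty Fq)[X] := Polynomial.X ^ Fintype.card Fq - Polynomial.X with hP
  have hdeg : P.natDegree = Fintype.card Fq :=
    FiniteField.X_pow_card_sub_X_natDegree_eq _ Fintype.one_lt_card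
  have hP0 : P ≠ 0 := FiniteField.X_pow_card_sub_X_ne_zero _ Fintype.one_lt_card
  have hsub : univ.image (algebraMap Fq (CInfty Fq)) ⊆ P.roots.toFinset := by
    intro y hy
    obtain ⟨c, -, rfl⟩ := mem_image.1 hy
    rw [Multiset.mem_toFinset, Polynomial.mem_roots hP0, Polynomial.IsRoot, hP]
    simp [← map_pow, FiniteField.pow_card]
  have hcard : P.roots.toFinset.card ≤ (univ.image (algebraMap Fq (CInfty Fq))).card := by
    rw [card_image_of_injective _ (algebraMap Fq (CInfty Fq)).injective, card_univ, ← hdeg]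
    exact (Multiset.toFinset_card_le _).trans (Polynomial.card_roots' P)
  have heq := eq_of_subset_of_card_le hsub hcard
  have hmem : x ∈ P.roots.toFinset := by
    rw [Multiset.mem_toFinset, Polynomial.mem_roots hP0, Polynomial.IsRoot, hP]
    simp [hx]
  rw [← heq] at hmem
  obtain ⟨c, -, hc⟩ := mem_image.1 hmem
  exact ⟨c, hc⟩

theorem norm_eq_one_of_pow_card {x : CInfty Fq} (hx : x ^ Fintype.card Fq = x) (h0 : x ≠ 0) :
    ‖x‖ = 1 := by
  have h1 : x ^ (Fintype.card Fq - 1) = 1 := by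
    refine mul_right_cancel₀ h0 ?_
    rw [← pow_succ, Nat.sub_add_cancel Fintype.card_pos, hx, one_mul]
  have h2 : ‖x‖ ^ (Fintype.card Fq - 1) = 1 := by rw [← norm_pow, h1, norm_one]
  have : 1 < Fintype.card Fq := Fintype.one_lt_card
  exact (pow_eq_one_iff_of_nonneg (norm_nonneg x) (by omega)).1 h2

/-- The `τ`-invariants of the Tate algebra are the polynomials over `𝔽_q`. -/
theorem exists_polyToSeries_of_twist_eq {f : (CInfty Fq)⟦X⟧} (hf : f ∈ tateAlgebra Fq)
    (h : twist Fq f = f) : ∃ p : Fq[X], polyToSeries Fq p = f := by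
  have hc : ∀ n, PowerSeries.coeff n f ^ Fintype.card Fq = PowerSeries.coeff n f := fun n => by
    rw [← coeff_twist, h]
  choose c hc' using fun n => exists_algebraMap_of_pow_card (hc n)
  rw [mem_tateAlgebra_iff] at hf
  -- The coefficients lie in `𝔽_q`, whose nonzero elements have norm one; a null sequence of such
  -- elements is eventually zero.
  obtain ⟨N, hN⟩ := eventually_atTop.1 (hf.eventually_lt_const one_pos)
  refine ⟨∑ n ∈ range N, Polynomial.monomial n (c n), ?_⟩
  ext n
  rw [coeff_polyToSeries, Polynomial.finsetSum_coeff]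
  simp only [Polynomial.coeff_monomial, sum_ite_eq', mem_range]
  split_ifs with hn
  · exact hc' n
  · rw [map_zero]
    by_contra h0
    have h1 := norm_eq_one_of_pow_card (hc n) (Ne.symm h0)
    have h2 := hN n (not_lt.1 hn)
    rw [h1] at h2
    exact lt_irrefl _ h2

end Fixed

namespace TModule

variable {Fq : Type*} [Field Fq] [Fintype Fq] {K : Type*} [Field K] [Algebra Fq K]
  {d : ℕ} [Algebra (RatFunc Fq) K] (E : TModule Fq K d) [Algebra K (CInfty Fq)]
  [IsScalarTower Fq (RatFunc Fq) K] [IsScalarTower (RatFunc Fq) K (CInfty Fq)]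

theorem algebraMap_pow_card_pow (c : Fq) (n : ℕ) :
    algebraMap Fq (CInfty Fq) c ^ Fintype.card Fq ^ n = algebraMap Fq (CInfty Fq) c := by
  rw [← map_pow, FiniteField.pow_card_pow]

theorem twistMulVec_smul (M : Matrix (Fin d) (Fin d) K) (n : ℕ) (c : Fq) (z : Fin d → CInfty Fq) :
    twistMulVec M n (algebraMap Fq (CInfty Fq) c • z) =
      algebraMap Fq (CInfty Fq) c • twistMulVec M n z := by
  rw [twistMulVec_apply, twistMulVec_apply, ← Matrix.mulVec_smul]
  congr 1
  funext i
  rw [Pi.smul_apply, smul_eq_mul, mul_pow, algebraMap_pow_card_pow]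
  rfl

theorem exp_smul (c : Fq) (z : Fin d → CInfty Fq) :
    E.exp (algebraMap Fq (CInfty Fq) c • z) = algebraMap Fq (CInfty Fq) c • E.exp z := by
  refine (E.hasSum_exp _).unique ?_
  simp only [twistMulVec_smul]
  exact (E.hasSum_exp z).const_smul _

theorem rowAct_smul_right (m : Fin d → TwistedPoly Fq K) (c : Fq) (g : Fin d → CInfty Fq) :
    rowAct m (algebraMap Fq (CInfty Fq) c • g) = algebraMap Fq (CInfty Fq) c * rowAct m g := by
  rw [rowAct_apply, rowAct_apply, mul_sum]
  refine sum_congr rfl fun i _ => ?_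
  obtain ⟨N, hN⟩ := TwistedPoly.exists_coeff_eq_zero (m i)
  rw [TwistedPoly.toEnd_eq_sum _ hN, TwistedPoly.toEnd_eq_sum _ hN, mul_sum]
  refine sum_congr rfl fun k _ => ?_
  rw [Pi.smul_apply, smul_eq_mul, mul_pow, algebraMap_pow_card_pow]
  ring

theorem lieVec_add (x y : E.Lie) : E.lieVec (x + y) = E.lieVec x + E.lieVec y := map_add _ x y

theorem lieVec_X_smul (x : E.Lie) :
    E.lieVec ((Polynomial.X : Fq[X]) • x) = E.dphiC.mulVec (E.lieVec x) :=
  Module.AEval.of_symm_X_smul E.lieT x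

theorem lieVec_C_smul (c : Fq) (x : E.Lie) :
    E.lieVec (Polynomial.C c • x) = algebraMap Fq (CInfty Fq) c • E.lieVec x := by
  rw [lieVec, Module.AEval.C_smul, map_smul]
  funext i
  rw [Pi.smul_apply, Pi.smul_apply, Algebra.smul_def, smul_eq_mul]
  rfl

/-- The period lattice as an `𝔽_q[t]`-module. -/
def periodModule : Submodule Fq[X] E.Lie where
  carrier := E.periods
  zero_mem' := by
    change E.exp (E.lieVec 0) = 0
    have : E.lieVec 0 = 0 := map_zero (Module.AEval'.of E.lieT).symm
    rw [this]
    exact map_zero E.expHom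
  add_mem' {x y} hx hy := by
    change E.exp (E.lieVec (x + y)) = 0
    rw [lieVec_add]
    have := map_add E.expHom (E.lieVec x) (E.lieVec y)
    rw [expHom_apply, expHom_apply, expHom_apply] at this
    rw [this, show E.exp (E.lieVec x) = 0 from hx, show E.exp (E.lieVec y) = 0 from hy, add_zero]
  smul_mem' p x hx := by
    change E.exp (E.lieVec (p • x)) = 0
    induction p using Polynomial.induction_on' with
    | add p q hp hq =>
      rw [add_smul, lieVec_add]
      have := map_add E.expHom (E.lieVec (p • x)) (E.lieVec (q • x))
      rw [expHom_apply, expHom_apply, expHom_apply] at this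
      rw [this, hp, hq, add_zero]
    | monomial n a =>
      rw [← Polynomial.C_mul_X_pow_eq_monomial, mul_smul, lieVec_C_smul, exp_smul]
      have : E.exp (E.lieVec ((Polynomial.X : Fq[X]) ^ n • x)) = 0 := by
        induction n with
        | zero => rw [pow_zero, one_smul]; exact hx
        | succ n ih => rw [pow_succ', mul_smul, lieVec_X_smul, exp_dphi, ih, map_zero]
      rw [this, smul_zero]

theorem mem_periodModule {x : E.Lie} : x ∈ E.periodModule ↔ E.exp (E.lieVec x) = 0 := Iff.rfl

/-- The Anderson generating function of a vector in `Lie(E)`, evaluated on an element of the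
motive. -/
def agf (lam : E.Lie) : E.Motive →+ (CInfty Fq)⟦X⟧ :=
  E.genSeries fun n => E.exp (E.divSeq (E.lieVec lam) n)

theorem agf_smul {lam : E.Lie} (h : lam ∈ E.periodModule) (p : K[X]) (x : E.Motive) :
    E.agf lam (p • x) = polyToSeries K p * E.agf lam x :=
  (E.isTower_exp_divSeq h).genSeries_smul p x

theorem agf_add_left (lam mu : E.Lie) (x : E.Motive) :
    E.agf (lam + mu) x = E.agf lam x + E.agf mu x := by
  rw [agf, agf, agf, ← genSeries_add_left]
  congr 2
  funext n
  rw [lieVec_add, divSeq_add]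
  exact map_add E.expHom _ _

theorem agf_C_smul_left (c : Fq) (lam : E.Lie) (x : E.Motive) :
    E.agf (Polynomial.C c • lam) x =
      PowerSeries.C (algebraMap Fq (CInfty Fq) c) * E.agf lam x := by
  ext n
  rw [agf, agf, coeff_genSeries, PowerSeries.coeff_C_mul, coeff_genSeries, lieVec_C_smul, divSeq,
    Matrix.mulVec_smul, exp_smul, rowAct_smul_right]
  rfl

/-- Multiplying a period by `t` shifts its division tower by one place, and the new first term is
`exp λ = 0`. -/
theorem agf_X_smul_left {lam : E.Lie} (h : lam ∈ E.periodModule) (x : E.Motive) :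
    E.agf ((Polynomial.X : Fq[X]) • lam) x = PowerSeries.X * E.agf lam x := by
  have hdiv : ∀ n, E.divSeq (E.dphiC.mulVec (E.lieVec lam)) n =
      (fun n => match n with
        | 0 => E.lieVec lam
        | n + 1 => E.divSeq (E.lieVec lam) n : ℕ → Fin d → CInfty Fq) n := by
    refine E.divSeq_unique rfl fun n => ?_
    cases n with
    | zero => exact E.dphiC_mulVec_divSeq_zero _
    | succ n => exact E.dphiC_mulVec_divSeq_succ _ n
  ext n
  rw [agf, coeff_genSeries, lieVec_X_smul, hdiv]
  cases n with
  | zero => rw [PowerSeries.coeff_zero_X_mul, E.mem_periodModule.1 h, map_zero]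
  | succ n => rw [PowerSeries.coeff_succ_X_mul, agf, coeff_genSeries]

theorem agf_zero_left (x : E.Motive) : E.agf 0 x = 0 := by
  have := E.agf_add_left 0 0 x
  rwa [add_zero, left_eq_add] at this

theorem agf_smul_left {lam : E.Lie} (h : lam ∈ E.periodModule) (p : Fq[X]) (x : E.Motive) :
    E.agf (p • lam) x = polyToSeries Fq p * E.agf lam x := by
  induction p using Polynomial.induction_on' with
  | add p q hp hq => rw [add_smul, agf_add_left, hp, hq, map_add, add_mul]
  | monomial n a =>
    rw [← Polynomial.C_mul_X_pow_eq_monomial, mul_smul, agf_C_smul_left, map_mul,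
      polyToSeries_C, mul_assoc, map_pow, polyToSeries_X]
    congr 1
    induction n with
    | zero => simp
    | succ n ih =>
      rw [pow_succ', mul_smul, E.agf_X_smul_left (Submodule.smul_mem _ _ h), ih, pow_succ',
        mul_assoc]

theorem agf_sum_left {r : ℕ} {lam : Fin r → E.Lie} (h : ∀ j, lam j ∈ E.periodModule)
    (p : Fin r → Fq[X]) (x : E.Motive) :
    E.agf (∑ j, p j • lam j) x = ∑ j, polyToSeries Fq (p j) * E.agf (lam j) x := by
  let φ : E.Lie →+ (CInfty Fq)⟦X⟧ :=
    { toFun := fun lam => E.agf lam x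
      map_zero' := E.agf_zero_left x
      map_add' := fun lam mu => E.agf_add_left lam mu x }
  change φ _ = _
  rw [map_sum]
  exact sum_congr rfl fun j _ => E.agf_smul_left (h j) (p j) x

theorem eq_zero_of_agf_eq_zero {r : ℕ} (m : Module.Basis (Fin r) K[X] E.Motive) {lam : E.Lie}
    (hlam : lam ∈ E.periodModule) (h : ∀ i, E.agf lam (m i) = 0) : lam = 0 := by
  have hall : ∀ x, E.agf lam x = 0 := fun x => by
    rw [← m.sum_repr x, map_sum]
    exact sum_eq_zero fun i _ => by rw [agf_smul E hlam, h, mul_zero]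
  have h0 : E.lieVec lam = 0 := E.eq_zero_of_exp_divSeq_eq_zero fun n => funext fun i => by
    have := congrArg (PowerSeries.coeff n) (hall (E.coordFun i))
    rwa [agf, coeff_genSeries_coordFun, map_zero] at this
  exact (Module.AEval'.of E.lieT).symm.injective (h0.trans (map_zero _).symm)

theorem agf_mem_tateAlgebra (lam : E.Lie) (x : E.Motive) : E.agf lam x ∈ tateAlgebra Fq :=
  E.genSeries_mem_tateAlgebra (E.tendsto_exp_divSeq _) x

end TModule

/-! ### Generating functions and the columns of the inverse trivialization -/

section Trivialization

variable {Fq : Type*} [Field Fq] [Fintype Fq] {r : ℕ}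

theorem tateMatrix_mul_inv (Υ : GL (Fin r) (tateAlgebra Fq)) :
    tateMatrix Υ * tateMatrix Υ⁻¹ = 1 := by
  rw [tateMatrix, tateMatrix, ← Matrix.map_mul, Units.mul_inv,
    Matrix.map_one _ (map_zero _) (map_one _)]

theorem tateMatrix_inv_mul (Υ : GL (Fin r) (tateAlgebra Fq)) :
    tateMatrix Υ⁻¹ * tateMatrix Υ = 1 := by
  rw [tateMatrix, tateMatrix, ← Matrix.map_mul, Units.inv_mul,
    Matrix.map_one _ (map_zero _) (map_one _)]

theorem tateMatrix_mem (Υ : GL (Fin r) (tateAlgebra Fq)) (i j : Fin r) :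
    tateMatrix Υ i j ∈ tateAlgebra Fq := (Υ.1 i j).2

variable {K : Type*} [Field K] [Algebra K (CInfty Fq)] {Θ : Matrix (Fin r) (Fin r) K[X]}
  {Υ : GL (Fin r) (tateAlgebra Fq)}

theorem twist_tateMatrix_inv (hΥ : IsRigidAnalyticTrivialization Θ Υ) :
    (tateMatrix Υ⁻¹).map (twist Fq) = Θ.map (polyToSeries K) * tateMatrix Υ⁻¹ := by
  have h1 : (tateMatrix Υ⁻¹).map (twist Fq) * (tateMatrix Υ).map (twist Fq) = 1 := by
    rw [← Matrix.map_mul, tateMatrix_inv_mul, Matrix.map_one _ (map_zero _) (map_one _)]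
  have h2 : Θ.map (polyToSeries K) = (tateMatrix Υ⁻¹).map (twist Fq) * tateMatrix Υ := by
    conv_rhs => rw [← hΥ, ← mul_assoc, h1, one_mul]
  rw [h2, mul_assoc, tateMatrix_mul_inv, mul_one]

end Trivialization

namespace TModule

variable {Fq : Type*} [Field Fq] [Fintype Fq] {K : Type*} [Field K] [Algebra Fq K]
  {d : ℕ} [Algebra (RatFunc Fq) K] (E : TModule Fq K d) [Algebra K (CInfty Fq)]
  [IsScalarTower Fq (RatFunc Fq) K] [IsScalarTower (RatFunc Fq) K (CInfty Fq)]
  {r : ℕ} (m : Module.Basis (Fin r) K[X] E.Motive)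
  {Θ : Matrix (Fin r) (Fin r) K[X]} {Υ : GL (Fin r) (tateAlgebra Fq)}

theorem polyToSeries_polyTwist (p : K[X]) :
    polyToSeries K (polyTwist Fq K p) = twist Fq (polyToSeries K p) := by
  ext n
  rw [coeff_twist, coeff_polyToSeries, coeff_polyToSeries, polyTwist, Polynomial.coe_mapRingHom,
    Polynomial.coeff_map, TwistedPoly.frobPow_apply, pow_one, map_pow]

/-- The `K[t]`-linear extension of a function on a basis of the motive. -/
def basisExtend (y : Fin r → (CInfty Fq)⟦X⟧) : E.Motive →+ (CInfty Fq)⟦X⟧ where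
  toFun x := ∑ i, polyToSeries K (m.repr x i) * y i
  map_zero' := sum_eq_zero fun i _ => by
    rw [map_zero, Finsupp.zero_apply, map_zero, zero_mul]
  map_add' x z := by
    rw [← sum_add_distrib]
    exact sum_congr rfl fun i _ => by rw [map_add, Finsupp.add_apply, map_add, add_mul]

theorem basisExtend_apply (y : Fin r → (CInfty Fq)⟦X⟧) (x : E.Motive) :
    E.basisExtend m y x = ∑ i, polyToSeries K (m.repr x i) * y i := rfl

theorem basisExtend_basis (y : Fin r → (CInfty Fq)⟦X⟧) (i : Fin r) :
    E.basisExtend m y (m i) = y i := by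
  rw [basisExtend_apply, sum_eq_single i]
  · rw [m.repr_self, Finsupp.single_eq_same, map_one, one_mul]
  · intro l _ hl
    rw [m.repr_self, Finsupp.single_eq_of_ne hl, map_zero, zero_mul]
  · exact fun h => absurd (mem_univ i) h

theorem basisExtend_smul (y : Fin r → (CInfty Fq)⟦X⟧) (p : K[X]) (x : E.Motive) :
    E.basisExtend m y (p • x) = polyToSeries K p * E.basisExtend m y x := by
  rw [basisExtend_apply, basisExtend_apply, mul_sum]
  refine sum_congr rfl fun i _ => ?_
  rw [map_smul, Finsupp.smul_apply, smul_eq_mul, map_mul, mul_assoc]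

theorem basisExtend_motiveTau (hΘ : ∀ i, E.motiveTau (m i) = ∑ j, Θ i j • m j)
    {y : Fin r → (CInfty Fq)⟦X⟧}
    (hy : ∀ i, twist Fq (y i) = ∑ j, polyToSeries K (Θ i j) * y j) (x : E.Motive) :
    E.basisExtend m y (E.motiveTau x) = twist Fq (E.basisExtend m y x) := by
  rw [← m.sum_repr x, motiveTau_sum, map_sum, map_sum, map_sum]
  refine sum_congr rfl fun i _ => ?_
  rw [motiveTau_smul, basisExtend_smul, basisExtend_smul, map_mul, polyToSeries_polyTwist,
    basisExtend_basis, hy, hΘ, map_sum]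
  congr 1
  refine sum_congr rfl fun l _ => ?_
  rw [basisExtend_smul, basisExtend_basis]

theorem basisExtend_mem_tateAlgebra {y : Fin r → (CInfty Fq)⟦X⟧} (hy : ∀ i, y i ∈ tateAlgebra Fq)
    (x : E.Motive) : E.basisExtend m y x ∈ tateAlgebra Fq := by
  rw [basisExtend_apply]
  exact Subring.sum_mem _ fun i _ =>
    Subring.mul_mem _ (polyToSeries_mem_tateAlgebra _) (hy i)

/-- The equation `τ(y) = Θ y` says that the `K[t]`-linear extension of `m_i ↦ y_i` is
`τ`-equivariant, so it comes from a division tower. Membership in the Tate algebra makes this tower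
tend to zero, and such a tower comes from a period. -/
theorem exists_period_of_twist_eq (hΘ : ∀ i, E.motiveTau (m i) = ∑ j, Θ i j • m j)
    {y : Fin r → (CInfty Fq)⟦X⟧} (hyT : ∀ i, y i ∈ tateAlgebra Fq)
    (hy : ∀ i, twist Fq (y i) = ∑ j, polyToSeries K (Θ i j) * y j) :
    ∃ lam ∈ E.periodModule, ∀ i, E.agf lam (m i) = y i := by
  obtain ⟨g, hg, hgh⟩ := E.exists_isTower (E.basisExtend m y) (E.basisExtend_smul m y)
    (E.basisExtend_motiveTau m hΘ hy)
  have hg0 : Tendsto g atTop (𝓝 0) := by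
    rw [tendsto_pi_nhds]
    intro i
    have h1 := mem_tateAlgebra_iff.1 (E.basisExtend_mem_tateAlgebra m hyT (E.coordFun i))
    rw [← hgh] at h1
    simp only [coeff_genSeries_coordFun] at h1
    exact tendsto_zero_iff_norm_tendsto_zero.2 h1
  obtain ⟨z, hz, hzg⟩ := E.exists_period_of_isTower hg hg0
  have hlie : E.lieVec (Module.AEval'.of E.lieT z) = z :=
    (Module.AEval'.of E.lieT).symm_apply_apply z
  refine ⟨Module.AEval'.of E.lieT z, ?_, fun i => ?_⟩
  · rw [mem_periodModule, hlie]
    exact hz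
  · rw [← E.basisExtend_basis m y i, ← hgh, agf, hlie, funext hzg]

theorem exists_period_of_column (hΘ : ∀ i, E.motiveTau (m i) = ∑ j, Θ i j • m j)
    (hΥ : IsRigidAnalyticTrivialization Θ Υ) (j : Fin r) :
    ∃ lam ∈ E.periodModule, ∀ i, E.agf lam (m i) = tateMatrix Υ⁻¹ i j := by
  refine E.exists_period_of_twist_eq m hΘ (fun i => tateMatrix_mem Υ⁻¹ i j) fun i => ?_
  have h1 := congrFun (congrFun (twist_tateMatrix_inv hΥ) i) j
  rw [Matrix.map_apply, Matrix.mul_apply] at h1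
  exact h1

theorem eq_of_agf_eq {lam mu : E.Lie} (hlam : lam ∈ E.periodModule) (hmu : mu ∈ E.periodModule)
    (h : ∀ i, E.agf lam (m i) = E.agf mu (m i)) : lam = mu := by
  have h0 : lam - mu = 0 := E.eq_zero_of_agf_eq_zero m (Submodule.sub_mem _ hlam hmu) fun i => by
    have h1 := E.agf_add_left (lam - mu) mu (m i)
    rwa [sub_add_cancel, h, right_eq_add] at h1
  exact sub_eq_zero.1 h0

/-- A relation among the periods is a relation among the columns of `y`, which has the left inverse
`Y`. -/
theorem linearIndependent_of_agf {lam : Fin r → E.Lie} (hlam : ∀ j, lam j ∈ E.periodModule)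
    {Y y : Matrix (Fin r) (Fin r) (CInfty Fq)⟦X⟧} (hYy : Y * y = 1)
    (h : ∀ i j, E.agf (lam j) (m i) = y i j) : LinearIndependent Fq[X] lam := by
  rw [Fintype.linearIndependent_iff]
  intro p hp
  have h1 : y.mulVec (fun j => polyToSeries Fq (p j)) = 0 := by
    funext i
    have h2 := E.agf_sum_left hlam p (m i)
    rw [hp, agf_zero_left] at h2
    rw [Matrix.mulVec, dotProduct, Pi.zero_apply, h2]
    exact sum_congr rfl fun j _ => by rw [h, mul_comm]
  have h2 : (fun j => polyToSeries Fq (p j)) = (0 : Fin r → (CInfty Fq)⟦X⟧) := by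
    rw [← Matrix.one_mulVec (fun j => polyToSeries Fq (p j)), ← hYy, ← Matrix.mulVec_mulVec, h1,
      Matrix.mulVec_zero]
  intro j
  exact polyToSeries_injective ((congrFun h2 j).trans (map_zero _).symm)

theorem mulVec_mem_tateAlgebra {Y : Matrix (Fin r) (Fin r) (CInfty Fq)⟦X⟧}
    (hY : ∀ i j, Y i j ∈ tateAlgebra Fq) {v : Fin r → (CInfty Fq)⟦X⟧}
    (hv : ∀ i, v i ∈ tateAlgebra Fq) (k : Fin r) : Y.mulVec v k ∈ tateAlgebra Fq := by
  rw [Matrix.mulVec, dotProduct]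
  exact Subring.sum_mem _ fun i _ => Subring.mul_mem _ (hY _ _) (hv _)

/-- For a period `x` the vector `v = (f_x(m_i))` satisfies `τ(v) = Θ v`. Hence `Y v` is invariant
under `τ` and lies in `𝔽_q[t]^r`; its entries are the coefficients of `x`, because a period is
determined by its generating function. -/
theorem exists_eq_sum_of_agf (hΘ : ∀ i, E.motiveTau (m i) = ∑ j, Θ i j • m j)
    {lam : Fin r → E.Lie} (hlam : ∀ j, lam j ∈ E.periodModule)
    {Y y : Matrix (Fin r) (Fin r) (CInfty Fq)⟦X⟧} (hyY : y * Y = 1)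
    (hYT : ∀ i j, Y i j ∈ tateAlgebra Fq)
    (hY : Y.map (twist Fq) * Θ.map (polyToSeries K) = Y)
    (h : ∀ i j, E.agf (lam j) (m i) = y i j) {x : E.Lie} (hx : x ∈ E.periodModule) :
    ∃ p : Fin r → Fq[X], x = ∑ j, p j • lam j := by
  have hvt : (fun i => twist Fq (E.agf x (m i))) =
      (Θ.map (polyToSeries K)).mulVec fun i => E.agf x (m i) := by
    funext i
    rw [agf, ← genSeries_motiveTau, hΘ, map_sum]
    exact sum_congr rfl fun j _ => E.agf_smul hx (Θ i j) (m j)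
  have hwt : ∀ k, twist Fq (Y.mulVec (fun i => E.agf x (m i)) k) =
      Y.mulVec (fun i => E.agf x (m i)) k := by
    intro k
    have e1 : twist Fq (Y.mulVec (fun i => E.agf x (m i)) k) =
        (Y.map (twist Fq)).mulVec (fun i => twist Fq (E.agf x (m i))) k := by
      rw [Matrix.mulVec, dotProduct, map_sum]
      exact sum_congr rfl fun i _ => map_mul _ _ _
    rw [e1, hvt, Matrix.mulVec_mulVec, hY]
  have hwm : ∀ k, Y.mulVec (fun i => E.agf x (m i)) k ∈ tateAlgebra Fq :=
    mulVec_mem_tateAlgebra hYT fun i => E.agf_mem_tateAlgebra x (m i)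
  choose p hp using fun k => exists_polyToSeries_of_twist_eq (hwm k) (hwt k)
  refine ⟨p, E.eq_of_agf_eq m hx (Submodule.sum_mem _ fun j _ =>
    Submodule.smul_mem _ _ (hlam j)) fun i => ?_⟩
  have hv : (fun i => E.agf x (m i)) = y.mulVec fun k => polyToSeries Fq (p k) := by
    rw [funext hp, Matrix.mulVec_mulVec, hyY, Matrix.one_mulVec]
  rw [E.agf_sum_left hlam]
  refine (congrFun hv i).trans ?_
  rw [Matrix.mulVec, dotProduct]
  exact sum_congr rfl fun j _ => by rw [h, mul_comm]

/-- The periods whose generating functions are the columns of `Υ⁻¹` are a basis of the period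
lattice. -/
theorem isPeriodBasis_of_agf (hΘ : ∀ i, E.motiveTau (m i) = ∑ j, Θ i j • m j)
    (hΥ : IsRigidAnalyticTrivialization Θ Υ) {lam : Fin r → E.Lie}
    (hlam : ∀ j, lam j ∈ E.periodModule)
    (h : ∀ i j, E.agf (lam j) (m i) = tateMatrix Υ⁻¹ i j) : E.IsPeriodBasis lam where
  linearIndependent := E.linearIndependent_of_agf m hlam (tateMatrix_mul_inv Υ) h
  span_eq := by
    have hle : Submodule.span Fq[X] (Set.range lam) ≤ E.periodModule := by
      rw [Submodule.span_le]
      rintro _ ⟨j, rfl⟩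
      exact hlam j
    refine Set.Subset.antisymm hle fun x hx => ?_
    obtain ⟨p, rfl⟩ := E.exists_eq_sum_of_agf m hΘ hlam (tateMatrix_inv_mul Υ) (tateMatrix_mem Υ)
      hΥ h hx
    exact Submodule.sum_mem _ fun j _ =>
      Submodule.smul_mem _ _ (Submodule.subset_span ⟨j, rfl⟩)

end TModule

/-! ### The polar parts of the generating functions at `t = θ` -/

section Pairing

variable {Fq : Type*} [Field Fq] [Fintype Fq] {K : Type*} [Field K] [Algebra K (CInfty Fq)] {d : ℕ}

/-- The pairing of a covector over `K` with a vector over `ℂ_∞`. -/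
def pairing (v : Fin d → K) : (Fin d → CInfty Fq) →+ CInfty Fq where
  toFun z := ∑ i, algebraMap K (CInfty Fq) (v i) * z i
  map_zero' := sum_eq_zero fun _ _ => mul_zero _
  map_add' x y := by simp only [Pi.add_apply, mul_add, sum_add_distrib]

theorem pairing_apply (v : Fin d → K) (z : Fin d → CInfty Fq) :
    pairing v z = ∑ i, algebraMap K (CInfty Fq) (v i) * z i := rfl

theorem pairing_zero_left (z : Fin d → CInfty Fq) : pairing (0 : Fin d → K) z = 0 := by
  simp [pairing_apply]

theorem pairing_mulVec (v : Fin d → K) (M : Matrix (Fin d) (Fin d) K) (z : Fin d → CInfty Fq) :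
    pairing v ((M.map (algebraMap K (CInfty Fq))).mulVec z) = pairing (Matrix.vecMul v M) z := by
  simp only [pairing_apply, Matrix.mulVec, Matrix.vecMul, dotProduct, map_sum, map_mul, mul_sum,
    sum_mul, Matrix.map_apply]
  rw [sum_comm]
  simp only [mul_assoc]

theorem exists_norm_pairing_le (v : Fin d → K) :
    ∃ C, 0 ≤ C ∧ ∀ z : Fin d → CInfty Fq, ‖pairing v z‖ ≤ C * ‖z‖ := by
  refine ⟨∑ i, ‖algebraMap K (CInfty Fq) (v i)‖, sum_nonneg fun _ _ => norm_nonneg _,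
    fun z => ?_⟩
  rw [pairing_apply, sum_mul]
  refine (norm_sum_le _ _).trans (sum_le_sum fun i _ => ?_)
  rw [norm_mul]
  gcongr
  exact norm_le_pi_norm z i

variable [Algebra Fq K]

open TModule

theorem exists_norm_toEnd_sub_le (f : TwistedPoly Fq K) :
    ∃ C, 0 ≤ C ∧ ∀ z : CInfty Fq, ‖z‖ ≤ 1 →
      ‖TwistedPoly.toEnd Fq K f z - algebraMap K (CInfty Fq) (f.coeff 0) * z‖ ≤ C * ‖z‖ ^ 2 := by
  obtain ⟨N, hN⟩ := TwistedPoly.exists_coeff_eq_zero f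
  refine ⟨∑ k ∈ range N, ‖algebraMap K (CInfty Fq) (f.coeff (k + 1))‖,
    sum_nonneg fun _ _ => norm_nonneg _, fun z hz => ?_⟩
  rw [TwistedPoly.toEnd_eq_sum f (N := N + 1) (fun n hn => hN n (by omega)), sum_range_succ',
    pow_zero, pow_one, add_sub_cancel_right, sum_mul]
  refine (norm_sum_le _ _).trans (sum_le_sum fun k _ => ?_)
  rw [norm_mul, norm_pow]
  refine mul_le_mul_of_nonneg_left (pow_le_pow_of_le_one (norm_nonneg _) hz ?_) (norm_nonneg _)
  calc 2 ≤ Fintype.card Fq := Fintype.one_lt_card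
    _ ≤ Fintype.card Fq ^ (k + 1) := Nat.le_self_pow (by omega) _

theorem TModule.exists_norm_rowAct_sub_le (m : Fin d → TwistedPoly Fq K) :
    ∃ C, 0 ≤ C ∧ ∀ z : Fin d → CInfty Fq, ‖z‖ ≤ 1 →
      ‖rowAct m z - pairing (linPart m) z‖ ≤ C * ‖z‖ ^ 2 := by
  choose C hC0 hC using fun i => exists_norm_toEnd_sub_le (m i)
  refine ⟨∑ i, C i, sum_nonneg fun i _ => hC0 i, fun z hz => ?_⟩
  rw [rowAct_apply, pairing_apply, ← sum_sub_distrib, sum_mul]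
  refine (norm_sum_le _ _).trans (sum_le_sum fun i _ => ?_)
  refine (hC i (z i) ((norm_le_pi_norm z i).trans hz)).trans ?_
  have := hC0 i
  gcongr
  exact norm_le_pi_norm z i

end Pairing

namespace TModule

variable {Fq : Type*} [Field Fq] [Fintype Fq] {K : Type*} [Field K] [Algebra Fq K]
  {d : ℕ} [Algebra (RatFunc Fq) K] (E : TModule Fq K d) [Algebra K (CInfty Fq)]
  [IsScalarTower Fq (RatFunc Fq) K] [IsScalarTower (RatFunc Fq) K (CInfty Fq)]

/-- The exponential and the homomorphism `m` each agree with their linear part up to a quadratic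
error. The exponent two is what enlarges the disc of convergence later. -/
theorem exists_norm_rowAct_exp_sub_le (m : Fin d → TwistedPoly Fq K) :
    ∃ B C : ℝ, 1 ≤ B ∧ 0 ≤ C ∧ ∀ z : Fin d → CInfty Fq, B * ‖z‖ ≤ 1 →
      ‖rowAct m (E.exp z) - pairing (linPart m) z‖ ≤ C * ‖z‖ ^ 2 := by
  obtain ⟨B, hB1, hB⟩ := E.exists_norm_exp_sub_le
  obtain ⟨C, hC0, hC⟩ := exists_norm_rowAct_sub_le (Fq := Fq) m
  obtain ⟨V, hV0, hV⟩ := exists_norm_pairing_le (Fq := Fq) (linPart m)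
  refine ⟨B, C * B ^ 2 + V * B ^ 2, hB1, by positivity, fun z hz => ?_⟩
  have hsub := hB z hz
  have hexp : ‖E.exp z‖ ≤ B * ‖z‖ := by
    have h1 := norm_sub_le_max_norm (E.exp z - z) (-z)
    rw [sub_neg_eq_add, sub_add_cancel, norm_neg] at h1
    refine h1.trans (max_le (hsub.trans ?_) ?_)
    · rw [sq]
      exact mul_le_of_le_one_left (by positivity) hz
    · exact le_mul_of_one_le_left (norm_nonneg _) hB1
  have e : rowAct m (E.exp z) - pairing (linPart m) z =
      (rowAct m (E.exp z) - pairing (linPart m) (E.exp z)) +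
        pairing (linPart m) (E.exp z - z) := by
    rw [map_sub]; ring
  rw [e]
  refine (norm_add_le _ _).trans ?_
  have h1 : ‖rowAct m (E.exp z) - pairing (linPart m) (E.exp z)‖ ≤ C * (B * ‖z‖) ^ 2 :=
    (hC _ (hexp.trans hz)).trans (by gcongr)
  have h2 : ‖pairing (linPart m) (E.exp z - z)‖ ≤ V * (B * ‖z‖) ^ 2 :=
    (hV _).trans (by gcongr)
  linarith [mul_pow B ‖z‖ 2]

/-- The generating series of the linear form `v` on the division tower of `z`. -/
def linSeries (z : Fin d → CInfty Fq) (v : Fin d → K) : (CInfty Fq)⟦X⟧ :=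
  PowerSeries.mk fun n => pairing v (E.divSeq z n)

/-- With `z_n` the division sequence, the error at index `n` is `O(‖z_n‖^2)`. Multiplied by `|θ|^n`
it is `‖z_n‖`, which tends to zero, times the bounded quantity `‖z_n‖ |θ|^n`. So the behaviour of
the generating function at `θ` is that of its linear part. -/
theorem agf_sub_linSeries_mem (lam : E.Lie) (x : E.Motive) :
    E.agf lam x - E.linSeries (E.lieVec lam) (E.lin x) ∈ thetaAlgebra Fq := by
  rw [thetaAlgebra, mem_restricted_iff]
  obtain ⟨B, C, hB1, hC0, hC⟩ := E.exists_norm_rowAct_exp_sub_le (E.rowVec x)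
  obtain ⟨A, hA0, hA⟩ := E.exists_norm_divSeq_le (E.lieVec lam)
  have ht := tendsto_zero_iff_norm_tendsto_zero.1 (E.tendsto_divSeq (E.lieVec lam))
  have hlim : Tendsto (fun n => C * A * ‖E.divSeq (E.lieVec lam) n‖) atTop (𝓝 0) := by
    simpa using ht.const_mul (C * A)
  have hsmall : ∀ᶠ n in atTop, B * ‖E.divSeq (E.lieVec lam) n‖ ≤ 1 := by
    have h1 : Tendsto (fun n => B * ‖E.divSeq (E.lieVec lam) n‖) atTop (𝓝 0) := by
      simpa using ht.const_mul B
    exact h1.eventually_le_const one_pos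
  refine squeeze_zero' (Eventually.of_forall fun n => by positivity) ?_ hlim
  filter_upwards [hsmall] with n hn
  have h1 := hC _ hn
  rw [map_sub, agf, coeff_genSeries, linSeries, PowerSeries.coeff_mk]
  calc _ ≤ C * ‖E.divSeq (E.lieVec lam) n‖ ^ 2 * ‖CInfty.theta Fq‖ ^ n := by
        gcongr
        exact h1
    _ = C * ‖E.divSeq (E.lieVec lam) n‖ *
        (‖E.divSeq (E.lieVec lam) n‖ * ‖CInfty.theta Fq‖ ^ n) := by ring
    _ ≤ C * ‖E.divSeq (E.lieVec lam) n‖ * A := by gcongr; exact hA n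
    _ = _ := by ring

theorem pairing_vecMul_nilPart (v : Fin d → K) (z : Fin d → CInfty Fq) :
    pairing v (E.dphiC.mulVec z) - CInfty.theta Fq * pairing v z =
      pairing (Matrix.vecMul v E.nilPart) z := by
  have h1 : E.dphi = E.nilPart + Matrix.scalar (Fin d) (thetaK Fq K) := by
    rw [nilPart, sub_add_cancel]
  have h2 : Matrix.vecMul v (Matrix.scalar (Fin d) (thetaK Fq K)) = thetaK Fq K • v := by
    rw [Matrix.scalar_apply, ← Matrix.smul_one_eq_diagonal, Matrix.vecMul_smul, Matrix.vecMul_one]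
  rw [dphiC, pairing_mulVec, h1, Matrix.vecMul_add, h2, sub_eq_iff_eq_add]
  simp only [pairing_apply, Pi.add_apply, Pi.smul_apply, smul_eq_mul, map_add, map_mul,
    algebraMap_thetaK, add_mul, sum_add_distrib, mul_sum, mul_assoc]

/-- Formally the series is `⟨v, (dφ_t - t)⁻¹ z⟩`, and `t - θ = N - (dφ_t - t)` with `N` the
nilpotent part. -/
theorem tSubTheta_mul_linSeries (z : Fin d → CInfty Fq) (v : Fin d → K) :
    tSubTheta Fq * E.linSeries z v =
      E.linSeries z (Matrix.vecMul v E.nilPart) - PowerSeries.C (pairing v z) := by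
  ext n
  rw [tSubTheta, sub_mul, map_sub, map_sub, PowerSeries.coeff_C_mul, linSeries,
    PowerSeries.coeff_mk, linSeries, PowerSeries.coeff_mk, ← pairing_vecMul_nilPart]
  cases n with
  | zero =>
    rw [PowerSeries.coeff_zero_X_mul, dphiC_mulVec_divSeq_zero, PowerSeries.coeff_C, if_pos rfl]
    ring
  | succ n =>
    rw [PowerSeries.coeff_succ_X_mul, PowerSeries.coeff_mk, dphiC_mulVec_divSeq_succ,
      PowerSeries.coeff_C, if_neg (Nat.succ_ne_zero n), sub_zero]

/-- Iteration of the preceding identity. Once `v N^k = 0`, only a polynomial in `t - θ` remains,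
with the pairings of `z` and `v N^j` as coefficients. -/
theorem tSubTheta_pow_mul_linSeries (z : Fin d → CInfty Fq) (k : ℕ) (v : Fin d → K) :
    tSubTheta Fq ^ k * E.linSeries z v =
      E.linSeries z (Matrix.vecMul v (E.nilPart ^ k)) -
        ∑ j ∈ range k, PowerSeries.C (pairing (Matrix.vecMul v (E.nilPart ^ j)) z) *
          tSubTheta Fq ^ (k - 1 - j) := by
  induction k generalizing v with
  | zero => simp
  | succ k ih =>
    rw [pow_succ, mul_assoc, tSubTheta_mul_linSeries, mul_sub, ih, sum_range_succ', pow_zero,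
      Matrix.vecMul_one, Matrix.vecMul_vecMul, ← pow_succ']
    have e : ∀ j ∈ range k, PowerSeries.C (pairing (Matrix.vecMul (Matrix.vecMul v E.nilPart)
        (E.nilPart ^ j)) z) * tSubTheta Fq ^ (k - 1 - j) =
        PowerSeries.C (pairing (Matrix.vecMul v (E.nilPart ^ (j + 1))) z) *
          tSubTheta Fq ^ (k + 1 - 1 - (j + 1)) := by
      intro j hj
      have := mem_range.1 hj
      rw [Matrix.vecMul_vecMul, ← pow_succ', show k + 1 - 1 - (j + 1) = k - 1 - j by omega]
    rw [sum_congr rfl e, add_tsub_cancel_right, tsub_zero]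
    ring

/-- The regular part, multiplied by `(t - θ)^k`, has a zero of order `k` at `θ` and contributes
nothing in order `k - 1 - j < k`. The hyperderivative of that order picks out one coefficient of the
remaining polynomial in `t - θ`. -/
theorem hasValueAtTheta_hyperDeriv_agf (lam : E.Lie) (x : E.Motive) {k j : ℕ} (hj : j < k)
    (hx : Matrix.vecMul (E.lin x) (E.nilPart ^ k) = 0) :
    HasValueAtTheta (hyperDeriv (k - 1 - j) (tSubTheta Fq ^ k * E.agf lam x))
      (-pairing (Matrix.vecMul (E.lin x) (E.nilPart ^ j)) (E.lieVec lam)) := by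
  set W := E.agf lam x - E.linSeries (E.lieVec lam) (E.lin x) with hW
  set c : ℕ → CInfty Fq := fun i =>
    pairing (Matrix.vecMul (E.lin x) (E.nilPart ^ i)) (E.lieVec lam) with hc
  have hz : E.linSeries (E.lieVec lam) 0 = 0 := by
    ext n
    rw [linSeries, PowerSeries.coeff_mk, pairing_zero_left, map_zero]
  have e : tSubTheta Fq ^ k * E.agf lam x = tSubTheta Fq ^ k * W +
      ∑ i ∈ range k, PowerSeries.C (-c i) * tSubTheta Fq ^ (k - 1 - i) := by
    have e1 : E.agf lam x = W + E.linSeries (E.lieVec lam) (E.lin x) := by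
      rw [hW, sub_add_cancel]
    rw [e1, mul_add, tSubTheta_pow_mul_linSeries, hx, hz, zero_sub, ← sum_neg_distrib]
    simp only [map_neg, neg_mul, hc]
  have hval : -c j = 0 + ∑ i ∈ range k, -c i * (if k - 1 - j = k - 1 - i then 1 else 0) := by
    rw [zero_add, sum_eq_single j]
    · rw [if_pos rfl, mul_one]
    · intro i hi hij
      have := mem_range.1 hi
      rw [if_neg (by omega), mul_zero]
    · exact fun h => absurd (mem_range.2 hj) h
  rw [e, hyperDeriv_add, hyperDeriv_sum]
  change HasValueAtTheta _ (-c j)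
  rw [hval]
  refine (hyperDeriv_tSubTheta_pow_mul (E.agf_sub_linSeries_mem lam x) k _ (by omega)).add
    (HasValueAtTheta.sum _ fun i _ => ?_)
  rw [hyperDeriv_C_mul]
  exact (hyperDeriv_tSubTheta_pow _ _).C_mul _

end TModule

/-! ### Rigid analytic trivializations are entire -/

/-- A null sequence of nonnegative reals that is dominated by the `q`-th powers of its last terms
decays faster than any geometric sequence. -/
theorem exists_mul_pow_le_of_recurrence {u : ℕ → ℝ} (hu0 : ∀ n, 0 ≤ u n)
    (hu : Tendsto u atTop (𝓝 0)) {C : ℝ} (hC : 0 ≤ C) {q N : ℕ} (hq : 2 ≤ q)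
    (h : ∀ n y, 0 ≤ y → (∀ b ≤ N, b ≤ n → C * u (n - b) ^ q ≤ y) → u n ≤ y)
    {ρ : ℝ} (hρ : 1 ≤ ρ) : ∃ D, ∀ n, u n * ρ ^ n ≤ D := by
  have hρ0 : 0 < ρ := one_pos.trans_le hρ
  -- Chosen so that `C δ ρ^N ≤ 1/2`; once `u n ≤ min δ 1`, the bound `C u^q ≤ C δ u` makes the
  -- recurrence contracting even against the weights `ρ^b`, `b ≤ N`.
  set δ : ℝ := (2 * (C + 1) * ρ ^ N)⁻¹ with hδ
  have hδ0 : 0 < δ := by positivity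
  have hδC : C * δ * ρ ^ N ≤ 1 / 2 := by
    rw [hδ, mul_inv, mul_inv]
    have : ρ ^ N ≠ 0 := by positivity
    have h2 : C * (2⁻¹ * (C + 1)⁻¹ * (ρ ^ N)⁻¹) * ρ ^ N = C * (C + 1)⁻¹ * 2⁻¹ := by
      field_simp
    rw [h2, ← div_eq_mul_inv C]
    have h3 : C / (C + 1) ≤ 1 := (div_le_one (by linarith)).2 (by linarith)
    linarith
  obtain ⟨n₀, hn₀⟩ := eventually_atTop.1 (hu.eventually_le_const (lt_min hδ0 one_pos))
  have hstep : ∀ n, n₀ ≤ n → C * u n ^ q ≤ C * δ * u n := by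
    intro n hn
    have h1 : u n ^ q ≤ u n ^ 2 :=
      pow_le_pow_of_le_one (hu0 n) ((hn₀ n hn).trans (min_le_right _ _)) hq
    have h2 : u n ^ 2 ≤ δ * u n := by
      rw [sq]
      exact mul_le_mul_of_nonneg_right ((hn₀ n hn).trans (min_le_left _ _)) (hu0 n)
    rw [mul_assoc]
    exact mul_le_mul_of_nonneg_left (h1.trans h2) hC
  set D := ∑ n ∈ range (n₀ + N), u n * ρ ^ n with hD
  have hD0 : 0 ≤ D := sum_nonneg fun n _ => mul_nonneg (hu0 n) (by positivity)
  refine ⟨D, fun n => ?_⟩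
  induction n using Nat.strong_induction_on with
  | _ n ih =>
    rcases lt_or_ge n (n₀ + N) with hn | hn
    · exact single_le_sum (f := fun n => u n * ρ ^ n)
        (fun n _ => mul_nonneg (hu0 n) (by positivity)) (mem_range.2 hn)
    · by_contra! hlt
      have hun : 0 < u n := by
        by_contra! h0
        exact absurd hlt (not_lt.2 ((mul_nonpos_of_nonpos_of_nonneg h0 (by positivity)).trans hD0))
      have hρN : 1 ≤ ρ ^ N := one_le_pow₀ hρ
      have hCδ : C * δ ≤ 1 / 2 := by
        refine le_trans ?_ hδC
        exact le_mul_of_one_le_right (by positivity) hρN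
      -- If the weighted term at `n` exceeds `D`, it exceeds all earlier ones, so `u (n - b) ≤ u n
      -- ρ^b`, and the recurrence gives `u n ≤ u n / 2`. The case `b = 0`, where `u n` occurs on
      -- both sides, uses `C δ ≤ 1/2` directly.
      have key : u n ≤ u n / 2 := by
        refine h n _ (by positivity) fun b hb hbn => ?_
        refine (hstep (n - b) (by omega)).trans ?_
        rcases Nat.eq_zero_or_pos b with rfl | hb0
        · rw [tsub_zero]
          nlinarith
        · have h1 := (ih (n - b) (by omega)).trans hlt.le
          have h2 : u n * ρ ^ n = u n * ρ ^ b * ρ ^ (n - b) := by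
            rw [mul_assoc, ← pow_add, Nat.add_sub_cancel' hbn]
          rw [h2] at h1
          have h3 : u (n - b) ≤ u n * ρ ^ b := le_of_mul_le_mul_right h1 (by positivity)
          have h4 : ρ ^ b ≤ ρ ^ N := pow_le_pow_right₀ hρ hb
          calc C * δ * u (n - b) ≤ C * δ * (u n * ρ ^ N) := by
                refine mul_le_mul_of_nonneg_left (h3.trans ?_) (by positivity)
                exact mul_le_mul_of_nonneg_left h4 hun.le
            _ = C * δ * ρ ^ N * u n := by ring
            _ ≤ 1 / 2 * u n := mul_le_mul_of_nonneg_right hδC hun.le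
            _ = u n / 2 := by ring
      linarith

/-! ### Growth of the coefficients of a solution of `τ(Y) Θ = Y` -/

section Recurrence

variable {Fq : Type*} [Field Fq] [Fintype Fq] {K : Type*} [Field K] [Algebra K (CInfty Fq)]
  {r : ℕ} {Y : Matrix (Fin r) (Fin r) (CInfty Fq)⟦X⟧} {Θ : Matrix (Fin r) (Fin r) K[X]}

theorem coeff_of_twist_mul_eq (hY : Y.map (twist Fq) * Θ.map (polyToSeries K) = Y)
    (n : ℕ) (i j : Fin r) :
    PowerSeries.coeff n (Y i j) = ∑ p ∈ antidiagonal n, ∑ k,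
      PowerSeries.coeff p.1 (Y i k) ^ Fintype.card Fq *
        algebraMap K (CInfty Fq) ((Θ k j).coeff p.2) := by
  have h := congrArg (PowerSeries.coeff n) (congrFun (congrFun hY i) j)
  rw [← h, Matrix.mul_apply, map_sum, sum_comm]
  refine sum_congr rfl fun k _ => ?_
  rw [Matrix.map_apply, Matrix.map_apply, PowerSeries.coeff_mul]
  simp only [coeff_twist, coeff_polyToSeries]

theorem exists_coeff_bound (Θ : Matrix (Fin r) (Fin r) K[X]) : ∃ (N : ℕ) (C : ℝ), 0 ≤ C ∧
    (∀ k j b, N < b → (Θ k j).coeff b = 0) ∧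
    ∀ k j b, ‖algebraMap K (CInfty Fq) ((Θ k j).coeff b)‖ ≤ C := by
  obtain ⟨N, hN⟩ := (Set.finite_range fun p : Fin r × Fin r => (Θ p.1 p.2).natDegree).bddAbove
  have hN' : ∀ k j b, N < b → (Θ k j).coeff b = 0 := fun k j b hb =>
    Polynomial.coeff_eq_zero_of_natDegree_lt (lt_of_le_of_lt (hN ⟨(k, j), rfl⟩) hb)
  obtain ⟨C, hC⟩ := (Set.finite_range fun p : Fin r × Fin r × Fin (N + 1) =>
    ‖algebraMap K (CInfty Fq) ((Θ p.1 p.2.1).coeff p.2.2)‖).bddAbove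
  refine ⟨N, max C 0, le_max_right _ _, hN', fun k j b => ?_⟩
  rcases lt_or_ge N b with hb | hb
  · rw [hN' k j b hb, map_zero, norm_zero]
    exact le_max_right _ _
  · exact (hC ⟨(k, j, ⟨b, by omega⟩), rfl⟩).trans (le_max_left _ _)

/-- The matrix of the `n`-th coefficients. -/
def coeffFun (Y : Matrix (Fin r) (Fin r) (CInfty Fq)⟦X⟧) (n : ℕ) : Fin r → Fin r → CInfty Fq :=
  fun i j => PowerSeries.coeff n (Y i j)

theorem norm_coeff_le_coeffFun (n : ℕ) (i j : Fin r) :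
    ‖PowerSeries.coeff n (Y i j)‖ ≤ ‖coeffFun Y n‖ :=
  (norm_le_pi_norm (coeffFun Y n i) j).trans (norm_le_pi_norm (coeffFun Y n) i)

theorem tendsto_coeffFun (hYT : ∀ i j, Y i j ∈ tateAlgebra Fq) :
    Tendsto (coeffFun Y) atTop (𝓝 0) := by
  refine tendsto_pi_nhds.2 fun i => tendsto_pi_nhds.2 fun j => ?_
  exact tendsto_zero_iff_norm_tendsto_zero.2 (mem_tateAlgebra_iff.1 (hYT i j))

/-- On coefficients the equation reads `Y_n = ∑ Y_(n-b)^(q) Θ_b`, with `b` bounded by the degree of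
`Θ`. By the ultrametric inequality the norms satisfy the recurrence of
`exists_mul_pow_le_of_recurrence`. -/
theorem exists_norm_coeff_mul_pow_le (hYT : ∀ i j, Y i j ∈ tateAlgebra Fq)
    (hY : Y.map (twist Fq) * Θ.map (polyToSeries K) = Y) {ρ : ℝ} (hρ : 1 ≤ ρ) :
    ∃ D, ∀ n i j, ‖PowerSeries.coeff n (Y i j)‖ * ρ ^ n ≤ D := by
  obtain ⟨N, C, hC0, hN, hC⟩ := exists_coeff_bound (Fq := Fq) Θ
  obtain ⟨D, hD⟩ := exists_mul_pow_le_of_recurrence (u := fun n => ‖coeffFun Y n‖)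
    (fun _ => norm_nonneg _) (tendsto_zero_iff_norm_tendsto_zero.1 (tendsto_coeffFun hYT)) hC0
    (q := Fintype.card Fq) (N := N) Fintype.one_lt_card (fun n y hy h => by
      refine (pi_norm_le_iff_of_nonneg hy).2 fun i => (pi_norm_le_iff_of_nonneg hy).2 fun j => ?_
      rw [coeffFun, coeff_of_twist_mul_eq hY]
      refine IsUltrametricDist.norm_sum_le_of_forall_le_of_nonneg hy fun p hp =>
        IsUltrametricDist.norm_sum_le_of_forall_le_of_nonneg hy fun k _ => ?_
      have hp' := HasAntidiagonal.mem_antidiagonal.1 hp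
      rcases lt_or_ge N p.2 with hb | hb
      · rw [hN _ _ _ hb, map_zero, mul_zero, norm_zero]
        exact hy
      · refine le_trans ?_ (h p.2 hb (by omega))
        rw [norm_mul, norm_pow, mul_comm, show n - p.2 = p.1 by omega]
        gcongr
        · exact hC _ _ _
        · exact norm_coeff_le_coeffFun _ _ _) hρ
  refine ⟨D, fun n i j => le_trans ?_ (hD n)⟩
  have := norm_coeff_le_coeffFun (Y := Y) n i j
  gcongr

theorem mem_restricted_of_twist_mul_eq (hYT : ∀ i j, Y i j ∈ tateAlgebra Fq)
    (hY : Y.map (twist Fq) * Θ.map (polyToSeries K) = Y) {c : ℝ} (hc : 0 ≤ c) (i j : Fin r) :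
    Y i j ∈ PowerSeries.IsRestricted.subring (R := CInfty Fq) c := by
  obtain ⟨D, hD⟩ := exists_norm_coeff_mul_pow_le hYT hY (ρ := c + 1) (by linarith)
  rw [mem_restricted_iff]
  have h1 : Tendsto (fun n : ℕ => D * (c / (c + 1)) ^ n) atTop (𝓝 0) := by
    have := tendsto_pow_atTop_nhds_zero_of_lt_one (r := c / (c + 1)) (by positivity)
      ((div_lt_one (by linarith)).2 (by linarith))
    simpa using this.const_mul D
  refine squeeze_zero (fun n => by positivity) (fun n => ?_) h1
  have h2 : ‖PowerSeries.coeff n (Y i j)‖ * c ^ n =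
      ‖PowerSeries.coeff n (Y i j)‖ * (c + 1) ^ n * (c / (c + 1)) ^ n := by
    rw [div_pow]
    field_simp
  rw [h2]
  gcongr
  exact hD n i j

end Recurrence

/-! ### Frobenius-linear systems: algebraicity and small solutions -/

section Algebraic

variable {Fq : Type*} [Field Fq] [Fintype Fq]

/-- For transcendental `x` the powers `x^(q^k)` would be infinitely many linearly independent
elements of the finite-dimensional space `V`. -/
theorem isAlgebraic_of_mem_of_pow_card_mem {L : Type*} [Field L] [Algebra L (CInfty Fq)]
    (V : Submodule L (CInfty Fq)) [FiniteDimensional L V]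
    (hV : ∀ v ∈ V, v ^ Fintype.card Fq ∈ V) {x : CInfty Fq} (hx : x ∈ V) : IsAlgebraic L x := by
  by_contra htr
  have hinj : Function.Injective (Polynomial.aeval x : L[X] →ₐ[L] CInfty Fq) :=
    transcendental_iff_injective.1 htr
  have hli : LinearIndependent L fun n : ℕ => x ^ n := by
    have h := (Polynomial.basisMonomials L).linearIndependent.map'
      (Polynomial.aeval x : L[X] →ₐ[L] CInfty Fq).toLinearMap (LinearMap.ker_eq_bot.2 hinj)
    have e : ((Polynomial.aeval x : L[X] →ₐ[L] CInfty Fq).toLinearMap ∘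
        Polynomial.basisMonomials L) = fun n : ℕ => x ^ n := by
      funext n
      simp
    rw [e] at h
    exact h
  have hpow : ∀ k : ℕ, x ^ Fintype.card Fq ^ k ∈ V := by
    intro k
    induction k with
    | zero => simpa using hx
    | succ k ih => rw [pow_succ, pow_mul]; exact hV _ ih
  have hli' : LinearIndependent L fun k : ℕ => (⟨x ^ Fintype.card Fq ^ k, hpow k⟩ : V) :=
    LinearIndependent.of_comp V.subtype
      (hli.comp _ (Nat.pow_right_injective (Fintype.one_lt_card (α := Fq))))
  exact Set.infinite_univ (α := ℕ) (Set.finite_univ_iff.2 hli'.finite)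

theorem sub_pow_card (x y : CInfty Fq) :
    (x - y) ^ Fintype.card Fq = x ^ Fintype.card Fq - y ^ Fintype.card Fq :=
  map_sub (CInfty.frob Fq) x y

theorem add_pow_card (x y : CInfty Fq) :
    (x + y) ^ Fintype.card Fq = x ^ Fintype.card Fq + y ^ Fintype.card Fq :=
  map_add (CInfty.frob Fq) x y

/-- The hypothesis makes the span of `1` and the `y_j` stable under `x ↦ x^q`, by additivity of
Frobenius. Including `1` allows inhomogeneous systems. -/
theorem isAlgebraic_of_pow_card_mem_span {L : Type*} [Field L] [Algebra L (CInfty Fq)] {r : ℕ}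
    (y : Fin r → CInfty Fq)
    (hy : ∀ j, y j ^ Fintype.card Fq ∈ Submodule.span L (insert 1 (Set.range y))) (j : Fin r) :
    IsAlgebraic L (y j) := by
  have : FiniteDimensional L (Submodule.span L (insert 1 (Set.range y))) :=
    FiniteDimensional.span_of_finite L ((Set.finite_range y).insert 1)
  refine isAlgebraic_of_mem_of_pow_card_mem (Submodule.span L (insert 1 (Set.range y)))
    (fun v hv => ?_) (Submodule.subset_span (Or.inr ⟨j, rfl⟩))
  induction hv using Submodule.span_induction with
  | mem x hx =>
    rcases hx with rfl | ⟨k, rfl⟩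
    · rw [one_pow]
      exact Submodule.subset_span (Or.inl rfl)
    · exact hy k
  | zero =>
    rw [zero_pow Fintype.card_ne_zero]
    exact Submodule.zero_mem _
  | add a b _ _ ha hb =>
    rw [add_pow_card]
    exact Submodule.add_mem _ ha hb
  | smul c a _ ha =>
    rw [_root_.smul_pow]
    exact Submodule.smul_mem _ _ ha

/-- A small solution of `y = y^(q) A + s` lies in every closed subfield that contains the
coefficients. -/
theorem mem_of_eq_sum_pow_card_add {L : Subfield (CInfty Fq)} (hL : IsClosed (L : Set (CInfty Fq)))
    {r : ℕ} {y s : Fin r → CInfty Fq} {A : Fin r → Fin r → CInfty Fq}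
    (hy : ∀ j, y j = ∑ k, y k ^ Fintype.card Fq * A k j + s j)
    (hs : ∀ j, s j ∈ L) (hA : ∀ k j, A k j ∈ L) {C : ℝ} (hC0 : 0 ≤ C) (hC : ∀ k j, ‖A k j‖ ≤ C)
    (hy1 : ‖y‖ ≤ 1) (hyC : C * ‖y‖ ≤ 1 / 2) (j : Fin r) : y j ∈ L := by
  -- Fixed point iteration for `y ↦ y^(q) A + s`, started at zero so that all iterates stay in `L`.
  let z : ℕ → Fin r → CInfty Fq := fun m =>
    Nat.rec 0 (fun _ z j => ∑ k, z k ^ Fintype.card Fq * A k j + s j) m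
  have hz0 : z 0 = 0 := rfl
  have hzs : ∀ m j, z (m + 1) j = ∑ k, z m k ^ Fintype.card Fq * A k j + s j := fun _ _ => rfl
  have hzL : ∀ m j, z m j ∈ L := by
    intro m
    induction m with
    | zero => intro j; rw [hz0]; exact L.zero_mem
    | succ m ih =>
      intro j
      rw [hzs]
      exact L.add_mem (L.sum_mem fun k _ => L.mul_mem (L.pow_mem (ih k) _) (hA k j)) (hs j)
  have hbound : ∀ m, ‖z m - y‖ ≤ (1 / 2) ^ m * ‖y‖ := by
    intro m
    induction m with
    | zero => rw [hz0, zero_sub, norm_neg, pow_zero, one_mul]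
    | succ m ih =>
      have hle : ‖z m - y‖ ≤ ‖y‖ :=
        ih.trans (mul_le_of_le_one_left (norm_nonneg _) (pow_le_one₀ (by norm_num) (by norm_num)))
      have hpow : ‖z m - y‖ ^ Fintype.card Fq ≤ ‖y‖ * ‖z m - y‖ := by
        refine (pow_le_pow_of_le_one (norm_nonneg _) (hle.trans hy1)
          (Fintype.one_lt_card (α := Fq))).trans ?_
        rw [Nat.succ_eq_add_one, one_add_one_eq_two, sq]
        exact mul_le_mul_of_nonneg_right hle (norm_nonneg _)
      -- Frobenius is additive, so the error evolves by `e ↦ e^(q) A`. As `‖e‖ ≤ ‖y‖ ≤ 1` and `q ≥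
      -- 2`, each step gains the factor `C ‖y‖ ≤ 1/2`.
      have hstep : ‖z (m + 1) - y‖ ≤ 1 / 2 * ‖z m - y‖ := by
        refine (pi_norm_le_iff_of_nonneg (by positivity)).2 fun j => ?_
        have e : (z (m + 1) - y) j = ∑ k, (z m - y) k ^ Fintype.card Fq * A k j := by
          rw [Pi.sub_apply, hzs, hy j, add_sub_add_right_eq_sub, ← sum_sub_distrib]
          exact sum_congr rfl fun k _ => by rw [Pi.sub_apply, sub_pow_card, sub_mul]
        rw [e]
        refine IsUltrametricDist.norm_sum_le_of_forall_le_of_nonneg (by positivity) fun k _ => ?_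
        rw [norm_mul, norm_pow]
        calc _ ≤ ‖z m - y‖ ^ Fintype.card Fq * C := by
              gcongr
              · exact norm_le_pi_norm (z m - y) k
              · exact hC k j
          _ ≤ ‖y‖ * ‖z m - y‖ * C := by gcongr
          _ = C * ‖y‖ * ‖z m - y‖ := by ring
          _ ≤ _ := by gcongr
      refine hstep.trans ?_
      rw [pow_succ', mul_assoc]
      gcongr
  have hlim : Tendsto z atTop (𝓝 y) := by
    rw [tendsto_iff_norm_sub_tendsto_zero]
    refine squeeze_zero (fun m => norm_nonneg _) hbound ?_
    simpa using (tendsto_pow_atTop_nhds_zero_of_lt_one (r := (1 / 2 : ℝ)) (by norm_num)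
      (by norm_num)).mul_const ‖y‖
  exact hL.mem_of_tendsto ((tendsto_pi_nhds.1 hlim) j) (Eventually.of_forall fun m => hzL m j)

end Algebraic

/-! ### Finite extensions of `K_∞` are closed -/

section Closed

variable {Fq : Type*} [Field Fq] [Fintype Fq] {K : Type*} [Field K] [Algebra K (CInfty Fq)]

theorem isClosed_KInfty : IsClosed (KInfty (Fq := Fq) K : Set (CInfty Fq)) :=
  Subfield.isClosed_topologicalClosure _

theorem algebraMap_mem_KInfty (a : K) : algebraMap K (CInfty Fq) a ∈ KInfty (Fq := Fq) K :=
  Subfield.le_topologicalClosure _ ⟨a, rfl⟩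

theorem algebraMap_mem_intermediateField (L : IntermediateField (KInfty (Fq := Fq) K) (CInfty Fq))
    (a : K) : algebraMap K (CInfty Fq) a ∈ L :=
  L.algebraMap_mem ⟨_, algebraMap_mem_KInfty a⟩

variable [Algebra (RatFunc Fq) K] [IsScalarTower (RatFunc Fq) K (CInfty Fq)]

/-- Finite extensions of `K_∞` are closed in `ℂ_∞`. -/
theorem isClosed_of_finiteDimensional
    (L : IntermediateField (KInfty (Fq := Fq) K) (CInfty Fq))
    [FiniteDimensional (KInfty (Fq := Fq) K) L] : IsClosed (L : Set (CInfty Fq)) := by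
  -- The field `K_∞` contains `θ`, of norm greater than one, and is complete as a closed subset of
  -- `ℂ_∞`; finite-dimensional subspaces over such a field are closed.
  let : NontriviallyNormedField (KInfty (Fq := Fq) K) :=
    { (inferInstance : NormedField (KInfty (Fq := Fq) K)) with
      non_trivial := ⟨⟨_, algebraMap_mem_KInfty (TModule.thetaK Fq K)⟩, by
        change 1 < ‖algebraMap K (CInfty Fq) (TModule.thetaK Fq K)‖
        rw [← IsScalarTower.algebraMap_apply (RatFunc Fq) K (CInfty Fq)]
        exact one_lt_norm_theta⟩ }
  have : CompleteSpace (KInfty (Fq := Fq) K) := isClosed_KInfty.completeSpace_coe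
  have : ContinuousSMul (KInfty (Fq := Fq) K) (CInfty Fq) :=
    ⟨(continuous_subtype_val.comp continuous_fst).mul continuous_snd⟩
  have : FiniteDimensional (KInfty (Fq := Fq) K) L.toSubalgebra.toSubmodule :=
    inferInstanceAs (FiniteDimensional (KInfty (Fq := Fq) K) L)
  exact Submodule.closed_of_finiteDimensional L.toSubalgebra.toSubmodule

end Closed

/-! ### The field generated by the coefficients -/

section CoefficientField

variable {Fq : Type*} [Field Fq] [Fintype Fq] {K : Type*} [Field K] [Algebra K (CInfty Fq)]
  {r : ℕ} {Y : Matrix (Fin r) (Fin r) (CInfty Fq)⟦X⟧} {Θ : Matrix (Fin r) (Fin r) K[X]}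

/-- The contribution of the lower coefficients to the `n`-th coefficient of `τ(Y) Θ`. -/
def lowerPart (Y : Matrix (Fin r) (Fin r) (CInfty Fq)⟦X⟧) (Θ : Matrix (Fin r) (Fin r) K[X])
    (n : ℕ) (i j : Fin r) : CInfty Fq :=
  ∑ p ∈ (antidiagonal n).erase (n, 0), ∑ k, PowerSeries.coeff p.1 (Y i k) ^ Fintype.card Fq *
    algebraMap K (CInfty Fq) ((Θ k j).coeff p.2)

theorem coeff_eq_sum_add_lowerPart (hY : Y.map (twist Fq) * Θ.map (polyToSeries K) = Y)
    (n : ℕ) (i j : Fin r) :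
    PowerSeries.coeff n (Y i j) = ∑ k, PowerSeries.coeff n (Y i k) ^ Fintype.card Fq *
      algebraMap K (CInfty Fq) ((Θ k j).coeff 0) + lowerPart Y Θ n i j := by
  have hmem : (n, 0) ∈ antidiagonal n := HasAntidiagonal.mem_antidiagonal.2 (add_zero n)
  rw [lowerPart, coeff_of_twist_mul_eq hY, ← add_sum_erase _ _ hmem]

theorem lowerPart_mem {L : IntermediateField (KInfty (Fq := Fq) K) (CInfty Fq)} {n : ℕ}
    {i : Fin r} (h : ∀ m < n, ∀ k, PowerSeries.coeff m (Y i k) ∈ L) (j : Fin r) :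
    lowerPart Y Θ n i j ∈ L := by
  refine sum_mem fun p hp => sum_mem fun k _ =>
    mul_mem (pow_mem (h p.1 ?_ k) _) (algebraMap_mem_intermediateField L _)
  obtain ⟨h1, h2⟩ := mem_erase.1 hp
  have h3 := HasAntidiagonal.mem_antidiagonal.1 h2
  rcases Nat.eq_zero_or_pos p.2 with h0 | h0
  · exact absurd (Prod.ext (by omega) h0) h1
  · omega

/-- By induction, a row `y` of `n`-th coefficients solves `y = y^(q) A + s` with `A = Θ(0)`
invertible and `s` algebraic. Solving for `y^(q)` puts it in the span of `1` and the entries of `y`,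
so these are algebraic over the algebraic closure of `K_∞` and hence lie in it. -/
theorem coeff_mem_algebraicClosure (hY : Y.map (twist Fq) * Θ.map (polyToSeries K) = Y)
    (hdet : (Θ.map fun p => p.coeff 0).det ≠ 0) (n : ℕ) :
    ∀ i j, PowerSeries.coeff n (Y i j) ∈ algebraicClosure (KInfty (Fq := Fq) K) (CInfty Fq) := by
  induction n using Nat.strong_induction_on with
  | _ n ih =>
    intro i j
    set L := algebraicClosure (KInfty (Fq := Fq) K) (CInfty Fq) with hL
    set A : Matrix (Fin r) (Fin r) K := Θ.map fun p => p.coeff 0 with hA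
    set y : Fin r → CInfty Fq := fun k => PowerSeries.coeff n (Y i k) with hy
    have hs : ∀ k, lowerPart Y Θ n i k ∈ L := lowerPart_mem fun m hm k => ih m hm i k
    have hAA : A.map (algebraMap K (CInfty Fq)) * A⁻¹.map (algebraMap K (CInfty Fq)) = 1 := by
      rw [← Matrix.map_mul, Matrix.mul_nonsing_inv _ (isUnit_iff_ne_zero.2 hdet),
        Matrix.map_one _ (map_zero _) (map_one _)]
    have h1 : Matrix.vecMul (fun k => y k ^ Fintype.card Fq) (A.map (algebraMap K (CInfty Fq))) =
        fun k => y k - lowerPart Y Θ n i k := by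
      funext k
      rw [eq_sub_iff_add_eq]
      exact (coeff_eq_sum_add_lowerPart hY n i k).symm
    have h2 : ∀ k, y k ^ Fintype.card Fq = ∑ l, (y l - lowerPart Y Θ n i l) *
        algebraMap K (CInfty Fq) (A⁻¹ l k) := by
      intro k
      have h3 := congrArg (fun v => Matrix.vecMul v (A⁻¹.map (algebraMap K (CInfty Fq))) k) h1
      simp only [Matrix.vecMul_vecMul, hAA, Matrix.vecMul_one] at h3
      exact h3
    have halg : IsAlgebraic L (y j) := by
      refine isAlgebraic_of_pow_card_mem_span y (fun k => ?_) j
      rw [h2]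
      refine Submodule.sum_mem _ fun l _ => ?_
      have hmem : y l - lowerPart Y Θ n i l ∈ Submodule.span L (insert 1 (Set.range y)) := by
        refine Submodule.sub_mem _ (Submodule.subset_span (Or.inr ⟨l, rfl⟩)) ?_
        have h4 := Submodule.smul_mem (Submodule.span L (insert 1 (Set.range y)))
          (⟨_, hs l⟩ : L) (Submodule.subset_span (Or.inl rfl))
        rw [IntermediateField.smul_def, smul_eq_mul, mul_one] at h4
        exact h4
      have h5 := Submodule.smul_mem _
        (⟨_, algebraMap_mem_intermediateField L (A⁻¹ l k)⟩ : L) hmem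
      rw [IntermediateField.smul_def, smul_eq_mul, mul_comm] at h5
      exact h5
    by_contra hnot
    exact Transcendental.algebraicClosure (fun h => hnot (mem_algebraicClosure_iff.2 h)) halg

/-- The power series that converge everywhere and have coefficients in `L`. -/
def entireRing (L : Subfield (CInfty Fq)) : Subring (CInfty Fq)⟦X⟧ where
  carrier := {f | (∀ c : ℝ, 1 ≤ c → f ∈ PowerSeries.IsRestricted.subring (R := CInfty Fq) c) ∧
    ∀ n, PowerSeries.coeff n f ∈ L}
  zero_mem' := ⟨fun c _ => Subring.zero_mem _, fun n => by rw [map_zero]; exact L.zero_mem⟩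
  one_mem' := ⟨fun c _ => Subring.one_mem _, fun n => by
    rw [PowerSeries.coeff_one]
    split_ifs
    exacts [L.one_mem, L.zero_mem]⟩
  add_mem' hf hg := ⟨fun c hc => Subring.add_mem _ (hf.1 c hc) (hg.1 c hc), fun n => by
    rw [map_add]; exact L.add_mem (hf.2 n) (hg.2 n)⟩
  neg_mem' hf := ⟨fun c hc => Subring.neg_mem _ (hf.1 c hc), fun n => by
    rw [map_neg]; exact L.neg_mem (hf.2 n)⟩
  mul_mem' hf hg := ⟨fun c hc => Subring.mul_mem _ (hf.1 c hc) (hg.1 c hc), fun n => by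
    rw [PowerSeries.coeff_mul]
    exact L.sum_mem fun p _ => L.mul_mem (hf.2 _) (hg.2 _)⟩

theorem hyperDeriv_mem_entireRing {L : Subfield (CInfty Fq)} {f : (CInfty Fq)⟦X⟧}
    (hf : f ∈ entireRing L) (n : ℕ) : hyperDeriv n f ∈ entireRing L := by
  refine ⟨fun c hc => hyperDeriv_mem_restricted (one_pos.trans_le hc) n (hf.1 c hc), fun i => ?_⟩
  rw [coeff_hyperDeriv]
  exact L.mul_mem (natCast_mem L _) (hf.2 _)

theorem twist_mem_entireRing {L : Subfield (CInfty Fq)} {f : (CInfty Fq)⟦X⟧}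
    (hf : f ∈ entireRing L) : twist Fq f ∈ entireRing L := by
  refine ⟨fun c hc => ?_, fun i => by rw [coeff_twist]; exact L.pow_mem (hf.2 i) _⟩
  have h1 := mem_restricted_iff.1 (hf.1 1 le_rfl)
  have h2 := mem_restricted_iff.1 (hf.1 c hc)
  simp only [one_pow, mul_one] at h1
  rw [mem_restricted_iff]
  refine squeeze_zero' (Eventually.of_forall fun n => by positivity) ?_ h2
  filter_upwards [h1.eventually_le_const one_pos] with n hn
  rw [coeff_twist, norm_pow]
  gcongr
  -- Almost all coefficients have norm at most one, and taking `q`-th powers does not increase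
  -- these.
  exact pow_le_of_le_one (norm_nonneg _) hn Fintype.card_ne_zero

theorem polyToSeries_mem_entireRing (L : IntermediateField (KInfty (Fq := Fq) K) (CInfty Fq))
    (p : K[X]) : polyToSeries K p ∈ entireRing L.toSubfield := by
  refine ⟨fun c _ => ?_, fun n => ?_⟩
  · rw [polyToSeries_apply]
    exact coe_mem_restricted c _
  · rw [coeff_polyToSeries]
    exact algebraMap_mem_intermediateField L _

theorem isEntire_of_mem_entireRing {L : IntermediateField (KInfty (Fq := Fq) K) (CInfty Fq)}
    [hL : FiniteDimensional (KInfty (Fq := Fq) K) L] {f : (CInfty Fq)⟦X⟧}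
    (hf : f ∈ entireRing L.toSubfield) : IsEntire K f := by
  refine ⟨fun z => ?_, L, hL, hf.2⟩
  refine NonarchimedeanAddGroup.summable_of_tendsto_cofinite_zero ?_
  rw [Nat.cofinite_eq_atTop, tendsto_zero_iff_norm_tendsto_zero]
  have h1 := mem_restricted_iff.1 (hf.1 (max ‖z‖ 1) (le_max_right _ _))
  refine squeeze_zero (fun n => norm_nonneg _) (fun n => ?_) h1
  rw [norm_mul, norm_pow]
  gcongr
  exact le_max_left _ _

variable [Algebra (RatFunc Fq) K] [IsScalarTower (RatFunc Fq) K (CInfty Fq)]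

/-- The coefficients of a solution of `τ(Y) Θ = Y` over the Tate algebra lie in a finite extension
of `K_∞`. -/
theorem exists_finiteDimensional_coeff_mem (hYT : ∀ i j, Y i j ∈ tateAlgebra Fq)
    (hY : Y.map (twist Fq) * Θ.map (polyToSeries K) = Y)
    (hdet : (Θ.map fun p => p.coeff 0).det ≠ 0) :
    ∃ L : IntermediateField (KInfty (Fq := Fq) K) (CInfty Fq),
      FiniteDimensional (KInfty (Fq := Fq) K) L ∧ ∀ n i j, PowerSeries.coeff n (Y i j) ∈ L := by
  obtain ⟨N, C, hC0, -, hC⟩ := exists_coeff_bound (Fq := Fq) Θ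
  have ht := tendsto_zero_iff_norm_tendsto_zero.1 (tendsto_coeffFun hYT)
  have htC : Tendsto (fun n => C * ‖coeffFun Y n‖) atTop (𝓝 0) := by simpa using ht.const_mul C
  -- From `n₀` on the coefficients meet the smallness conditions of `mem_of_eq_sum_pow_card_add`.
  -- Adjoining the finitely many algebraic coefficients before `n₀` therefore suffices: every later
  -- row is a small solution over this closed field.
  obtain ⟨n₀, hn₀⟩ := eventually_atTop.1 ((ht.eventually_le_const one_pos).and
    (htC.eventually_le_const (half_pos one_pos)))
  set S : Set (CInfty Fq) := Set.range fun p : Fin n₀ × Fin r × Fin r =>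
    PowerSeries.coeff (p.1 : ℕ) (Y p.2.1 p.2.2) with hS
  have hfin : FiniteDimensional (KInfty (Fq := Fq) K)
      (IntermediateField.adjoin (KInfty (Fq := Fq) K) S) := by
    refine IntermediateField.finiteDimensional_adjoin ?_
    rintro _ ⟨p, rfl⟩
    exact mem_algebraicClosure_iff'.1 (coeff_mem_algebraicClosure hY hdet _ _ _)
  refine ⟨IntermediateField.adjoin (KInfty (Fq := Fq) K) S, hfin, fun n => ?_⟩
  have hclosed := isClosed_of_finiteDimensional (IntermediateField.adjoin (KInfty (Fq := Fq) K) S)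
  induction n using Nat.strong_induction_on with
  | _ n ih =>
    intro i j
    rcases lt_or_ge n n₀ with hn | hn
    · exact IntermediateField.subset_adjoin _ _ ⟨(⟨n, hn⟩, i, j), rfl⟩
    · obtain ⟨h1, h2⟩ := hn₀ n hn
      have hle : ‖coeffFun Y n i‖ ≤ ‖coeffFun Y n‖ := norm_le_pi_norm (coeffFun Y n) i
      exact mem_of_eq_sum_pow_card_add
        (L := (IntermediateField.adjoin (KInfty (Fq := Fq) K) S).toSubfield) hclosed
        (y := coeffFun Y n i) (coeff_eq_sum_add_lowerPart hY n i)
        (lowerPart_mem fun m hm k => ih m hm i k)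
        (fun k j => algebraMap_mem_intermediateField _ _) hC0 (fun k j => hC k j 0)
        (hle.trans h1) ((mul_le_mul_of_nonneg_left hle hC0).trans h2) j

theorem exists_mem_entireRing (hYT : ∀ i j, Y i j ∈ tateAlgebra Fq)
    (hY : Y.map (twist Fq) * Θ.map (polyToSeries K) = Y)
    (hdet : (Θ.map fun p => p.coeff 0).det ≠ 0) :
    ∃ L : IntermediateField (KInfty (Fq := Fq) K) (CInfty Fq),
      FiniteDimensional (KInfty (Fq := Fq) K) L ∧ ∀ i j, Y i j ∈ entireRing L.toSubfield := by
  obtain ⟨L, hL, h⟩ := exists_finiteDimensional_coeff_mem hYT hY hdet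
  exact ⟨L, hL, fun i j => ⟨fun c hc => mem_restricted_of_twist_mul_eq hYT hY (by linarith) i j,
    fun n => h n i j⟩⟩

end CoefficientField

/-! ### The conditions of Anderson, Brownawell and Papanikolas -/

section ABP

variable {Fq : Type*} [Field Fq] [Fintype Fq] {ι : Type*} [Fintype ι] [DecidableEq ι]

theorem exists_eq_tateMatrix {Ψ Ψ' : Matrix ι ι (CInfty Fq)⟦X⟧} (h : ∀ i j, Ψ i j ∈ tateAlgebra Fq)
    (h' : ∀ i j, Ψ' i j ∈ tateAlgebra Fq) (hmul : Ψ * Ψ' = 1) :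
    ∃ g : GL ι (tateAlgebra Fq), Ψ = g.1.map (tateAlgebra Fq).subtype := by
  set G : Matrix ι ι (tateAlgebra Fq) := Matrix.of fun i j => ⟨Ψ i j, h i j⟩ with hG
  set G' : Matrix ι ι (tateAlgebra Fq) := Matrix.of fun i j => ⟨Ψ' i j, h' i j⟩ with hG'
  have hGm : G.map (tateAlgebra Fq).subtype = Ψ := rfl
  have hGm' : G'.map (tateAlgebra Fq).subtype = Ψ' := rfl
  have h1 : G * G' = 1 := by
    refine Matrix.map_injective (f := (tateAlgebra Fq).subtype) Subtype.val_injective ?_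
    change (G * G').map (tateAlgebra Fq).subtype =
      (1 : Matrix ι ι (tateAlgebra Fq)).map (tateAlgebra Fq).subtype
    rw [Matrix.map_mul, hGm, hGm', hmul, Matrix.map_one _ (map_zero _) (map_one _)]
  exact ⟨⟨G, G', h1, mul_eq_one_comm.1 h1⟩, rfl⟩

theorem prolongation_inv (l : ℕ) {Ψ : Matrix ι ι (CInfty Fq)⟦X⟧} (h : IsUnit Ψ.det) :
    prolongation l Ψ⁻¹ = (prolongation l Ψ)⁻¹ := by
  refine (Matrix.inv_eq_right_inv ?_).symm
  rw [← prolongation_mul, Matrix.mul_nonsing_inv _ h, prolongation_one]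

variable {K : Type*} [Field K] [Algebra K (CInfty Fq)]

/-- Convergence at the powers of `θ`, whose norms are unbounded, gives the decay of the coefficients
for every radius. -/
theorem IsEntire.exists_mem_entireRing {f : (CInfty Fq)⟦X⟧} (hf : IsEntire K f) :
    ∃ L : IntermediateField (KInfty (Fq := Fq) K) (CInfty Fq),
      FiniteDimensional (KInfty (Fq := Fq) K) L ∧ f ∈ entireRing L.toSubfield := by
  obtain ⟨hs, L, hL, h⟩ := hf
  refine ⟨L, hL, fun c hc => ?_, h⟩
  obtain ⟨k, hk⟩ := pow_unbounded_of_one_lt c (one_lt_norm_theta (Fq := Fq))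
  have h1 := (hs (CInfty.theta Fq ^ k)).tendsto_atTop_zero
  rw [tendsto_zero_iff_norm_tendsto_zero] at h1
  rw [mem_restricted_iff]
  refine squeeze_zero (fun n => by positivity) (fun n => ?_) h1
  rw [norm_mul, norm_pow, norm_pow]
  gcongr

theorem IsEntire.hyperDeriv {f : (CInfty Fq)⟦X⟧} (hf : IsEntire K f) (n : ℕ) :
    IsEntire K (hyperDeriv n f) := by
  obtain ⟨L, hL, h⟩ := hf.exists_mem_entireRing
  exact isEntire_of_mem_entireRing (hyperDeriv_mem_entireRing h n)

theorem isEntire_zero : IsEntire K (0 : (CInfty Fq)⟦X⟧) := by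
  have h : (0 : (CInfty Fq)⟦X⟧) ∈ entireRing
      (⊥ : IntermediateField (KInfty (Fq := Fq) K) (CInfty Fq)).toSubfield := Subring.zero_mem _
  exact isEntire_of_mem_entireRing h

/-- Prolongation is multiplicative, commutes with `σ`, preserves polynomials, the Tate algebra and
entire series, and raises the determinant to the power `l + 1`. -/
theorem ABPConditions.prolongation {Φ Ψ : Matrix ι ι (CInfty Fq)⟦X⟧} (h : ABPConditions K Φ Ψ)
    (l : ℕ) : ABPConditions K (prolongation l Φ) (prolongation l Ψ) where
  poly := by
    obtain ⟨P, hP⟩ := h.poly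
    refine ⟨Matrix.of fun x y => if x.1 ≤ y.1 then
      Polynomial.hasseDeriv ((y.1 : ℕ) - (x.1 : ℕ)) (P x.2 y.2) else 0, ?_⟩
    ext1 x y
    rw [prolongation_apply, Matrix.map_apply, Matrix.of_apply, hP, Matrix.map_apply,
      hyperDeriv_polyToSeries]
    split_ifs
    · rfl
    · rw [map_zero]
  det := by
    obtain ⟨c, hc, s, hs, hdet⟩ := h.det
    refine ⟨c ^ (l + 1), pow_ne_zero _ hc, s * (l + 1), by nlinarith, ?_⟩
    rw [det_prolongation, hdet, mul_pow, ← map_pow, pow_mul]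
    rfl
  tate := by
    obtain ⟨g, hg⟩ := h.tate
    have hmem : ∀ M : Matrix ι ι (tateAlgebra Fq), ∀ x y,
        TPeriods.prolongation l (M.map (tateAlgebra Fq).subtype) x y ∈ tateAlgebra Fq := by
      intro M x y
      rw [prolongation_apply]
      split_ifs
      · exact hyperDeriv_mem_tateAlgebra _ (M x.2 y.2).2
      · exact Subring.zero_mem _
    rw [hg]
    refine exists_eq_tateMatrix (hmem _) (hmem (g⁻¹).1) ?_
    rw [← prolongation_mul, ← Matrix.map_mul, Units.mul_inv,
      Matrix.map_one _ (map_zero _) (map_one _), prolongation_one]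
  entire x y := by
    rw [prolongation_apply]
    split_ifs
    · exact (h.entire _ _).hyperDeriv _
    · exact isEntire_zero
  eqn := by rw [prolongation_map_invTwist, h.eqn, prolongation_mul]

end ABP

/-! ### The conditions for `Θ̃` and `R` -/

section Trivial

variable {Fq : Type*} [Field Fq] [Fintype Fq] {K : Type*} [Field K] [Algebra K (CInfty Fq)]
  {r : ℕ}

theorem map_inv_eq {R : Type*} [CommRing R] (f : K[X] →+* R) (B : GL (Fin r) K[X]) :
    (B.1.map f)⁻¹ = (B⁻¹).1.map f := by
  refine Matrix.inv_eq_right_inv ?_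
  rw [← Matrix.map_mul, Units.mul_inv, Matrix.map_one _ (map_zero _) (map_one _)]

theorem exists_det_eq_C (B : GL (Fin r) K[X]) : ∃ b : K, b ≠ 0 ∧ B.1.det = Polynomial.C b := by
  obtain ⟨b, hb, h⟩ := Polynomial.isUnit_iff.1 ((Matrix.isUnit_iff_isUnit_det _).1 B.isUnit)
  exact ⟨b, hb.ne_zero, h.symm⟩

theorem algebraMap_mem_algebraicClosure (a : K) :
    algebraMap K (CInfty Fq) a ∈ algebraicClosure K (CInfty Fq) :=
  (algebraicClosure K (CInfty Fq)).algebraMap_mem a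

theorem frob_symm_mem_algebraicClosure (a : K) :
    (CInfty.frob Fq).symm (algebraMap K (CInfty Fq) a) ∈ algebraicClosure K (CInfty Fq) := by
  refine mem_algebraicClosure_iff.2 (IsAlgebraic.of_pow (Fintype.card_pos (α := Fq)) ?_)
  rw [← CInfty.frob_apply, RingEquiv.apply_symm_apply]
  exact isAlgebraic_algebraMap a

theorem polyToSeries_mem_range (p : K[X]) : polyToSeries (Fq := Fq) K p ∈
    (polyToSeries (Fq := Fq) (algebraicClosure K (CInfty Fq))).range := by
  refine ⟨p.map (algebraMap K (algebraicClosure K (CInfty Fq))), ?_⟩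
  ext n
  rw [coeff_polyToSeries, coeff_polyToSeries, Polynomial.coeff_map]
  rfl

/-- The inverse twist takes `q`-th roots of coefficients, which may leave `K` but stay in its
algebraic closure. -/
theorem invTwist_polyToSeries_mem_range (p : K[X]) : invTwist Fq (polyToSeries K p) ∈
    (polyToSeries (Fq := Fq) (algebraicClosure K (CInfty Fq))).range := by
  refine ⟨∑ n ∈ range (p.natDegree + 1),
    Polynomial.monomial n ⟨_, frob_symm_mem_algebraicClosure (p.coeff n)⟩, ?_⟩
  ext n
  rw [coeff_polyToSeries, coeff_invTwist, coeff_polyToSeries, Polynomial.finsetSum_coeff]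
  simp only [Polynomial.coeff_monomial, sum_ite_eq', mem_range]
  split_ifs with h
  · rfl
  · rw [Polynomial.coeff_eq_zero_of_natDegree_lt (by omega), map_zero, map_zero, map_zero]

theorem polyToSeries_linTheta [Algebra (RatFunc Fq) K] [IsScalarTower (RatFunc Fq) K (CInfty Fq)] :
    polyToSeries (Fq := Fq) K (TModule.linTheta Fq K) = tSubTheta Fq := by
  rw [map_sub, polyToSeries_X, polyToSeries_C, tSubTheta,
    ← IsScalarTower.algebraMap_apply (RatFunc Fq) K (CInfty Fq)]
  rfl

variable {Θ : Matrix (Fin r) (Fin r) K[X]} {Υ : GL (Fin r) (tateAlgebra Fq)}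

theorem twistedTheta_eq (B : GL (Fin r) K[X]) : twistedTheta (Fq := Fq) Θ B =
    B.1.map (polyToSeries K) * Θ.map (polyToSeries K) *
      ((B⁻¹).1.map (polyToSeries K)).map (invTwist Fq) := by
  rw [twistedTheta]
  congr 1
  exact map_inv_eq ((invTwist Fq).comp (polyToSeries K)) B

theorem matrixR_eq (B : GL (Fin r) K[X]) : matrixR Υ B =
    (tateMatrix Υ).map (twist Fq) * (B⁻¹).1.map (polyToSeries K) := by
  rw [matrixR, map_inv_eq (polyToSeries (Fq := Fq) K) B]

theorem matrixR_mul (B : GL (Fin r) K[X]) : matrixR Υ B *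
    (B.1.map (polyToSeries K) * (tateMatrix Υ⁻¹).map (twist Fq)) = 1 := by
  rw [matrixR_eq, mul_assoc, ← mul_assoc ((B⁻¹).1.map (polyToSeries (Fq := Fq) K)),
    ← Matrix.map_mul (f := polyToSeries (Fq := Fq) K), Units.inv_mul,
    Matrix.map_one _ (map_zero _) (map_one _), one_mul, ← Matrix.map_mul, tateMatrix_mul_inv,
    Matrix.map_one _ (map_zero _) (map_one _)]

theorem matrixR_inv (B : GL (Fin r) K[X]) : (matrixR Υ B)⁻¹ =
    B.1.map (polyToSeries K) * (tateMatrix Υ⁻¹).map (twist Fq) :=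
  Matrix.inv_eq_right_inv (matrixR_mul B)

theorem isUnit_det_matrixR (B : GL (Fin r) K[X]) : IsUnit (matrixR Υ B).det :=
  Matrix.isUnit_det_of_right_inverse (matrixR_mul B)

/-- At `t = 0` the factor `t - θ` becomes `-θ ≠ 0`. Invertibility of `Θ(0)` is what makes the
coefficients of the trivialization algebraic. -/
theorem det_coeff_zero_ne [Algebra (RatFunc Fq) K] {c : K} (hc : c ≠ 0) {s : ℕ}
    (hdet : Θ.det = Polynomial.C c * TModule.linTheta Fq K ^ s) :
    (Θ.map fun p => p.coeff 0).det ≠ 0 := by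
  have h1 : (Θ.map fun p => p.coeff 0).det = Polynomial.constantCoeff Θ.det := by
    rw [RingHom.map_det]
    rfl
  have hθ : TModule.thetaK Fq K ≠ 0 := by
    rw [Ne, _root_.map_eq_zero]
    exact RatFunc.X_ne_zero
  rw [h1, hdet, map_mul, map_pow, map_sub]
  simp [hc, hθ]

variable [Algebra (RatFunc Fq) K] [IsScalarTower (RatFunc Fq) K (CInfty Fq)]

/-- The determinants of `B` and `B⁻¹` are nonzero constants, so only the constant in front of the
power of `t - θ` changes. -/
theorem det_twistedTheta {c : K} (hc : c ≠ 0) {s : ℕ}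
    (hdet : Θ.det = Polynomial.C c * TModule.linTheta Fq K ^ s) (B : GL (Fin r) K[X]) :
    ∃ a : algebraicClosure K (CInfty Fq), a ≠ 0 ∧ (twistedTheta (Fq := Fq) Θ B).det =
      PowerSeries.C (a : CInfty Fq) * tSubTheta Fq ^ s := by
  obtain ⟨b, hb, hB⟩ := exists_det_eq_C B
  obtain ⟨b', hb', hB'⟩ := exists_det_eq_C B⁻¹
  refine ⟨⟨_, algebraMap_mem_algebraicClosure (b * c)⟩ *
    ⟨_, frob_symm_mem_algebraicClosure b'⟩, mul_ne_zero ?_ ?_, ?_⟩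
  · intro h
    exact mul_ne_zero hb hc ((_root_.map_eq_zero _).1 (congrArg Subtype.val h))
  · intro h
    exact hb' ((_root_.map_eq_zero _).1 ((_root_.map_eq_zero _).1 (congrArg Subtype.val h)))
  · have h1 : ∀ (f : K[X] →+* (CInfty Fq)⟦X⟧) (M : Matrix (Fin r) (Fin r) K[X]),
        (M.map f).det = f M.det := fun f M => (RingHom.map_det f M).symm
    have h2 : (((B⁻¹).1.map (polyToSeries K)).map (invTwist Fq)).det =
        invTwist Fq (polyToSeries K (B⁻¹).1.det) :=
      h1 ((invTwist Fq).comp (polyToSeries K)) _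
    have h3 : ∀ x, invTwist Fq (PowerSeries.C x) = PowerSeries.C ((CInfty.frob Fq).symm x) :=
      fun x => PowerSeries.map_C _ _
    rw [twistedTheta_eq, Matrix.det_mul, Matrix.det_mul, h1, h1, h2, hdet, hB, hB', map_mul,
      map_pow, polyToSeries_linTheta, polyToSeries_C, polyToSeries_C, polyToSeries_C, h3]
    change _ = PowerSeries.C (algebraMap K (CInfty Fq) (b * c) *
      (CInfty.frob Fq).symm (algebraMap K (CInfty Fq) b')) * _
    rw [map_mul, map_mul, map_mul]
    ring

theorem abpConditions_matrixR (hΥ : IsRigidAnalyticTrivialization Θ Υ) {c : K} (hc : c ≠ 0) {s : ℕ}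
    (hs : 1 ≤ s) (hdet : Θ.det = Polynomial.C c * TModule.linTheta Fq K ^ s)
    (B : GL (Fin r) K[X]) :
    ABPConditions K (twistedTheta (Fq := Fq) Θ B) (matrixR Υ B) where
  poly := by
    have hmem : ∀ i j, twistedTheta (Fq := Fq) Θ B i j ∈
        (polyToSeries (Fq := Fq) (algebraicClosure K (CInfty Fq))).range := by
      intro i j
      rw [twistedTheta_eq, Matrix.mul_apply]
      refine Subring.sum_mem _ fun k _ =>
        Subring.mul_mem _ ?_ (invTwist_polyToSeries_mem_range _)
      rw [Matrix.mul_apply]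
      exact Subring.sum_mem _ fun l _ =>
        Subring.mul_mem _ (polyToSeries_mem_range _) (polyToSeries_mem_range _)
    choose P hP using hmem
    exact ⟨Matrix.of P, Matrix.ext fun i j => (hP i j).symm⟩
  det := by
    obtain ⟨a, ha, h⟩ := det_twistedTheta hc hdet B
    exact ⟨a, ha, s, hs, h⟩
  tate := by
    refine exists_eq_tateMatrix (fun i j => ?_) (fun i j => ?_) (matrixR_mul B)
    · rw [matrixR_eq, Matrix.mul_apply]
      exact Subring.sum_mem _ fun k _ => Subring.mul_mem _
        (twist_mem_tateAlgebra (tateMatrix_mem _ _ _)) (polyToSeries_mem_tateAlgebra _)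
    · rw [Matrix.mul_apply]
      exact Subring.sum_mem _ fun k _ => Subring.mul_mem _
        (polyToSeries_mem_tateAlgebra _) (twist_mem_tateAlgebra (tateMatrix_mem _ _ _))
  entire i j := by
    obtain ⟨L, hL, h⟩ := exists_mem_entireRing (tateMatrix_mem Υ) hΥ (det_coeff_zero_ne hc hdet)
    refine isEntire_of_mem_entireRing (L := L) ?_
    rw [matrixR_eq, Matrix.mul_apply]
    exact Subring.sum_mem _ fun k _ => Subring.mul_mem _
      (twist_mem_entireRing (h _ _)) (polyToSeries_mem_entireRing L _)
  eqn := by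
    have h1 : ∀ M : Matrix (Fin r) (Fin r) (CInfty Fq)⟦X⟧,
        (M.map (twist Fq)).map (invTwist Fq) = M := fun M => by
      ext1 i j
      exact invTwist_twist _
    have h2 : (B⁻¹).1.map (polyToSeries (Fq := Fq) K) * B.1.map (polyToSeries K) = 1 := by
      rw [← Matrix.map_mul, Units.inv_mul, Matrix.map_one _ (map_zero _) (map_one _)]
    rw [matrixR_eq, twistedTheta_eq, Matrix.map_mul, h1, ← mul_assoc, ← mul_assoc,
      mul_assoc ((tateMatrix Υ).map (twist Fq)), h2, mul_one]
    congr 1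
    exact hΥ.symm

end Trivial

/-! ### Periods as values of hyperderivatives -/

section Coordinates

variable {Fq : Type*} [Field Fq] [Fintype Fq] {K : Type*} [Field K] [Algebra Fq K] {d : ℕ}

variable (Fq K) in
/-- The constants as a subring of the twisted polynomials. -/
def TwistedPoly.constHom : K →+* TwistedPoly Fq K where
  toFun := TwistedPoly.monomial 0
  map_one' := TwistedPoly.monomial_zero_one
  map_zero' := TwistedPoly.ext fun n => by
    rw [TwistedPoly.coeff_monomial, TwistedPoly.coeff_zero, ite_self]
  map_mul' a b := by rw [TwistedPoly.monomial_mul_monomial, pow_zero, pow_one, add_zero]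
  map_add' a b := TwistedPoly.ext fun n => by
    simp only [TwistedPoly.coeff_add, TwistedPoly.coeff_monomial]
    split_ifs
    · rfl
    · rw [add_zero]

theorem TwistedPoly.coeff_zero_constHom (a : K) :
    (TwistedPoly.constHom Fq K a).coeff 0 = a := by
  change (TwistedPoly.monomial 0 a : TwistedPoly Fq K).coeff 0 = a
  rw [TwistedPoly.coeff_monomial, if_pos rfl]

variable [Algebra K (CInfty Fq)]

/-- Every basis of `K^d` gives a coordinate system of `𝔾_a^d`. -/
theorem exists_lieCoord_eq_pairing (b : Module.Basis (Fin d) K (Fin d → K)) :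
    ∃ U : GL (Fin d) (TwistedPoly Fq K), ∀ x i, lieCoord U x i = pairing (b i) x := by
  obtain ⟨u, hu⟩ : IsUnit (Matrix.of b : Matrix (Fin d) (Fin d) K) :=
    Matrix.linearIndependent_rows_iff_isUnit.1 b.linearIndependent
  -- A linear change of coordinates suffices: the matrix with rows `b_i`, seen as constant twisted
  -- polynomials.
  refine ⟨Units.map (TwistedPoly.constHom Fq K).mapMatrix.toMonoidHom u, fun x i => ?_⟩
  rw [lieCoord, pairing_apply, Matrix.mulVec, dotProduct]
  refine sum_congr rfl fun j _ => ?_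
  change algebraMap K (CInfty Fq) (((TwistedPoly.constHom Fq K) (u.1 i j)).coeff 0) * x j = _
  rw [TwistedPoly.coeff_zero_constHom, hu]
  rfl

end Coordinates

namespace TModule

variable {Fq : Type*} [Field Fq] [Fintype Fq] {K : Type*} [Field K] [Algebra Fq K]
  {d : ℕ} [Algebra (RatFunc Fq) K] (E : TModule Fq K d) [Algebra K (CInfty Fq)]
  [IsScalarTower Fq (RatFunc Fq) K] [IsScalarTower (RatFunc Fq) K (CInfty Fq)]
  {r : ℕ} (m : Module.Basis (Fin r) K[X] E.Motive)
  {Θ : Matrix (Fin r) (Fin r) K[X]} {Υ : GL (Fin r) (tateAlgebra Fq)}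

/-- Here `R⁻¹ = B τ(Υ⁻¹)`, and `τ`-equivariance and `K[t]`-linearity of the generating functions
move both factors into the argument. -/
theorem matrixR_inv_apply {lam : Fin r → E.Lie} (hlam : ∀ j, lam j ∈ E.periodModule)
    (hagf : ∀ i j, E.agf (lam j) (m i) = tateMatrix Υ⁻¹ i j) (B : GL (Fin r) K[X])
    (i j : Fin r) :
    (matrixR Υ B)⁻¹ i j = E.agf (lam j) (∑ k, B.1 i k • E.motiveTau (m k)) := by
  rw [matrixR_inv, Matrix.mul_apply, map_sum]
  refine sum_congr rfl fun k _ => ?_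
  rw [E.agf_smul (hlam j), Matrix.map_apply, Matrix.map_apply, ← hagf, agf, genSeries_motiveTau]

/-- The periods are values at `t = θ` of hyperderivatives of the entries of `R⁻¹`. -/
theorem exists_coordinates (hΘ : ∀ i, E.motiveTau (m i) = ∑ j, Θ i j • m j) (hdet : Θ.det ≠ 0)
    {lam : Fin r → E.Lie} (hlam : ∀ j, lam j ∈ E.periodModule)
    (hagf : ∀ i j, E.agf (lam j) (m i) = tateMatrix Υ⁻¹ i j) :
    ∃ (B : GL (Fin r) K[X]) (U : GL (Fin d) (TwistedPoly Fq K)) (a : Fin d → ℕ)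
      (k : Fin d → Fin r), (∀ i, a i < d) ∧
      ∀ i j, HasValueAtTheta (hyperDeriv (a i) ((matrixR Υ B)⁻¹ (k i) j))
        (lieCoord U (E.lieVec (lam j)) i) := by
  obtain ⟨B, μ, n, hB, hlin⟩ := E.exists_elementary_divisors hdet hΘ
  obtain ⟨b, hb⟩ := E.exists_lin_basis hlin
  let e : Fin d ≃ Σ i, Fin (n i) := (Pi.basisFun K (Fin d)).indexEquiv b
  -- Counting the basis of covectors gives `∑ n_i = d`, so the orders of the hyperderivatives stay
  -- below `d`.
  have hn : ∀ i, n i ≤ d := by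
    intro i
    have h1 := Fintype.card_congr e
    rw [Fintype.card_fin, Fintype.card_sigma] at h1
    simp only [Fintype.card_fin] at h1
    rw [h1]
    exact single_le_sum (f := n) (fun _ _ => Nat.zero_le _) (mem_univ i)
  -- The covectors are negated because the values at `θ` are the negatives of the pairings.
  obtain ⟨U, hU⟩ := exists_lieCoord_eq_pairing (Fq := Fq)
    ((b.reindex e.symm).unitsSMul fun _ => -1)
  refine ⟨B, U, fun i => n (e i).1 - 1 - (e i).2, fun i => (e i).1, fun i => ?_, fun i j => ?_⟩
  · have h1 := (e i).2.2
    have h2 := hn (e i).1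
    change n (e i).1 - 1 - ((e i).2 : ℕ) < d
    omega
  · have hzero : Matrix.vecMul (E.lin (μ (e i).1)) (E.nilPart ^ n (e i).1) = 0 := by
      rw [← lin_linTheta_pow_smul, hlin]
      intro k
      rw [map_smul, Finsupp.smul_apply, smul_eq_mul, μ.repr_self]
      rcases eq_or_ne k (e i).1 with rfl | hk
      · exact dvd_mul_right _ _
      · rw [Finsupp.single_eq_of_ne hk, mul_zero]
        exact dvd_zero _
    have h1 := E.hasValueAtTheta_hyperDeriv_agf (lam j) (μ (e i).1) (e i).2.2 hzero
    rw [E.matrixR_inv_apply m hlam hagf, ← hB, E.agf_smul (hlam j), map_pow,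
      polyToSeries_linTheta]
    convert h1 using 1
    rw [hU, Module.Basis.unitsSMul_apply, Module.Basis.reindex_apply, Equiv.symm_symm, hb,
      lin_linTheta_pow_smul, pairing_apply, pairing_apply, ← sum_neg_distrib]
    refine sum_congr rfl fun c _ => ?_
    rw [Units.smul_def, Pi.smul_apply, Units.val_neg, Units.val_one, neg_one_smul, map_neg,
      neg_mul]

end TModule

end TPeriods

end

/-! ### The theorem -/

open TPeriods in
theorem mainTheorem1 {Fq : Type*} [Field Fq] [Fintype Fq]
    {K : Type*} [Field K] [Algebra (RatFunc Fq) K] [FiniteDimensional (RatFunc Fq) K]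
    [Algebra Fq K] [IsScalarTower Fq (RatFunc Fq) K]
    [Algebra K (CInfty Fq)] [IsScalarTower (RatFunc Fq) K (CInfty Fq)]
    {d r : ℕ} (hd : 1 ≤ d) (E : TModule Fq K d) (hab : E.IsAbelian) (hunif : E.IsUniformizable)
    (m : Module.Basis (Fin r) K[X] E.Motive)
    (Θ : Matrix (Fin r) (Fin r) K[X]) (hΘ : ∀ i, E.motiveTau (m i) = ∑ j, Θ i j • m j)
    (Υ : GL (Fin r) (tateAlgebra Fq)) (hΥ : IsRigidAnalyticTrivialization Θ Υ) :
    (∀ B : GL (Fin r) K[X],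
      ABPConditions K (twistedTheta (Fq := Fq) Θ B) (matrixR Υ B) ∧
      ∀ l : ℕ,
        ABPConditions K (prolongation l (twistedTheta (Fq := Fq) Θ B))
          (prolongation l (matrixR Υ B)) ∧
        prolongation l (matrixR Υ B)⁻¹ = (prolongation l (matrixR Υ B))⁻¹) ∧
    ∃ (B : GL (Fin r) K[X]) (U : GL (Fin d) (TwistedPoly Fq K)) (lam : Fin r → E.Lie),
      E.IsPeriodBasis lam ∧
      ∃ (row : Fin d → Fin (d - 1 + 1) × Fin r) (col : Fin r → Fin (d - 1 + 1) × Fin r),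
        ∀ i j, HasValueAtTheta ((prolongation (d - 1) (matrixR Υ B))⁻¹ (row i) (col j))
          (lieCoord U (E.lieVec (lam j)) i) := by
  obtain ⟨c, hc, s, hs, hdet⟩ := E.exists_det_theta hd hΘ
  have hdet0 : Θ.det ≠ 0 := by
    rw [hdet]
    exact mul_ne_zero (Polynomial.C_ne_zero.2 hc)
      (pow_ne_zero _ (Polynomial.X_sub_C_ne_zero _))
  refine ⟨fun B => ?_, ?_⟩
  · have h := abpConditions_matrixR hΥ hc hs hdet B
    exact ⟨h, fun l => ⟨h.prolongation l, prolongation_inv l (isUnit_det_matrixR B)⟩⟩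
  · choose lam hlam hagf using E.exists_period_of_column m hΘ hΥ
    obtain ⟨B, U, a, k, ha, h⟩ := E.exists_coordinates m hΘ hdet0 hlam fun i j => hagf j i
    -- The last block column of the prolongation contains the hyperderivatives of all orders from `d
    -- - 1` down to `0`; order `a` sits in block row `d - 1 - a`.
    refine ⟨B, U, lam, E.isPeriodBasis_of_agf m hΘ hΥ hlam fun i j => hagf j i,
      fun i => (⟨d - 1 - a i, by omega⟩, k i), fun j => (Fin.last (d - 1), j), fun i j => ?_⟩
    have hai := ha i
    rw [← prolongation_inv _ (isUnit_det_matrixR B), prolongation_apply, if_pos (Fin.le_last _)]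
    have e : ((Fin.last (d - 1) : Fin (d - 1 + 1)) : ℕ) - (d - 1 - a i) = a i := by
      rw [Fin.val_last]
      omega
    change HasValueAtTheta (hyperDeriv (((Fin.last (d - 1) : Fin (d - 1 + 1)) : ℕ) -
      (d - 1 - a i)) ((matrixR Υ B)⁻¹ (k i) j)) _
    rw [e]
    exact h i j
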